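/- **Setting.** Let $\mathfrak g$ be a finite-dimensional simple complex Lie algebra with a non-degenerate symmetric invariant bilinear form $(\cdot,\cdot)$, let $\sigma_0,\dots,\sigma_n$ be commuting automorphisms of $\mathfrak g$ of finite orders $m_0,\dots,m_n$, and let $\xi_i$ be a primitive $m_i$-th root of unity. For $(k_0,k)\in\mathbb Z\times\mathbb Z^n$ put $\mathfrak g(\bar k_0,\bar k)=\{X\in\mathfrak g:\sigma_iX=\xi_i^{k_i}X,\ 0\le i\le n\}$. Assume that $\mathfrak g(\bar 0,\bar 0)$ is simple, fix a Cartan subalgebra $\mathfrak h(0)$ of it, let $\Delta_0$ be its root system and fix simple roots $\alpha_1,\dots,\alpha_d$ of $\Delta_0$. Assume that $LT=\bigoplus_{(k_0,k)}\mathfrak g(\bar k_0,\bar k)\,t_0^{k_0}t^k$ is a Lie torus: as a $\mathfrak g(\bar 0,\bar 0)$-module each $\mathfrak g(\bar k_0,\bar k)$ is the direct sum of a trivial module and of a module that is either zero or irreducible with highest weight equal to the highest root of $\Delta_0$, or to the highest short root if $\Delta_0$ is not simply laced, or to twice the highest short root if $\Delta_0$ is of type $B_l$ ($l\ge1$, $B_1=A_1$,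 all roots of a simply laced system counting as short). Let $A(m)=\mathbb C[t_1^{\pm m_1},\dots,t_n^{\pm m_n}]$ and let $\mathfrak L=LT\oplus (K\otimes A(m))\oplus\mathbb C d_0$ be the Lie algebra in which $K\otimes A(m)$ is central, $[d_0,Xt_0^{k_0}t^k]=k_0Xt_0^{k_0}t^k$, and $$[Xt_0^{k_0}t^k,\,Yt_0^{l_0}t^l]=[X,Y]t_0^{k_0+l_0}t^{k+l}+k_0\,(X,Y)\,\delta_{k_0+l_0,0}\,K\otimes t^{k+l}.$$ For $\alpha\in\mathfrak h(0)^*$ let $\mathfrak g(\bar k_0,\bar k,\alpha)$ be the $\alpha$-weight space of $\mathfrak h(0)$ in $\mathfrak g(\bar k_0,\bar k)$; let $\mathfrak L_{\alpha+k_0\delta}=\bigoplus_k\mathfrak g(\bar k_0,\bar k,\alpha)t_0^{k_0}t^k$ if $(\alpha,k_0)\ne(0,0)$, and $\mathfrak L^0=\mathfrak L_0=\bigoplus_k\mathfrak g(\bar 0,\bar k,0)t^k\oplus (K\otimes A(m))\oplus\mathbb Cd_0$. Let $\mathfrak L^+$ be the sum of the $\mathfrak L_{\alpha+k_0\delta}$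 with $k_0>0$, or with $k_0=0$ and $\alpha$ a nonzero sum of simple roots. For an ideal $J$ of $A(m)$ let $$\mathfrak L(J)=\bigoplus_{k_0,\bar k}\mathfrak g(\bar k_0,\bar k)t_0^{k_0}t^kJ\oplus (K\otimes J),\qquad \mathfrak L^0(J)=\bigoplus_{\bar k}\mathfrak g(\bar 0,\bar k,0)t^kJ\oplus (K\otimes J);$$ $\mathfrak L(J)$ is an ideal of $\mathfrak L$, and $\mathfrak L/\mathfrak L(J)$ is denoted $\mathfrak L(A(m)/J)\oplus\mathbb Cd_0$. Let $N$ be a finite-dimensional irreducible $\mathfrak L^0$-module, let $M(N)=U(\mathfrak L)\otimes_{U(\mathfrak L^+\oplus\mathfrak L^0)}N$ with $\mathfrak L^+$ acting on $N$ by zero, and let $V(N)$ be the irreducible quotient of $M(N)$. Assume that $V(N)$ is integrable: it is the direct sum of its weight spaces with respect to $\mathfrak h(0)\oplus\mathbb CK\oplus\mathbb Cd_0$, these are finite-dimensional, and every element of every $\mathfrak L_{\alpha+k_0\delta}$ with $\alpha\ne0$ acts locally nilpotently on $V(N)$. **Proposition.** There are one-variable polynomials $P_1,\dots,P_n\in\mathbb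 C[x]$ with constant term $1$ such that the ideal $I$ of $A(m)$ generated by $P_1(t_1^{m_1}),\dots,P_n(t_n^{m_n})$ is co-finite and $\mathfrak L^0(I)\cdot N=0$. Moreover, let $P_1,\dots,P_n\in\mathbb C[x]$ be any polynomials with nonzero constant terms such that $\mathfrak L^0(I)\cdot N=0$ for the ideal $I$ generated by the $P_i(t_i^{m_i})$. Let $P_i'(x)=\prod_c(x-c)$, the product being over the distinct roots $c$ of $P_i$, and let $I'$ be the ideal of $A(m)$ generated by the $P_i'(t_i^{m_i})$. Then $$\mathfrak L(I')\cdot V(N)=0,$$ and hence the action of $\mathfrak L$ on $V(N)$ factors through $\mathfrak L/\mathfrak L(I')=\mathfrak L(A(m)/I')\oplus\mathbb Cd_0$. -/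

import Mathlib

open scoped TensorProduct Polynomial

noncomputable section

namespace LieTorus

universe u v w

/-! ### Laurent polynomials and the loop algebra `𝔤 ⊗ A` -/

/-- The algebra `A = ℂ[t₀^{±1}, …, tₙ^{±1}]`; the monomial `t₀^{κ 0} ⋯ tₙ^{κ n}` is `single κ 1`. -/
abbrev Laurent (n : ℕ) : Type := AddMonoidAlgebra ℂ (Fin (n + 1) → ℤ)

/-- The derivation `t₀ ∂/∂t₀` of `A`. -/
def degZero (n : ℕ) : Laurent n →ₗ[ℂ] Laurent n :=
  (AddMonoidAlgebra.basis (Fin (n + 1) → ℤ) ℂ).constr ℂ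
    fun κ => AddMonoidAlgebra.single κ (κ 0 : ℂ)

/-- The Lie algebra `𝔤 ⊗ A`, with bracket `[X ⊗ f, Y ⊗ g] = [X, Y] ⊗ fg`. -/
def Loop (n : ℕ) (𝔤 : Type u) [LieRing 𝔤] [LieAlgebra ℂ 𝔤] : Type u := Laurent n ⊗[ℂ] 𝔤

namespace Loop

variable {n : ℕ} {𝔤 : Type u} [LieRing 𝔤] [LieAlgebra ℂ 𝔤]

instance : LieRing (Loop n 𝔤) := inferInstanceAs (LieRing (Laurent n ⊗[ℂ] 𝔤))

instance : LieAlgebra ℂ (Loop n 𝔤) := inferInstanceAs (LieAlgebra ℂ (Laurent n ⊗[ℂ] 𝔤))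

/-- The element `X ⊗ f` of `𝔤 ⊗ A`. -/
def tmul (f : Laurent n) (X : 𝔤) : Loop n 𝔤 := f ⊗ₜ[ℂ] X

/-- The derivation `t₀ ∂/∂t₀` of `𝔤 ⊗ A`. -/
def der : Loop n 𝔤 →ₗ[ℂ] Loop n 𝔤 :=
  (LinearMap.rTensor 𝔤 (degZero n) : Laurent n ⊗[ℂ] 𝔤 →ₗ[ℂ] Laurent n ⊗[ℂ] 𝔤)

/-- The extension `(X ⊗ f, Y ⊗ g) = (X, Y) fg` of a bilinear form on `𝔤`. -/
def formAux (B : LinearMap.BilinForm ℂ 𝔤) :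
    Laurent n ⊗[ℂ] 𝔤 →ₗ[ℂ] Laurent n ⊗[ℂ] 𝔤 →ₗ[ℂ] Laurent n :=
  LinearMap.mk₂ ℂ (fun x y => LinearMap.BilinForm.baseChange (Laurent n) B x y)
    (fun x x' y => by simp) (fun c x y => by simp [LinearMap.map_smul_of_tower])
    (fun x y y' => by simp) (fun c x y => by simp [LinearMap.map_smul_of_tower])

/-- The extension `(X ⊗ f, Y ⊗ g) = (X, Y) fg` of a bilinear form on `𝔤`. -/
def form (B : LinearMap.BilinForm ℂ 𝔤) : Loop n 𝔤 →ₗ[ℂ] Loop n 𝔤 →ₗ[ℂ] Laurent n := formAux B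

theorem tmul_lie_tmul (f g : Laurent n) (X Y : 𝔤) :
    ⁅tmul f X, tmul g Y⁆ = tmul (f * g) ⁅X, Y⁆ := rfl

theorem der_tmul (f : Laurent n) (X : 𝔤) : der (tmul f X) = tmul (degZero n f) X := rfl

theorem form_tmul (B : LinearMap.BilinForm ℂ 𝔤) (f g : Laurent n) (X Y : 𝔤) :
    form B (tmul f X) (tmul g Y) = B X Y • (f * g) := rfl

theorem add_tmul (f g : Laurent n) (X : 𝔤) : tmul (f + g) X = tmul f X + tmul g X :=
  TensorProduct.add_tmul f g X

/-- Induction on elements of `𝔤 ⊗ A`. -/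
theorem induction {p : Loop n 𝔤 → Prop} (x : Loop n 𝔤) (h0 : p 0) (h1 : ∀ f X, p (tmul f X))
    (h2 : ∀ x y, p x → p y → p (x + y)) : p x :=
  TensorProduct.induction_on (motive := p) x h0 h1 h2

/-- Induction on Laurent polynomials, by linearity. -/
theorem laurent_induction {p : Laurent n → Prop} (f : Laurent n)
    (h1 : ∀ κ, p (AddMonoidAlgebra.single κ 1)) (h2 : ∀ f g, p f → p g → p (f + g))
    (h3 : ∀ (c : ℂ) f, p f → p (c • f)) : p f := by
  have hf := (AddMonoidAlgebra.basis (Fin (n + 1) → ℤ) ℂ).mem_span f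
  induction hf using Submodule.span_induction with
  | mem x hx => obtain ⟨κ, rfl⟩ := hx; simpa using h1 κ
  | zero => simpa using h3 0 _ (h1 0)
  | add x y _ _ hx hy => exact h2 x y hx hy
  | smul c x _ hx => exact h3 c x hx

theorem degZero_single (κ : Fin (n + 1) → ℤ) (c : ℂ) :
    degZero n (AddMonoidAlgebra.single κ c) = AddMonoidAlgebra.single κ ((κ 0 : ℂ) * c) := by
  have h : (AddMonoidAlgebra.single κ c : Laurent n) =
      c • AddMonoidAlgebra.basis (Fin (n + 1) → ℤ) ℂ κ := by simp
  rw [h, map_smul, degZero, Module.Basis.constr_basis]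
  simp [mul_comm]

theorem degZero_mul (f g : Laurent n) :
    degZero n (f * g) = degZero n f * g + f * degZero n g := by
  induction f using laurent_induction with
  | h2 a b ha hb => simp only [add_mul, map_add, ha, hb]; abel
  | h3 c a ha => simp only [smul_mul_assoc, map_smul, ha, smul_add]
  | h1 κ =>
    induction g using laurent_induction with
    | h2 a b ha hb => simp only [mul_add, map_add, ha, hb]; abel
    | h3 c a ha => simp only [mul_smul_comm, map_smul, ha, smul_add]
    | h1 μ =>
      simp only [AddMonoidAlgebra.single_mul_single, degZero_single, ← AddMonoidAlgebra.single_add]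
      congr 1
      simp

theorem der_lie (x y : Loop n 𝔤) : der ⁅x, y⁆ = ⁅der x, y⁆ + ⁅x, der y⁆ := by
  induction x using Loop.induction with
  | h0 => simp
  | h2 a b ha hb => simp only [add_lie, map_add, ha, hb]; abel
  | h1 f X =>
    induction y using Loop.induction with
    | h0 => simp
    | h2 a b ha hb => simp only [lie_add, map_add, ha, hb]; abel
    | h1 g Y => simp only [der_tmul, tmul_lie_tmul, degZero_mul, add_tmul]

theorem form_symm {B : LinearMap.BilinForm ℂ 𝔤} (hB : ∀ X Y, B X Y = B Y X) (x y : Loop n 𝔤) :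
    form B x y = form B y x := by
  induction x using Loop.induction with
  | h0 => simp
  | h2 a b ha hb => simp only [map_add, LinearMap.add_apply, ha, hb]
  | h1 f X =>
    induction y using Loop.induction with
    | h0 => simp
    | h2 a b ha hb => simp only [map_add, LinearMap.add_apply, ha, hb]
    | h1 g Y => simp only [form_tmul, hB X Y, mul_comm]

theorem form_invariant {B : LinearMap.BilinForm ℂ 𝔤} (hB : ∀ X Y Z, B ⁅X, Y⁆ Z = B X ⁅Y, Z⁆)
    (x y z : Loop n 𝔤) : form B ⁅x, y⁆ z = form B x ⁅y, z⁆ := by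
  induction x using Loop.induction with
  | h0 => simp
  | h2 a b ha hb => simp only [map_add, add_lie, LinearMap.add_apply, ha, hb]
  | h1 f X =>
    induction y using Loop.induction with
    | h0 => simp
    | h2 a b ha hb => simp only [map_add, lie_add, add_lie, LinearMap.add_apply, ha, hb]
    | h1 g Y =>
      induction z using Loop.induction with
      | h0 => simp
      | h2 a b ha hb => simp only [map_add, lie_add, ha, hb]
      | h1 h Z => simp only [form_tmul, tmul_lie_tmul, hB, mul_assoc]

theorem degZero_form (B : LinearMap.BilinForm ℂ 𝔤) (x y : Loop n 𝔤) :
    degZero n (form B x y) = form B (der x) y + form B x (der y) := by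
  induction x using Loop.induction with
  | h0 => simp
  | h2 a b ha hb => simp only [map_add, LinearMap.add_apply, ha, hb]; abel
  | h1 f X =>
    induction y using Loop.induction with
    | h0 => simp
    | h2 a b ha hb => simp only [map_add, ha, hb]; abel
    | h1 g Y => simp only [form_tmul, der_tmul, degZero_mul, map_smul, smul_add]

end Loop

/-! ### The data defining a multiloop algebra -/

/-- A non-degenerate symmetric invariant bilinear form on `𝔤`, commuting automorphisms
`σ₀, …, σₙ` of `𝔤` of finite orders `m₀, …, mₙ`, and primitive `mᵢ`-th roots of unity `ξᵢ`. -/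
structure Datum (n : ℕ) (𝔤 : Type u) [LieRing 𝔤] [LieAlgebra ℂ 𝔤] where
  form : LinearMap.BilinForm ℂ 𝔤
  form_nondegenerate : form.Nondegenerate
  form_symm : ∀ X Y, form X Y = form Y X
  form_invariant : ∀ X Y Z, form ⁅X, Y⁆ Z = form X ⁅Y, Z⁆
  σ : Fin (n + 1) → (𝔤 ≃ₗ⁅ℂ⁆ 𝔤)
  σ_comm : ∀ i j X, σ i (σ j X) = σ j (σ i X)
  σ_finite : ∀ i, IsOfFinOrder (σ i).toLinearEquiv
  ξ : Fin (n + 1) → ℂ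
  ξ_primitive : ∀ i, IsPrimitiveRoot (ξ i) (orderOf (σ i).toLinearEquiv)

namespace Datum

variable {n : ℕ} {𝔤 : Type u} [LieRing 𝔤] [LieAlgebra ℂ 𝔤] (D : Datum n 𝔤)

/-- The order `mᵢ` of `σᵢ`. -/
def m (i : Fin (n + 1)) : ℕ := orderOf (D.σ i).toLinearEquiv

/-- The lattice `Γ = m₁ℤ ⊕ ⋯ ⊕ mₙℤ ⊆ ℤⁿ`. -/
def Γ : AddSubgroup (Fin n → ℤ) where
  carrier := {k | ∀ i, (D.m i.succ : ℤ) ∣ k i}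
  add_mem' {a b} ha hb := fun i => by
    rw [Pi.add_apply]; exact dvd_add (ha i) (hb i)
  zero_mem' := fun i => by rw [Pi.zero_apply]; exact dvd_zero _
  neg_mem' {a} ha := fun i => by rw [Pi.neg_apply]; exact (dvd_neg).2 (ha i)

/-- The algebra `A(m) = ℂ[t₁^{±m₁}, …, tₙ^{±mₙ}]`, as the group algebra of `Γ`. -/
abbrev Am : Type := AddMonoidAlgebra ℂ D.Γ

/-- The inclusion of exponents `Γ ⊆ ℤⁿ ⊆ ℤ^{n+1}`, with `t₀`-exponent zero. -/
def expIncl : D.Γ →+ (Fin (n + 1) → ℤ) where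
  toFun γ := Fin.cons 0 (γ : Fin n → ℤ)
  map_zero' := by ext i; refine Fin.cases ?_ (fun j => ?_) i <;> simp
  map_add' a b := by ext i; refine Fin.cases ?_ (fun j => ?_) i <;> simp

/-- The inclusion `A(m) ⊆ A`. -/
def incl : D.Am →ₐ[ℂ] Laurent n := AddMonoidAlgebra.mapDomainAlgHom ℂ ℂ D.expIncl

open Classical in
/-- The linear projection `A → A(m)` which fixes the monomials lying in `A(m)` and kills all the
other monomials. -/
def res : Laurent n →ₗ[ℂ] D.Am :=
  (AddMonoidAlgebra.basis (Fin (n + 1) → ℤ) ℂ).constr ℂ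
    fun κ => if h : κ 0 = 0 ∧ Fin.tail κ ∈ D.Γ then AddMonoidAlgebra.single ⟨Fin.tail κ, h.2⟩ 1
      else 0

theorem res_single_one (κ : Fin (n + 1) → ℤ) [Decidable (κ 0 = 0 ∧ Fin.tail κ ∈ D.Γ)] :
    D.res (AddMonoidAlgebra.single κ 1) =
      if h : κ 0 = 0 ∧ Fin.tail κ ∈ D.Γ then AddMonoidAlgebra.single ⟨Fin.tail κ, h.2⟩ 1
      else 0 := by
  have h : (AddMonoidAlgebra.single κ 1 : Laurent n) =
      AddMonoidAlgebra.basis (Fin (n + 1) → ℤ) ℂ κ := by simp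
  rw [h, res, Module.Basis.constr_basis]
  congr

theorem res_degZero (f : Laurent n) : D.res (degZero n f) = 0 := by
  classical
  induction f using Loop.laurent_induction with
  | h2 a b ha hb => simp [ha, hb]
  | h3 c a ha => simp [ha]
  | h1 κ =>
    have h : degZero n (AddMonoidAlgebra.single κ 1) =
        (κ 0 : ℂ) • (AddMonoidAlgebra.single κ 1 : Laurent n) := by simp [Loop.degZero_single]
    rw [h, map_smul, res_single_one]
    split_ifs with h
    · simp [h.1]
    · simp

/-- The cocycle with values in `A(m)`; on homogeneous elements,
`cocycle (X t^κ) (Y t^μ) = κ₀ (X, Y) res (t^{κ+μ})`. -/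
def cocycle : Loop n 𝔤 →ₗ[ℂ] Loop n 𝔤 →ₗ[ℂ] D.Am :=
  ((Loop.form D.form).comp Loop.der).compr₂ D.res

theorem cocycle_apply (x y : Loop n 𝔤) :
    D.cocycle x y = D.res (Loop.form D.form (Loop.der x) y) := rfl

theorem cocycle_swap (x y : Loop n 𝔤) : D.cocycle x y = -D.cocycle y x := by
  have h := D.res_degZero (Loop.form D.form x y)
  rw [Loop.degZero_form, map_add, Loop.form_symm D.form_symm x (Loop.der y)] at h
  exact eq_neg_of_add_eq_zero_left h

theorem cocycle_self (x : Loop n 𝔤) : D.cocycle x x = 0 := by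
  have h : (2 : ℂ) • D.cocycle x x = 0 := by
    rw [two_smul, add_eq_zero_iff_eq_neg]
    exact D.cocycle_swap x x
  exact (smul_eq_zero.1 h).resolve_left two_ne_zero

theorem cocycle_der (x y : Loop n 𝔤) :
    D.cocycle (Loop.der x) y + D.cocycle x (Loop.der y) = 0 := by
  have h := D.res_degZero (Loop.form D.form (Loop.der x) y)
  rwa [Loop.degZero_form, map_add] at h

theorem cocycle_lie (x y z : Loop n 𝔤) :
    D.cocycle x ⁅y, z⁆ = D.cocycle ⁅x, y⁆ z + D.cocycle y ⁅x, z⁆ := by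
  have inv := Loop.form_invariant (n := n) D.form_invariant
  have symm := Loop.form_symm (n := n) D.form_symm
  have h := D.res_degZero (Loop.form D.form y ⁅x, z⁆)
  rw [Loop.degZero_form, map_add, Loop.der_lie] at h
  have e1 : Loop.form D.form (Loop.der x) ⁅y, z⁆ = -Loop.form D.form y ⁅Loop.der x, z⁆ := by
    rw [← inv, ← inv, ← lie_skew, map_neg, LinearMap.neg_apply]
  rw [cocycle_apply, cocycle_apply, cocycle_apply, Loop.der_lie, e1]
  have e2 : Loop.form D.form ⁅Loop.der x, y⁆ z = -Loop.form D.form y ⁅Loop.der x, z⁆ := by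
    rw [← lie_skew, map_neg, LinearMap.neg_apply, inv]
  have e3 : Loop.form D.form ⁅x, Loop.der y⁆ z = -Loop.form D.form (Loop.der y) ⁅x, z⁆ := by
    rw [← lie_skew, map_neg, LinearMap.neg_apply, inv]
  rw [map_add, LinearMap.add_apply, map_add, e2, e3]
  simp

/-! ### The ambient Lie algebra `(𝔤 ⊗ A) ⊕ (K ⊗ A(m)) ⊕ ℂ d₀` -/

/-- `(𝔤 ⊗ A) ⊕ (K ⊗ A(m)) ⊕ ℂ d₀`. -/
def Ambient : Type u := Loop n 𝔤 × D.Am × ℂ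

namespace Ambient

instance : AddCommGroup D.Ambient := inferInstanceAs (AddCommGroup (Loop n 𝔤 × D.Am × ℂ))

instance : Module ℂ D.Ambient := inferInstanceAs (Module ℂ (Loop n 𝔤 × D.Am × ℂ))

variable {D}

/-- The element `x + K ⊗ f + c d₀`. -/
def mk (x : Loop n 𝔤) (f : D.Am) (c : ℂ) : D.Ambient := (x, f, c)

/-- The component in `𝔤 ⊗ A`. -/
def loop : D.Ambient →ₗ[ℂ] Loop n 𝔤 := LinearMap.fst ℂ (Loop n 𝔤) (D.Am × ℂ)

/-- The component `f ∈ A(m)` of the central part `K ⊗ f`. -/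
def cen : D.Ambient →ₗ[ℂ] D.Am :=
  (LinearMap.fst ℂ D.Am ℂ).comp (LinearMap.snd ℂ (Loop n 𝔤) (D.Am × ℂ))

/-- The coefficient of `d₀`. -/
def dCoeff : D.Ambient →ₗ[ℂ] ℂ :=
  (LinearMap.snd ℂ D.Am ℂ).comp (LinearMap.snd ℂ (Loop n 𝔤) (D.Am × ℂ))

theorem ext {a b : D.Ambient} (h1 : loop a = loop b) (h2 : cen a = cen b)
    (h3 : dCoeff a = dCoeff b) : a = b := Prod.ext h1 (Prod.ext h2 h3)

@[simp] theorem loop_mk (x : Loop n 𝔤) (f : D.Am) (c : ℂ) : loop (mk x f c) = x := rfl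

@[simp] theorem cen_mk (x : Loop n 𝔤) (f : D.Am) (c : ℂ) : cen (mk x f c) = f := rfl

@[simp] theorem dCoeff_mk (x : Loop n 𝔤) (f : D.Am) (c : ℂ) : dCoeff (mk x f c) = c := rfl

/-- On homogeneous elements: `[X t^κ, Y t^μ] = [X, Y] t^{κ+μ} + κ₀ (X, Y) K ⊗ res (t^{κ+μ})`,
the elements `K ⊗ f` are central, and `[d₀, X t^κ] = κ₀ X t^κ`. -/
instance : Bracket D.Ambient D.Ambient where
  bracket a b := mk
    (⁅loop a, loop b⁆ + dCoeff a • Loop.der (loop b) - dCoeff b • Loop.der (loop a))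
    (D.cocycle (loop a) (loop b)) 0

theorem loop_lie (a b : D.Ambient) : loop ⁅a, b⁆ =
    ⁅loop a, loop b⁆ + dCoeff a • Loop.der (loop b) - dCoeff b • Loop.der (loop a) := rfl

theorem cen_lie (a b : D.Ambient) : cen ⁅a, b⁆ = D.cocycle (loop a) (loop b) := rfl

theorem dCoeff_lie (a b : D.Ambient) : dCoeff ⁅a, b⁆ = 0 := rfl

theorem jacobi_aux {L : Type u} [LieRing L] [LieAlgebra ℂ L] (d : L →ₗ[ℂ] L)
    (hd : ∀ x y, d ⁅x, y⁆ = ⁅d x, y⁆ + ⁅x, d y⁆) (x y z : L) (a b c : ℂ) :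
    ⁅x, ⁅y, z⁆ + b • d z - c • d y⁆ + a • d (⁅y, z⁆ + b • d z - c • d y) - (0 : ℂ) • d x =
      ⁅⁅x, y⁆ + a • d y - b • d x, z⁆ + (0 : ℂ) • d z - c • d (⁅x, y⁆ + a • d y - b • d x) +
      (⁅y, ⁅x, z⁆ + a • d z - c • d x⁆ + b • d (⁅x, z⁆ + a • d z - c • d x) - (0 : ℂ) • d y) := by
  simp only [map_add, map_sub, map_smul, hd, lie_add, add_lie, lie_sub, sub_lie, lie_smul,
    smul_lie, leibniz_lie x y z, ← lie_skew (d x) y]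
  module

theorem jacobi_aux' {L : Type u} {M : Type v} [LieRing L] [LieAlgebra ℂ L] [AddCommGroup M]
    [Module ℂ M] (d : L →ₗ[ℂ] L) (ψ : L →ₗ[ℂ] L →ₗ[ℂ] M) (h1 : ∀ x y, ψ x y = -ψ y x)
    (h2 : ∀ x y, ψ (d x) y + ψ x (d y) = 0)
    (h3 : ∀ x y z, ψ x ⁅y, z⁆ = ψ ⁅x, y⁆ z + ψ y ⁅x, z⁆) (x y z : L) (a b c : ℂ) :
    ψ x (⁅y, z⁆ + b • d z - c • d y) =
      ψ (⁅x, y⁆ + a • d y - b • d x) z + ψ y (⁅x, z⁆ + a • d z - c • d x) := by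
  simp only [map_add, map_sub, map_smul, LinearMap.add_apply, LinearMap.sub_apply,
    LinearMap.smul_apply, h3 x y z]
  rw [eq_neg_of_add_eq_zero_left (h2 x z), eq_neg_of_add_eq_zero_left (h2 y z), h1 x (d y),
    eq_neg_of_add_eq_zero_left (h2 y x)]
  module

instance : LieRing D.Ambient where
  add_lie a b c := by
    apply ext
    · simp only [map_add, loop_lie, add_lie, add_smul, smul_add]; abel
    · simp only [map_add, cen_lie, LinearMap.add_apply]
    · simp [dCoeff_lie]
  lie_add a b c := by
    apply ext
    · simp only [map_add, loop_lie, lie_add, add_smul, smul_add]; abel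
    · simp only [map_add, cen_lie]
    · simp [dCoeff_lie]
  lie_self a := by
    apply ext
    · simp [loop_lie]
    · simp [cen_lie, cocycle_self]
    · simp [dCoeff_lie]
  leibniz_lie a b c := by
    apply ext
    · simp only [map_add, loop_lie, dCoeff_lie]
      exact jacobi_aux Loop.der Loop.der_lie _ _ _ _ _ _
    · simp only [map_add, cen_lie, loop_lie]
      exact jacobi_aux' Loop.der D.cocycle D.cocycle_swap D.cocycle_der D.cocycle_lie _ _ _ _ _ _
    · simp [dCoeff_lie]

instance : LieAlgebra ℂ D.Ambient where
  lie_smul c a b := by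
    apply ext
    · simp only [map_smul, loop_lie, lie_smul, smul_sub, smul_add, smul_assoc,
        smul_comm (dCoeff a) c]
    · simp only [map_smul, cen_lie]
    · simp [dCoeff_lie]

end Ambient

/-! ### The multiloop algebra and the Lie algebra `𝔏` -/

/-- `𝔤(k̄₀, k̄) = {X ∈ 𝔤 | σᵢ X = ξᵢ ^ κᵢ X, 0 ≤ i ≤ n}` for `κ = (k₀, k)`. -/
def graded (κ : Fin (n + 1) → ℤ) : Submodule ℂ 𝔤 where
  carrier := {X | ∀ i, D.σ i X = D.ξ i ^ κ i • X}
  add_mem' {X Y} hX hY i := by rw [map_add, hX i, hY i, smul_add]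
  zero_mem' i := by simp
  smul_mem' c X hX i := by rw [map_smul, hX i, smul_comm]

/-- The subalgebra `𝔤(0̄, 0̄)` of fixed points of `σ₀, …, σₙ`. -/
def fixed : LieSubalgebra ℂ 𝔤 where
  carrier := {X | ∀ i, D.σ i X = X}
  add_mem' {X Y} hX hY i := by rw [map_add, hX i, hY i]
  zero_mem' i := by simp
  smul_mem' c X hX i := by rw [map_smul, hX i]
  lie_mem' {X Y} hX hY i := by
    rw [LieEquiv.map_lie, hX i, hY i]

theorem ξ_ne_zero (i : Fin (n + 1)) : D.ξ i ≠ 0 :=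
  (D.ξ_primitive i).ne_zero (D.σ_finite i).orderOf_pos.ne'

theorem lie_mem_graded {κ μ : Fin (n + 1) → ℤ} {X Y : 𝔤} (hX : X ∈ D.graded κ)
    (hY : Y ∈ D.graded μ) : ⁅X, Y⁆ ∈ D.graded (κ + μ) := fun i => by
  rw [LieEquiv.map_lie, hX i, hY i, Pi.add_apply, zpow_add₀ (D.ξ_ne_zero i), smul_lie, lie_smul,
    smul_smul]

theorem mem_graded_zero (X : D.fixed) : (X : 𝔤) ∈ D.graded 0 := fun i => by
  simpa using X.2 i

/-- `𝔤(k̄₀, k̄)` as a module over `𝔤(0̄, 0̄)`. -/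
def gradedModule (κ : Fin (n + 1) → ℤ) : LieSubmodule ℂ D.fixed 𝔤 where
  __ := D.graded κ
  lie_mem {X Y} hY := by
    have h := D.lie_mem_graded (D.mem_graded_zero X) hY
    rw [zero_add] at h
    exact h

/-- Given subsets `S κ ⊆ 𝔤`, the span of all `X t^κ` with `X ∈ S κ`. -/
def homSpan (S : (Fin (n + 1) → ℤ) → Set 𝔤) : Submodule ℂ (Loop n 𝔤) :=
  Submodule.span ℂ {x | ∃ κ, ∃ X ∈ S κ, x = Loop.tmul (AddMonoidAlgebra.single κ 1) X}

/-- Given subsets `S κ ⊆ 𝔤`, the span of all `X t^κ f` with `X ∈ S κ` and `f ∈ I`. -/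
def homSpanIdeal (S : (Fin (n + 1) → ℤ) → Set 𝔤) (I : Ideal D.Am) : Submodule ℂ (Loop n 𝔤) :=
  Submodule.span ℂ {x | ∃ κ, ∃ X ∈ S κ, ∃ f ∈ I,
    x = Loop.tmul (AddMonoidAlgebra.single κ 1 * D.incl f) X}

/-- The multiloop algebra `LT = ⨁ 𝔤(k̄₀, k̄) t₀^{k₀} t^k`. -/
def LT : Submodule ℂ (Loop n 𝔤) := homSpan fun κ => D.graded κ

theorem degZero_single_one (κ : Fin (n + 1) → ℤ) :
    degZero n (AddMonoidAlgebra.single κ 1) =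
      (κ 0 : ℂ) • (AddMonoidAlgebra.single κ 1 : Laurent n) := by simp [Loop.degZero_single]

theorem smul_tmul (c : ℂ) (f : Laurent n) (X : 𝔤) :
    Loop.tmul (c • f) X = c • Loop.tmul f X := rfl

theorem homSpan_der (S : (Fin (n + 1) → ℤ) → Set 𝔤) {x : Loop n 𝔤} (hx : x ∈ homSpan S) :
    Loop.der x ∈ homSpan S := by
  induction hx using Submodule.span_induction with
  | mem x hx =>
    obtain ⟨κ, X, hX, rfl⟩ := hx
    rw [Loop.der_tmul, degZero_single_one, smul_tmul]
    exact Submodule.smul_mem _ _ (Submodule.subset_span ⟨κ, X, hX, rfl⟩)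
  | zero => simp
  | add x y _ _ hx hy => rw [map_add]; exact add_mem hx hy
  | smul c x _ hx => rw [map_smul]; exact Submodule.smul_mem _ _ hx

theorem homSpan_lie {S T U : (Fin (n + 1) → ℤ) → Set 𝔤}
    (h : ∀ κ μ, ∀ X ∈ S κ, ∀ Y ∈ T μ, ⁅X, Y⁆ ∈ U (κ + μ)) {x y : Loop n 𝔤}
    (hx : x ∈ homSpan S) (hy : y ∈ homSpan T) : ⁅x, y⁆ ∈ homSpan U := by
  induction hx using Submodule.span_induction with
  | mem x hx =>
    obtain ⟨κ, X, hX, rfl⟩ := hx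
    induction hy using Submodule.span_induction with
    | mem y hy =>
      obtain ⟨μ, Y, hY, rfl⟩ := hy
      refine Submodule.subset_span ⟨κ + μ, ⁅X, Y⁆, h κ μ X hX Y hY, ?_⟩
      rw [Loop.tmul_lie_tmul, AddMonoidAlgebra.single_mul_single, one_mul]
    | zero => simp
    | add y z _ _ hy hz => rw [lie_add]; exact add_mem hy hz
    | smul c y _ hy => rw [lie_smul]; exact Submodule.smul_mem _ _ hy
  | zero => simp
  | add x z _ _ hx hz => rw [add_lie]; exact add_mem hx hz
  | smul c x _ hx => rw [smul_lie]; exact Submodule.smul_mem _ _ hx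

/-- The Lie algebra `𝔏 = LT ⊕ (K ⊗ A(m)) ⊕ ℂ d₀`. If `X ∈ 𝔤(κ)`, `Y ∈ 𝔤(μ)` and `(X, Y) ≠ 0`, then
`κ + μ` is divisible by `(m₀, …, mₙ)`, because the form is invariant under the `σᵢ`; so `res`
discards nothing in the brackets of `𝔏`, and
`[X t^κ, Y t^μ] = [X, Y] t^{κ+μ} + κ₀ (X, Y) δ_{κ₀+μ₀,0} K ⊗ t^{k+l}`, where `κ = (κ₀, k)` and
`μ = (μ₀, l)`. -/
def L : LieSubalgebra ℂ D.Ambient where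
  carrier := {x | Ambient.loop x ∈ D.LT}
  add_mem' {x y} hx hy := by
    change Ambient.loop (x + y) ∈ D.LT
    rw [map_add]; exact add_mem hx hy
  zero_mem' := by
    change Ambient.loop (0 : D.Ambient) ∈ D.LT
    rw [map_zero]; exact zero_mem _
  smul_mem' c x hx := by
    change Ambient.loop (c • x) ∈ D.LT
    rw [map_smul]; exact Submodule.smul_mem _ _ hx
  lie_mem' {x y} hx hy := by
    change Ambient.loop ⁅x, y⁆ ∈ D.LT
    rw [Ambient.loop_lie]
    exact sub_mem (add_mem
      (homSpan_lie (fun κ μ X hX Y hY => D.lie_mem_graded hX hY) hx hy)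
      (Submodule.smul_mem _ _ (homSpan_der _ hy))) (Submodule.smul_mem _ _ (homSpan_der _ hx))

/-- The component of an element of `𝔏` in `LT ⊆ 𝔤 ⊗ A`. -/
def loopL : D.L →ₗ[ℂ] Loop n 𝔤 := Ambient.loop.comp D.L.toSubmodule.subtype

/-- The component `f` of the central part `K ⊗ f` of an element of `𝔏`. -/
def cenL : D.L →ₗ[ℂ] D.Am := Ambient.cen.comp D.L.toSubmodule.subtype

/-- The coefficient of `d₀` of an element of `𝔏`. -/
def dL : D.L →ₗ[ℂ] ℂ := Ambient.dCoeff.comp D.L.toSubmodule.subtype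

theorem loopL_lie (x y : D.L) : D.loopL ⁅x, y⁆ =
    ⁅D.loopL x, D.loopL y⁆ + D.dL x • Loop.der (D.loopL y) - D.dL y • Loop.der (D.loopL x) := rfl

theorem cenL_lie (x y : D.L) : D.cenL ⁅x, y⁆ = D.cocycle (D.loopL x) (D.loopL y) := rfl

theorem dL_lie (x y : D.L) : D.dL ⁅x, y⁆ = 0 := rfl

theorem loopL_mem (x : D.L) : D.loopL x ∈ D.LT := x.2

/-! ### The ideals `𝔏(I)` -/

theorem incl_single (γ : D.Γ) (c : ℂ) :
    D.incl (AddMonoidAlgebra.single γ c) = AddMonoidAlgebra.single (D.expIncl γ) c := by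
  simp [incl]

theorem res_mul_incl (a : Laurent n) (f : D.Am) : D.res (a * D.incl f) = D.res a * f := by
  classical
  induction a using Loop.laurent_induction with
  | h2 a b ha hb => simp only [add_mul, map_add, ha, hb]
  | h3 c a ha => simp only [smul_mul_assoc, map_smul, ha]
  | h1 κ =>
    have hf := (AddMonoidAlgebra.basis D.Γ ℂ).mem_span f
    induction hf using Submodule.span_induction with
    | zero => simp
    | add x y _ _ hx hy => simp only [mul_add, map_add, hx, hy]
    | smul c x _ hx => simp only [mul_smul_comm, map_smul, hx]
    | mem x hx =>
      obtain ⟨γ, rfl⟩ := hx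
      have e : Fin.tail (κ + D.expIncl γ) = Fin.tail κ + (γ : Fin n → ℤ) := by
        ext j; simp [expIncl, Fin.tail]
      have e0 : (κ + D.expIncl γ) 0 = κ 0 := by simp [expIncl]
      have hiff : Fin.tail κ + (γ : Fin n → ℤ) ∈ D.Γ ↔ Fin.tail κ ∈ D.Γ :=
        AddSubgroup.add_mem_cancel_right _ γ.2
      rw [AddMonoidAlgebra.basis_apply, incl_single, AddMonoidAlgebra.single_mul_single, one_mul,
        res_single_one, res_single_one]
      by_cases h : κ 0 = 0 ∧ Fin.tail κ ∈ D.Γ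
      · rw [dif_pos h, dif_pos (by rw [e0, e, hiff]; exact h), AddMonoidAlgebra.single_mul_single,
          one_mul]
        congr 1
      · rw [dif_neg h, dif_neg (by rw [e0, e, hiff]; exact h), zero_mul]

theorem degZero_incl (f : D.Am) : degZero n (D.incl f) = 0 := by
  have hf := (AddMonoidAlgebra.basis D.Γ ℂ).mem_span f
  induction hf using Submodule.span_induction with
  | zero => simp
  | add x y _ _ hx hy => simp only [map_add, hx, hy, add_zero]
  | smul c x _ hx => simp only [map_smul, hx, smul_zero]
  | mem x hx =>
    obtain ⟨γ, rfl⟩ := hx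
    rw [AddMonoidAlgebra.basis_apply, incl_single, Loop.degZero_single]
    simp [expIncl]

theorem homSpanIdeal_der (S : (Fin (n + 1) → ℤ) → Set 𝔤) (I : Ideal D.Am) {x : Loop n 𝔤}
    (hx : x ∈ D.homSpanIdeal S I) : Loop.der x ∈ D.homSpanIdeal S I := by
  induction hx using Submodule.span_induction with
  | mem x hx =>
    obtain ⟨κ, X, hX, f, hf, rfl⟩ := hx
    rw [Loop.der_tmul, Loop.degZero_mul, degZero_single_one, degZero_incl, mul_zero, add_zero,
      smul_mul_assoc, smul_tmul]
    exact Submodule.smul_mem _ _ (Submodule.subset_span ⟨κ, X, hX, f, hf, rfl⟩)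
  | zero => simp
  | add x y _ _ hx hy => rw [map_add]; exact add_mem hx hy
  | smul c x _ hx => rw [map_smul]; exact Submodule.smul_mem _ _ hx

theorem homSpanIdeal_lie (I : Ideal D.Am) {x y : Loop n 𝔤} (hx : x ∈ D.LT)
    (hy : y ∈ D.homSpanIdeal (fun κ => D.graded κ) I) :
    ⁅x, y⁆ ∈ D.homSpanIdeal (fun κ => D.graded κ) I ∧ D.cocycle x y ∈ I := by
  induction hx using Submodule.span_induction with
  | mem x hx =>
    obtain ⟨κ, X, hX, rfl⟩ := hx
    induction hy using Submodule.span_induction with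
    | mem y hy =>
      obtain ⟨μ, Y, hY, f, hf, rfl⟩ := hy
      constructor
      · refine Submodule.subset_span ⟨κ + μ, ⁅X, Y⁆, D.lie_mem_graded hX hY, f, hf, ?_⟩
        rw [Loop.tmul_lie_tmul, ← mul_assoc, AddMonoidAlgebra.single_mul_single, one_mul]
      · rw [cocycle_apply, Loop.der_tmul, Loop.form_tmul, ← mul_assoc, map_smul, res_mul_incl]
        exact Submodule.smul_of_tower_mem I _ (I.mul_mem_left _ hf)
    | zero => simp
    | add y z _ _ hy hz =>
      rw [lie_add, map_add]; exact ⟨add_mem hy.1 hz.1, add_mem hy.2 hz.2⟩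
    | smul c y _ hy =>
      rw [lie_smul, map_smul]
      exact ⟨Submodule.smul_mem _ _ hy.1, Submodule.smul_of_tower_mem I _ hy.2⟩
  | zero => simp
  | add x z _ _ hx hz =>
    rw [add_lie, map_add, LinearMap.add_apply]; exact ⟨add_mem hx.1 hz.1, add_mem hx.2 hz.2⟩
  | smul c x _ hx =>
    rw [smul_lie, map_smul, LinearMap.smul_apply]
    exact ⟨Submodule.smul_mem _ _ hx.1, Submodule.smul_of_tower_mem I _ hx.2⟩

/-- The ideal `𝔏(I) = ⨁ 𝔤(k̄₀, k̄) t₀^{k₀} t^k I ⊕ (K ⊗ I)` of `𝔏`, for an ideal `I` of `A(m)`. -/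
def idealL (I : Ideal D.Am) : LieIdeal ℂ D.L where
  carrier := {x | D.loopL x ∈ D.homSpanIdeal (fun κ => D.graded κ) I ∧ D.cenL x ∈ I ∧ D.dL x = 0}
  add_mem' {x y} hx hy := by
    refine ⟨?_, ?_, ?_⟩
    · rw [map_add]; exact add_mem hx.1 hy.1
    · rw [map_add]; exact add_mem hx.2.1 hy.2.1
    · rw [map_add, hx.2.2, hy.2.2, add_zero]
  zero_mem' := by
    refine ⟨?_, ?_, ?_⟩ <;> rw [map_zero]
    · exact zero_mem _
    · exact zero_mem _
  smul_mem' c x hx := by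
    refine ⟨?_, ?_, ?_⟩
    · rw [map_smul]; exact Submodule.smul_mem _ _ hx.1
    · rw [map_smul]; exact Submodule.smul_of_tower_mem I _ hx.2.1
    · rw [map_smul, hx.2.2, smul_zero]
  lie_mem {x y} hy := by
    have h := D.homSpanIdeal_lie I (D.loopL_mem x) hy.1
    refine ⟨?_, ?_, D.dL_lie x y⟩
    · rw [loopL_lie, hy.2.2, zero_smul, sub_zero]
      exact add_mem h.1 (Submodule.smul_mem _ _ (D.homSpanIdeal_der _ _ hy.1))
    · rw [cenL_lie]; exact h.2

/-- The Lie algebra `𝔏(A(m)/I) ⊕ ℂ d₀`, realised as the quotient `𝔏 / 𝔏(I)`. -/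
abbrev quotientL (I : Ideal D.Am) : Type u := D.L ⧸ D.idealL I

/-! ### Root spaces, the triangular decomposition and Lie tori -/

section Roots

variable (𝔥 : LieSubalgebra ℂ D.fixed)

/-- `𝔤(k̄₀, k̄, α) = {X ∈ 𝔤(k̄₀, k̄) | [h, X] = α(h) X for all h ∈ 𝔥(0)}`. -/
def gradedRoot (κ : Fin (n + 1) → ℤ) (α : Module.Dual ℂ 𝔥) : Submodule ℂ 𝔤 where
  carrier := {X | X ∈ D.graded κ ∧ ∀ h : 𝔥, ⁅((h : D.fixed) : 𝔤), X⁆ = α h • X}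
  add_mem' {X Y} hX hY :=
    ⟨add_mem hX.1 hY.1, fun h => by rw [lie_add, hX.2 h, hY.2 h, smul_add]⟩
  zero_mem' := ⟨zero_mem _, fun h => by simp⟩
  smul_mem' c X hX :=
    ⟨Submodule.smul_mem _ _ hX.1, fun h => by rw [lie_smul, hX.2 h, smul_comm]⟩

/-- The root space `𝔏_{α + k₀δ}`. It is `⨁_k 𝔤(k̄₀, k̄, α) t₀^{k₀} t^k` if `α + k₀δ ≠ 0` and
`⨁_k 𝔤(0̄, k̄, 0) t^k ⊕ (K ⊗ A(m)) ⊕ ℂ d₀` if `α + k₀δ = 0`. -/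
def rootSpace (α : Module.Dual ℂ 𝔥) (k₀ : ℤ) : Submodule ℂ D.L where
  carrier := {x | D.loopL x ∈ homSpan (fun κ => {X | κ 0 = k₀ ∧ X ∈ D.gradedRoot 𝔥 κ α}) ∧
    (¬(α = 0 ∧ k₀ = 0) → D.cenL x = 0 ∧ D.dL x = 0)}
  add_mem' {x y} hx hy := by
    refine ⟨?_, fun h => ⟨?_, ?_⟩⟩
    · rw [map_add]; exact add_mem hx.1 hy.1
    · rw [map_add, (hx.2 h).1, (hy.2 h).1, add_zero]
    · rw [map_add, (hx.2 h).2, (hy.2 h).2, add_zero]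
  zero_mem' := by
    refine ⟨?_, fun _ => ⟨map_zero _, map_zero _⟩⟩
    rw [map_zero]; exact zero_mem _
  smul_mem' c x hx := by
    refine ⟨?_, fun h => ⟨?_, ?_⟩⟩
    · rw [map_smul]; exact Submodule.smul_mem _ _ hx.1
    · rw [map_smul, (hx.2 h).1, smul_zero]
    · rw [map_smul, (hx.2 h).2, smul_zero]

/-- The subalgebra `𝔏⁰ = 𝔏_0`. -/
def L0 : LieSubalgebra ℂ D.L where
  __ := D.rootSpace 𝔥 0 0
  lie_mem' {x y} hx hy := by
    refine ⟨?_, fun h => absurd ⟨rfl, rfl⟩ h⟩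
    rw [loopL_lie]
    refine sub_mem (add_mem (homSpan_lie ?_ hx.1 hy.1)
      (Submodule.smul_mem _ _ (homSpan_der _ hy.1))) (Submodule.smul_mem _ _ (homSpan_der _ hx.1))
    rintro κ μ X ⟨hκ, hX⟩ Y ⟨hμ, hY⟩
    refine ⟨by rw [Pi.add_apply, hκ, hμ, add_zero], D.lie_mem_graded hX.1 hY.1, fun h => ?_⟩
    rw [leibniz_lie, hX.2 h, hY.2 h]
    simp

/-- `𝔏⁰(I) = ⨁ 𝔤(0̄, k̄, 0) t^k I ⊕ (K ⊗ I)`. -/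
def L0Ideal (I : Ideal D.Am) : Submodule ℂ D.L where
  carrier := {x | D.loopL x ∈
      D.homSpanIdeal (fun κ => {X | κ 0 = 0 ∧ X ∈ D.gradedRoot 𝔥 κ 0}) I ∧
    D.cenL x ∈ I ∧ D.dL x = 0}
  add_mem' {x y} hx hy := by
    refine ⟨?_, ?_, ?_⟩
    · rw [map_add]; exact add_mem hx.1 hy.1
    · rw [map_add]; exact add_mem hx.2.1 hy.2.1
    · rw [map_add, hx.2.2, hy.2.2, add_zero]
  zero_mem' := by
    refine ⟨?_, ?_, ?_⟩ <;> rw [map_zero]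
    · exact zero_mem _
    · exact zero_mem _
  smul_mem' c x hx := by
    refine ⟨?_, ?_, ?_⟩
    · rw [map_smul]; exact Submodule.smul_mem _ _ hx.1
    · rw [map_smul]; exact Submodule.smul_of_tower_mem I _ hx.2.1
    · rw [map_smul, hx.2.2, smul_zero]

theorem tmul_one_mem_LT (h : D.fixed) : Loop.tmul 1 (h : 𝔤) ∈ D.LT :=
  Submodule.subset_span ⟨0, h, D.mem_graded_zero h, rfl⟩

/-- The identification of `𝔥(0) × ℂ × ℂ` with the abelian subalgebra
`𝔥(0) ⊕ ℂK ⊕ ℂd₀` of `𝔏`: `(h, c, e) ↦ h + cK + e d₀`. -/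
def cartanIncl (p : 𝔥 × ℂ × ℂ) : D.L :=
  ⟨Ambient.mk (Loop.tmul 1 ((p.1 : D.fixed) : 𝔤)) (AddMonoidAlgebra.single 0 p.2.1) p.2.2,
    D.tmul_one_mem_LT p.1⟩

section Modules

variable (V : Type v) [AddCommGroup V] [Module ℂ V] [LieRingModule D.L V] [LieModule ℂ D.L V]

/-- The weight space `V_λ` for `λ` in the dual of `𝔥(0) ⊕ ℂK ⊕ ℂd₀`. -/
def weightSpace (lam : Module.Dual ℂ (𝔥 × ℂ × ℂ)) : Submodule ℂ V where
  carrier := {v | ∀ p, ⁅D.cartanIncl 𝔥 p, v⁆ = lam p • v}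
  add_mem' {v w} hv hw p := by rw [lie_add, hv p, hw p, smul_add]
  zero_mem' p := by simp
  smul_mem' c v hv p := by rw [lie_smul, hv p, smul_comm]

/-- Weight modules: `V` is the direct sum of its weight spaces, and these are
finite-dimensional. -/
def IsWeightModule : Prop :=
  iSupIndep (D.weightSpace 𝔥 V) ∧ ⨆ lam, D.weightSpace 𝔥 V lam = ⊤ ∧
    ∀ lam, FiniteDimensional ℂ (D.weightSpace 𝔥 V lam)

/-- Integrable modules: weight modules on which every real root vector, that is, every element of
`𝔏_{α + k₀δ}` with `α ≠ 0`, acts locally nilpotently. -/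
def IsIntegrable : Prop :=
  D.IsWeightModule 𝔥 V ∧
    ∀ α : Module.Dual ℂ 𝔥, α ≠ 0 → ∀ k₀ : ℤ, ∀ x ∈ D.rootSpace 𝔥 α k₀, ∀ v : V,
      ∃ r : ℕ, ((LieModule.toEnd ℂ D.L V x) ^ r) v = 0

end Modules

end Roots

section LieTori

open LieAlgebra.IsKilling

variable [FiniteDimensional ℂ 𝔤] [LieAlgebra.IsSimple ℂ D.fixed]
variable {𝔥 : LieSubalgebra ℂ D.fixed} [𝔥.IsCartanSubalgebra] (b : (rootSystem 𝔥).Base)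

/-- `Q⁺`, the set of all sums of simple roots. -/
def posCone : AddSubmonoid (Module.Dual ℂ 𝔥) :=
  AddSubmonoid.closure ((rootSystem 𝔥).root '' b.support)

/-- Short roots of `Δ₀`: the roots of minimal length (so all the roots, if `Δ₀` is simply laced). -/
def IsShort (i : 𝔥.root) : Prop :=
  ∀ j : 𝔥.root,
    ((rootSystem 𝔥).RootForm ((rootSystem 𝔥).root i) ((rootSystem 𝔥).root i)).re ≤
      ((rootSystem 𝔥).RootForm ((rootSystem 𝔥).root j) ((rootSystem 𝔥).root j)).re

/-- `θ` is the highest root of `Δ₀`. -/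
def IsHighestRoot (θ : Module.Dual ℂ 𝔥) : Prop :=
  (∃ i, θ = (rootSystem 𝔥).root i) ∧ ∀ j, θ - (rootSystem 𝔥).root j ∈ D.posCone b

/-- `θ` is the highest short root of `Δ₀`. -/
def IsHighestShortRoot (θ : Module.Dual ℂ 𝔥) : Prop :=
  (∃ i, D.IsShort i ∧ θ = (rootSystem 𝔥).root i) ∧
    ∀ j, D.IsShort j → θ - (rootSystem 𝔥).root j ∈ D.posCone b

/-- `Δ₀` is of type `B_l` for some `l ≥ 1` (with `B₁ = A₁`). -/
def IsTypeB : Prop :=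
  ∃ (l : ℕ) (e : b.support ≃ Fin l), ∀ i j, b.cartanMatrix i j = CartanMatrix.B l (e i) (e j)

/-- The highest weights allowed by property (M). -/
def IsPropertyMWeight (lam : Module.Dual ℂ 𝔥) : Prop :=
  D.IsHighestRoot b lam ∨
  (¬ b.cartanMatrix.IsSimplyLaced ∧ D.IsHighestShortRoot b lam) ∨
  (D.IsTypeB b ∧ ∃ β, D.IsHighestShortRoot b β ∧ lam = (2 : ℂ) • β)

/-- Property (M) for a `𝔤(0̄, 0̄)`-submodule `W` of `𝔤`: it is irreducible, and its highest weight is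
the highest root, or the highest short root if `Δ₀` is not simply laced, or twice the highest short
root if `Δ₀` is of type `B_l`. -/
def PropertyM (W : LieSubmodule ℂ D.fixed 𝔤) : Prop :=
  LieModule.IsIrreducible ℂ D.fixed W ∧
  ∃ (lam : Module.Dual ℂ 𝔥) (w : 𝔤), w ∈ W ∧ w ≠ 0 ∧
    (∀ h : 𝔥, ⁅(h : D.fixed), w⁆ = lam h • w) ∧
    (∀ i : 𝔥.root, (rootSystem 𝔥).root i ∈ D.posCone b →
      ∀ x ∈ LieAlgebra.rootSpace 𝔥 (i : LieModule.Weight ℂ 𝔥 D.fixed), ⁅x, w⁆ = 0) ∧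
    D.IsPropertyMWeight b lam

/-- The multiloop algebra is a Lie torus: `𝔤(0̄, 0̄)` is simple (which is already an assumption here),
and each `𝔤(k̄₀, k̄)` is the direct sum of a trivial `𝔤(0̄, 0̄)`-module and of a module which is zero
or has property (M). -/
def IsLieTorus : Prop :=
  ∀ κ, ∃ U W : LieSubmodule ℂ D.fixed 𝔤,
    U ⊓ W = ⊥ ∧ U ⊔ W = D.gradedModule κ ∧ LieModule.IsTrivial D.fixed U ∧
    (W = ⊥ ∨ D.PropertyM b W)

/-- `α + k₀δ > 0`: either `k₀ > 0`, or `k₀ = 0` and `α > 0`. -/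
def IsPositive (α : Module.Dual ℂ 𝔥) (k₀ : ℤ) : Prop :=
  0 < k₀ ∨ (k₀ = 0 ∧ α ≠ 0 ∧ α ∈ D.posCone b)

/-- `𝔏⁺`, the sum of the root spaces `𝔏_{α + k₀δ}` with `α + k₀δ > 0`. -/
def Lplus : Submodule ℂ D.L :=
  ⨆ (α : Module.Dual ℂ 𝔥) (k₀ : ℤ) (_ : D.IsPositive b α k₀), D.rootSpace 𝔥 α k₀

/-! ### Highest weight modules -/

section Verma

variable (N : Type v) [AddCommGroup N] [Module ℂ N] [LieRingModule (D.L0 𝔥) N]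
  [LieModule ℂ (D.L0 𝔥) N]

/-- The relations `ux ⊗ v = u ⊗ xv` for `x ∈ 𝔏⁰` and `ux ⊗ v = 0` for `x ∈ 𝔏⁺`. -/
def vermaRel : Submodule (UniversalEnvelopingAlgebra ℂ D.L)
    (UniversalEnvelopingAlgebra ℂ D.L ⊗[ℂ] N) :=
  Submodule.span _
    ({z | ∃ (x : D.L0 𝔥) (v : N),
        z = UniversalEnvelopingAlgebra.ι ℂ (x : D.L) ⊗ₜ[ℂ] v - 1 ⊗ₜ[ℂ] ⁅x, v⁆} ∪
     {z | ∃ x ∈ D.Lplus b, ∃ v : N, z = UniversalEnvelopingAlgebra.ι ℂ x ⊗ₜ[ℂ] v})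

/-- The module `M(N) = U(𝔏) ⊗_{U(𝔏⁺ ⊕ 𝔏⁰)} N`, with `𝔏⁺` acting on `N` by zero. -/
def Verma : Type _ := (UniversalEnvelopingAlgebra ℂ D.L ⊗[ℂ] N) ⧸ D.vermaRel b N

namespace Verma

attribute [local instance 100] LieRing.ofAssociativeRing

instance : AddCommGroup (D.Verma b N) :=
  inferInstanceAs (AddCommGroup ((UniversalEnvelopingAlgebra ℂ D.L ⊗[ℂ] N) ⧸ D.vermaRel b N))

instance : Module (UniversalEnvelopingAlgebra ℂ D.L) (D.Verma b N) :=
  inferInstanceAs (Module (UniversalEnvelopingAlgebra ℂ D.L)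
    ((UniversalEnvelopingAlgebra ℂ D.L ⊗[ℂ] N) ⧸ D.vermaRel b N))

instance : Module ℂ (D.Verma b N) :=
  Module.compHom _ (algebraMap ℂ (UniversalEnvelopingAlgebra ℂ D.L))

/-- `𝔏` acts on `M(N)` through `𝔏 → U(𝔏)`. -/
instance : LieRingModule D.L (D.Verma b N) where
  bracket x v := UniversalEnvelopingAlgebra.ι ℂ x • v
  add_lie x y v := by
    change UniversalEnvelopingAlgebra.ι ℂ (x + y) • v = _
    rw [map_add, add_smul]
  lie_add x v w := smul_add _ v w
  leibniz_lie x y v := by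
    change UniversalEnvelopingAlgebra.ι ℂ x • UniversalEnvelopingAlgebra.ι ℂ y • v =
      UniversalEnvelopingAlgebra.ι ℂ ⁅x, y⁆ • v +
        UniversalEnvelopingAlgebra.ι ℂ y • UniversalEnvelopingAlgebra.ι ℂ x • v
    rw [LieHom.map_lie, LieRing.of_associative_ring_bracket, sub_smul, mul_smul, mul_smul,
      sub_add_cancel]

instance : LieModule ℂ D.L (D.Verma b N) where
  smul_lie c x v := by
    change UniversalEnvelopingAlgebra.ι ℂ (c • x) • v =
      algebraMap ℂ (UniversalEnvelopingAlgebra ℂ D.L) c • UniversalEnvelopingAlgebra.ι ℂ x • v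
    rw [map_smul, Algebra.smul_def, mul_smul]
  lie_smul c x v := by
    change UniversalEnvelopingAlgebra.ι ℂ x •
        algebraMap ℂ (UniversalEnvelopingAlgebra ℂ D.L) c • v =
      algebraMap ℂ (UniversalEnvelopingAlgebra ℂ D.L) c • UniversalEnvelopingAlgebra.ι ℂ x • v
    rw [← mul_smul, ← mul_smul, Algebra.commutes]

end Verma

end Verma

end LieTori

/-! ### The ideals generated by polynomials in the `tᵢ^{mᵢ}` -/

/-- The element `tᵢ^{mᵢ}` of `A(m)`. -/
def powVar (i : Fin n) : D.Am :=
  AddMonoidAlgebra.single ⟨Pi.single i (D.m i.succ : ℤ), fun j => by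
    rcases eq_or_ne j i with rfl | h
    · simp
    · simp [h]⟩ 1

/-- The ideal of `A(m)` generated by `P₁(t₁^{m₁}), …, Pₙ(tₙ^{mₙ})`. -/
def idealOf (P : Fin n → ℂ[X]) : Ideal D.Am :=
  Ideal.span (Set.range fun i => Polynomial.aeval (D.powVar i) (P i))

end Datum

/-- `∏ⱼ (X - cⱼ)`, the product being over the distinct roots `cⱼ` of `P`. -/
def squarefreePart (P : ℂ[X]) : ℂ[X] := ∏ c ∈ P.roots.toFinset, (Polynomial.X - Polynomial.C c)

end LieTorus

end

noncomputable section

namespace LieTorus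

theorem mem_of_mem_iSup_of_iSupIndep {ι R M : Type*} [Ring R] [AddCommGroup M] [Module R M]
    {V W : ι → Submodule R M} (hV : iSupIndep V) (hWV : ∀ i, W i ≤ V i) {i : ι} {z : M}
    (hz : z ∈ V i) (hz' : z ∈ ⨆ j, W j) : z ∈ W i := by
  have h : (⨆ j, W j) ≤ W i ⊔ ⨆ (j) (_ : j ≠ i), V j := by
    refine iSup_le fun j => ?_
    by_cases hj : j = i
    · subst hj; exact le_sup_left
    · exact le_sup_of_le_right ((hWV j).trans (le_iSup₂_of_le j hj le_rfl))
  obtain ⟨w, hw, w', hw', rfl⟩ := Submodule.mem_sup.1 (h hz')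
  have h0 : w' ∈ V i := by simpa using sub_mem hz (hWV i hw)
  have h1 : w' = 0 := by
    have := (hV i).le_bot ⟨h0, hw'⟩
    simpa using this
  simpa [h1] using hw

namespace Datum

universe u
variable {n : ℕ} {𝔤 : Type u} [LieRing 𝔤] [LieAlgebra ℂ 𝔤] (D : Datum n 𝔤)

/-! ### The grading of `𝔤` -/

theorem graded_congr {κ μ : Fin (n + 1) → ℤ} (h : ∀ i, D.ξ i ^ κ i = D.ξ i ^ μ i) :
    D.graded κ = D.graded μ := by
  ext X
  change (∀ i, _) ↔ (∀ i, _)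
  simp only [h]

theorem gradedRoot_congr (𝔥 : LieSubalgebra ℂ D.fixed) {κ μ : Fin (n + 1) → ℤ}
    (h : ∀ i, D.ξ i ^ κ i = D.ξ i ^ μ i) (α : Module.Dual ℂ 𝔥) :
    D.gradedRoot 𝔥 κ α = D.gradedRoot 𝔥 μ α := by
  ext X
  change (X ∈ D.graded κ ∧ _) ↔ (X ∈ D.graded μ ∧ _)
  rw [D.graded_congr h]

theorem m_pos (i : Fin (n + 1)) : 0 < D.m i := (D.σ_finite i).orderOf_pos

theorem ξ_zpow_congr {κ μ : Fin (n + 1) → ℤ} (h : ∀ i, (D.m i : ℤ) ∣ κ i - μ i)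
    (i : Fin (n + 1)) : D.ξ i ^ κ i = D.ξ i ^ μ i := by
  have h1 : D.ξ i ^ (κ i - μ i) = 1 := ((D.ξ_primitive i).zpow_eq_one_iff_dvd _).2 (h i)
  rw [zpow_sub₀ (D.ξ_ne_zero i), div_eq_one_iff_eq (zpow_ne_zero _ (D.ξ_ne_zero i))] at h1
  exact h1

theorem lie_mem_gradedRoot {𝔥 : LieSubalgebra ℂ D.fixed} {κ μ : Fin (n + 1) → ℤ}
    {α β : Module.Dual ℂ 𝔥} {X Y : 𝔤} (hX : X ∈ D.gradedRoot 𝔥 κ α)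
    (hY : Y ∈ D.gradedRoot 𝔥 μ β) : ⁅X, Y⁆ ∈ D.gradedRoot 𝔥 (κ + μ) (α + β) := by
  refine ⟨D.lie_mem_graded hX.1 hY.1, fun h => ?_⟩
  rw [leibniz_lie, hX.2 h, hY.2 h, LinearMap.add_apply, add_smul, smul_lie, lie_smul]

/-- The endomorphism `σᵢ` of `𝔤`. -/
def σEnd (i : Fin (n + 1)) : Module.End ℂ 𝔤 := ((D.σ i).toLinearEquiv : 𝔤 →ₗ[ℂ] 𝔤)

@[simp] theorem σEnd_apply (i : Fin (n + 1)) (X : 𝔤) : D.σEnd i X = D.σ i X := rfl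

theorem σEnd_pow_m (i : Fin (n + 1)) : D.σEnd i ^ D.m i = 1 := by
  have h : (D.σ i).toLinearEquiv ^ D.m i = 1 := pow_orderOf_eq_one _
  have h2 : ∀ k : ℕ, ∀ X, (D.σEnd i ^ k) X = ((D.σ i).toLinearEquiv ^ k) X := by
    intro k
    induction k with
    | zero => intro X; rfl
    | succ k ih => intro X; rw [pow_succ, pow_succ]; exact ih _
  ext X
  rw [h2, h]; rfl

theorem σEnd_commute (i j : Fin (n + 1)) : Commute (D.σEnd i) (D.σEnd j) := by
  ext X
  exact D.σ_comm i j X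

theorem σEnd_isSemisimple (i : Fin (n + 1)) : (D.σEnd i).IsSemisimple := by
  have h0 : (D.m i : ℂ) ≠ 0 := by exact_mod_cast (D.m_pos i).ne'
  refine Module.End.isSemisimple_of_squarefree_aeval_eq_zero
    (p := (Polynomial.X ^ D.m i - 1 : ℂ[X])) ?_ ?_
  · exact (Polynomial.X_pow_sub_one_separable_iff.2 h0).squarefree
  · simp [D.σEnd_pow_m i]

theorem iSup_graded [FiniteDimensional ℂ 𝔤] : ⨆ κ, D.graded κ = ⊤ := by
  have h := Module.End.iSup_iInf_maxGenEigenspace_eq_top_of_iSup_maxGenEigenspace_eq_top_of_commute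
    D.σEnd (fun i j _ => D.σEnd_commute i j) fun i => Module.End.iSup_maxGenEigenspace_eq_top _
  rw [eq_top_iff, ← h]
  refine iSup_le fun χ X hX => ?_
  by_cases h0 : X = 0
  · rw [h0]; exact zero_mem _
  have h1 : ∀ i, D.σ i X = χ i • X := by
    intro i
    have := (Submodule.mem_iInf _).1 hX i
    rw [(D.σEnd_isSemisimple i).isFinitelySemisimple.maxGenEigenspace_eq_eigenspace,
      Module.End.mem_eigenspace_iff] at this
    exact this
  have h2 : ∀ i, ∃ k : ℤ, χ i = D.ξ i ^ k := by
    intro i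
    have h3 : ∀ k : ℕ, (D.σEnd i ^ k) X = χ i ^ k • X := by
      intro k
      induction k with
      | zero => simp
      | succ k ih =>
        rw [pow_succ', Module.End.mul_apply, ih, map_smul, σEnd_apply, h1, smul_smul, pow_succ]
    have h4 : χ i ^ D.m i = 1 := by
      have := h3 (D.m i)
      rw [D.σEnd_pow_m, Module.End.one_apply] at this
      have h5 : (χ i ^ D.m i - 1) • X = 0 := by rw [sub_smul, ← this, one_smul, sub_self]
      exact sub_eq_zero.1 ((smul_eq_zero.1 h5).resolve_right h0)
    have : NeZero (orderOf (D.σ i).toLinearEquiv) := ⟨(D.m_pos i).ne'⟩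
    obtain ⟨k, -, hk⟩ := (D.ξ_primitive i).eq_pow_of_pow_eq_one h4
    exact ⟨k, by rw [zpow_natCast, hk]⟩
  choose κ hκ using h2
  exact Submodule.mem_iSup_of_mem κ fun i => by rw [h1, hκ]

/-! ### Simultaneous eigenspaces of the `σᵢ` and of `𝔥(0)` -/

section Roots

variable (𝔥 : LieSubalgebra ℂ D.fixed)

/-- The endomorphisms `σᵢ` and `ad h`, for `h ∈ 𝔥(0)`. -/
def jointEnd : Fin (n + 1) ⊕ 𝔥 → Module.End ℂ 𝔤 :=
  Sum.elim D.σEnd fun h => LieModule.toEnd ℂ 𝔤 𝔤 ((h : D.fixed) : 𝔤)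

/-- The joint eigenvalues on `𝔤(κ, α)`. -/
def jointChar (κ : Fin (n + 1) → ℤ) (α : Module.Dual ℂ 𝔥) : Fin (n + 1) ⊕ 𝔥 → ℂ :=
  Sum.elim (fun i => D.ξ i ^ κ i) α

theorem jointEnd_commute [IsLieAbelian 𝔥] (i j : Fin (n + 1) ⊕ 𝔥) :
    Commute (D.jointEnd 𝔥 i) (D.jointEnd 𝔥 j) := by
  have key : ∀ (i : Fin (n + 1)) (h : 𝔥),
      Commute (D.jointEnd 𝔥 (Sum.inl i)) (D.jointEnd 𝔥 (Sum.inr h)) := by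
    intro i h
    ext X
    change D.σ i ⁅((h : D.fixed) : 𝔤), X⁆ = ⁅((h : D.fixed) : 𝔤), D.σ i X⁆
    rw [LieEquiv.map_lie, (h : D.fixed).2 i]
  rcases i with i | h <;> rcases j with j | h'
  · exact D.σEnd_commute i j
  · exact key i h'
  · exact (key j h).symm
  · ext X
    change ⁅((h : D.fixed) : 𝔤), ⁅((h' : D.fixed) : 𝔤), X⁆⁆ =
      ⁅((h' : D.fixed) : 𝔤), ⁅((h : D.fixed) : 𝔤), X⁆⁆
    have h0 : ⁅((h : D.fixed) : 𝔤), ((h' : D.fixed) : 𝔤)⁆ = 0 := by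
      have := trivial_lie_zero 𝔥 𝔥 h h'
      have := congrArg (fun x : 𝔥 => ((x : D.fixed) : 𝔤)) this
      simpa using this
    rw [leibniz_lie, h0, zero_lie, zero_add]

theorem iSupIndep_jointEigenspace [IsLieAbelian 𝔥] :
    iSupIndep fun χ : Fin (n + 1) ⊕ 𝔥 → ℂ =>
      ⨅ i, (D.jointEnd 𝔥 i).maxGenEigenspace (χ i) :=
  Module.End.independent_iInf_maxGenEigenspace_of_forall_mapsTo _ fun i j φ =>
    Module.End.mapsTo_maxGenEigenspace_of_comm (D.jointEnd_commute 𝔥 j i) φ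

theorem gradedRoot_le_jointEigenspace (κ : Fin (n + 1) → ℤ) (α : Module.Dual ℂ 𝔥) :
    D.gradedRoot 𝔥 κ α ≤ ⨅ i, (D.jointEnd 𝔥 i).maxGenEigenspace (D.jointChar 𝔥 κ α i) := by
  refine le_iInf fun i X hX => ?_
  refine (D.jointEnd 𝔥 i).genEigenspace (D.jointChar 𝔥 κ α i) |>.mono
    (show (1 : ℕ∞) ≤ ⊤ from le_top) ?_
  rw [Module.End.mem_genEigenspace_one]
  rcases i with i | h
  · exact hX.1 i
  · exact hX.2 h

end Roots
end Datum
end LieTorus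

namespace LieTorus
namespace Datum

universe u
variable {n : ℕ} {𝔤 : Type u} [LieRing 𝔤] [LieAlgebra ℂ 𝔤] [FiniteDimensional ℂ 𝔤]
variable (D : Datum n 𝔤)

/-! ### The invariant form -/

theorem exists_form_eq_killingForm [LieAlgebra.IsSimple ℂ 𝔤] :
    ∃ c : ℂ, ∀ X Y, D.form X Y = c * killingForm ℂ 𝔤 X Y := by
  have hk := LieAlgebra.IsKilling.killingForm_nondegenerate ℂ 𝔤
  let T : 𝔤 →ₗ[ℂ] 𝔤 := (LinearMap.BilinForm.toDual (killingForm ℂ 𝔤) hk).symm.toLinearMap ∘ₗ D.form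
  have hT : ∀ X Y, killingForm ℂ 𝔤 (T X) Y = D.form X Y := fun X Y =>
    LinearMap.BilinForm.apply_toDual_symm_apply (hB := hk) (D.form X) Y
  have hinv : ∀ X Y, T ⁅X, Y⁆ = ⁅T X, Y⁆ := by
    intro X Y
    have : killingForm ℂ 𝔤 (T ⁅X, Y⁆ - ⁅T X, Y⁆) = 0 := by
      ext Z
      rw [map_sub, LinearMap.sub_apply, hT, D.form_invariant, ← hT,
        LieModule.traceForm_apply_lie_apply, sub_self, LinearMap.zero_apply]
    exact sub_eq_zero.1 (hk.1 _ fun Z => by rw [this, LinearMap.zero_apply])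
  have hnt : Nontrivial 𝔤 := by
    by_contra h
    rw [not_nontrivial_iff_subsingleton] at h
    exact LieAlgebra.IsSimple.non_abelian (R := ℂ) (L := 𝔤)
      ⟨fun _ _ => Subsingleton.elim _ _⟩
  obtain ⟨c, hc⟩ := Module.End.exists_eigenvalue T
  let E : LieIdeal ℂ 𝔤 :=
    { Module.End.eigenspace T c with
      lie_mem := fun {Y X} hX => by
        have hX' : T X = c • X := Module.End.mem_eigenspace_iff.1 hX
        refine Module.End.mem_eigenspace_iff.2 ?_
        rw [← lie_skew, map_neg, hinv, hX', smul_lie, smul_neg] }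
  have hE : E = ⊤ := by
    refine (LieAlgebra.IsSimple.eq_bot_or_eq_top E).resolve_left fun h => ?_
    obtain ⟨X, hX, hX0⟩ := hc.exists_hasEigenvector
    have : X ∈ E := hX
    rw [h, LieSubmodule.mem_bot] at this
    exact hX0 this
  refine ⟨c, fun X Y => ?_⟩
  have hX : X ∈ E := by rw [hE]; exact LieSubmodule.mem_top X
  have hX' : T X = c • X := Module.End.mem_eigenspace_iff.1 hX
  rw [← hT, hX', map_smul, LinearMap.smul_apply, smul_eq_mul]

theorem form_σ [LieAlgebra.IsSimple ℂ 𝔤] (i : Fin (n + 1)) (X Y : 𝔤) :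
    D.form (D.σ i X) (D.σ i Y) = D.form X Y := by
  obtain ⟨c, hc⟩ := D.exists_form_eq_killingForm
  rw [hc, hc, LieAlgebra.killingForm_of_equiv_apply]

theorem form_eq_zero_of_graded [LieAlgebra.IsSimple ℂ 𝔤] {κ μ : Fin (n + 1) → ℤ} {X Y : 𝔤}
    (hX : X ∈ D.graded κ) (hY : Y ∈ D.graded μ) (h : D.form X Y ≠ 0) (i : Fin (n + 1)) :
    D.ξ i ^ (κ i + μ i) = 1 := by
  have h1 := D.form_σ i X Y
  rw [hX i, hY i, map_smul, map_smul, LinearMap.smul_apply, smul_smul, smul_eq_mul, mul_comm (_ ^ _),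
    ← zpow_add₀ (D.ξ_ne_zero i)] at h1
  exact (mul_eq_right₀ h).1 h1

omit [FiniteDimensional ℂ 𝔤] in
theorem form_gradedRoot {𝔥 : LieSubalgebra ℂ D.fixed} {κ μ : Fin (n + 1) → ℤ}
    {α β : Module.Dual ℂ 𝔥} {X Y : 𝔤} (hX : X ∈ D.gradedRoot 𝔥 κ α)
    (hY : Y ∈ D.gradedRoot 𝔥 μ β) (h : D.form X Y ≠ 0) : β = -α := by
  ext t
  have h1 := D.form_invariant X ((t : D.fixed) : 𝔤) Y
  rw [← lie_skew, hX.2 t, hY.2 t, map_neg, LinearMap.neg_apply, map_smul, map_smul,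
    LinearMap.smul_apply, smul_eq_mul, smul_eq_mul] at h1
  have h2 : (β t + α t) * D.form X Y = 0 := by rw [add_mul, ← h1]; ring
  exact eq_neg_of_add_eq_zero_left ((mul_eq_zero.1 h2).resolve_right h)

/-! ### Weights of `𝔥(0)` -/

section Simple

variable [LieAlgebra.IsSimple ℂ D.fixed] {𝔥 : LieSubalgebra ℂ D.fixed} [𝔥.IsCartanSubalgebra]

/-- The sum of the weight spaces of `𝔥(0)` in `𝔤(κ)`, as a `𝔤(0̄, 0̄)`-module. -/
def weightSum (𝔥 : LieSubalgebra ℂ D.fixed) [𝔥.IsCartanSubalgebra] (κ : Fin (n + 1) → ℤ) :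
    LieSubmodule ℂ D.fixed 𝔤 where
  __ := ⨆ α, D.gradedRoot 𝔥 κ α
  lie_mem {x X} hX := by
    change X ∈ ⨆ α, D.gradedRoot 𝔥 κ α at hX
    change ⁅x, X⁆ ∈ ⨆ α, D.gradedRoot 𝔥 κ α
    induction hX using Submodule.iSup_induction' with
    | zero => rw [lie_zero]; exact zero_mem _
    | add X Y _ _ hX hY => rw [lie_add]; exact add_mem hX hY
    | mem α X hX =>
      have hx : x ∈ ⨆ χ : LieModule.Weight ℂ 𝔥 D.fixed, LieAlgebra.rootSpace 𝔥 χ := by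
        rw [LieModule.iSup_genWeightSpace_eq_top']; exact LieSubmodule.mem_top x
      induction hx using LieSubmodule.iSup_induction' with
      | zero => rw [zero_lie]; exact zero_mem _
      | add x y _ _ hx hy => rw [add_lie]; exact add_mem hx hy
      | mem χ x hx =>
        have hx' : (x : 𝔤) ∈ D.gradedRoot 𝔥 0 (LieModule.Weight.toLinear ℂ 𝔥 D.fixed χ) := by
          refine ⟨D.mem_graded_zero x, fun h => ?_⟩
          have := LieAlgebra.IsKilling.lie_eq_smul_of_mem_rootSpace hx h
          exact congrArg (fun x : D.fixed => (x : 𝔤)) this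
        have := D.lie_mem_gradedRoot hx' hX
        rw [zero_add] at this
        exact Submodule.mem_iSup_of_mem _ this

theorem graded_le_iSup_gradedRoot {b : (LieAlgebra.IsKilling.rootSystem 𝔥).Base}
    (hD : D.IsLieTorus b) (κ : Fin (n + 1) → ℤ) : D.graded κ ≤ ⨆ α, D.gradedRoot 𝔥 κ α := by
  obtain ⟨U, W, -, hUW, hU, hW⟩ := hD κ
  have hU' : U ≤ D.weightSum 𝔥 κ := by
    intro X hX
    have hX' : X ∈ D.gradedModule κ := hUW ▸ (le_sup_left : U ≤ U ⊔ W) hX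
    refine Submodule.mem_iSup_of_mem (0 : Module.Dual ℂ 𝔥) ⟨hX', fun h => ?_⟩
    have := congrArg (fun x : U => (x : 𝔤)) (hU.trivial (h : D.fixed) ⟨X, hX⟩)
    simpa using this
  have hW' : W ≤ D.weightSum 𝔥 κ := by
    rcases hW with rfl | ⟨hirr, lam, w, hw, hw0, hlam, -⟩
    · exact bot_le
    · have hwκ : w ∈ D.gradedModule κ := hUW ▸ (le_sup_right : W ≤ U ⊔ W) hw
      have hwS : w ∈ D.weightSum 𝔥 κ := Submodule.mem_iSup_of_mem lam ⟨hwκ, hlam⟩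
      have htop : (D.weightSum 𝔥 κ).comap W.incl = ⊤ := by
        refine (eq_bot_or_eq_top _).resolve_left fun h => hw0 ?_
        have : (⟨w, hw⟩ : W) ∈ (D.weightSum 𝔥 κ).comap W.incl := hwS
        rw [h, LieSubmodule.mem_bot] at this
        exact congrArg Subtype.val this
      intro X hX
      have : (⟨X, hX⟩ : W) ∈ (D.weightSum 𝔥 κ).comap W.incl := by
        rw [htop]; exact LieSubmodule.mem_top _
      exact this
  intro X hX
  have : X ∈ U ⊔ W := hUW ▸ (show X ∈ D.gradedModule κ from hX)
  exact sup_le hU' hW' this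

theorem iSup_gradedRoot {b : (LieAlgebra.IsKilling.rootSystem 𝔥).Base}
    (hD : D.IsLieTorus b) : ⨆ (κ) (α), D.gradedRoot 𝔥 κ α = ⊤ := by
  rw [eq_top_iff, ← D.iSup_graded]
  exact iSup_mono (D.graded_le_iSup_gradedRoot hD)

end Simple

end Datum
end LieTorus

namespace LieTorus
namespace Datum

universe u
variable {n : ℕ} {𝔤 : Type u} [LieRing 𝔤] [LieAlgebra ℂ 𝔤] [FiniteDimensional ℂ 𝔤]
variable (D : Datum n 𝔤)

section Simple

variable [LieAlgebra.IsSimple ℂ D.fixed] {𝔥 : LieSubalgebra ℂ D.fixed} [𝔥.IsCartanSubalgebra]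

theorem exists_gradedRoot_ne_bot {b : (LieAlgebra.IsKilling.rootSystem 𝔥).Base}
    (hD : D.IsLieTorus b) :
    ∃ (κ : Fin (n + 1) → ℤ) (α : Module.Dual ℂ 𝔥), α ≠ 0 ∧ D.gradedRoot 𝔥 κ α ≠ ⊥ := by
  by_contra! hcon
  have hact : ∀ (h : 𝔥) (X : 𝔤), ⁅((h : D.fixed) : 𝔤), X⁆ = 0 := by
    intro h X
    have hX : X ∈ ⨆ (κ) (α), D.gradedRoot 𝔥 κ α := by
      rw [D.iSup_gradedRoot hD]; exact Submodule.mem_top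
    have hle : ⨆ (κ) (α), D.gradedRoot 𝔥 κ α ≤
        LinearMap.ker (LieModule.toEnd ℂ 𝔤 𝔤 ((h : D.fixed) : 𝔤)) := by
      refine iSup₂_le fun κ α Y hY => ?_
      by_cases hα : α = 0
      · subst hα; simpa using hY.2 h
      · rw [hcon κ α hα, Submodule.mem_bot] at hY
        rw [hY]; exact zero_mem _
    exact hle hX
  have hbot : ∀ h : 𝔥, (h : D.fixed) = 0 := by
    intro h
    have hc : (h : D.fixed) ∈ LieAlgebra.center ℂ D.fixed := by
      rw [LieModule.mem_maxTrivSubmodule]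
      intro x
      have := hact h (x : 𝔤)
      rw [← lie_skew, neg_eq_zero]
      exact Subtype.ext this
    rwa [LieAlgebra.center_eq_bot, LieSubmodule.mem_bot] at hc
  have hn := LieSubalgebra.IsCartanSubalgebra.self_normalizing (H := 𝔥)
  refine LieAlgebra.IsSimple.non_abelian (R := ℂ) (L := D.fixed) ⟨fun x y => ?_⟩
  have hx : x ∈ 𝔥 := by
    rw [← hn, LieSubalgebra.mem_normalizer_iff]
    intro y hy
    have hy0 : y = 0 := hbot ⟨y, hy⟩
    rw [hy0, lie_zero]
    exact zero_mem _
  have hx0 : x = 0 := hbot ⟨x, hx⟩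
  rw [hx0, zero_lie]

theorem exists_form_ne_zero [LieAlgebra.IsSimple ℂ 𝔤]
    {b : (LieAlgebra.IsKilling.rootSystem 𝔥).Base} (hD : D.IsLieTorus b) :
    ∃ (κ : Fin (n + 1) → ℤ) (α : Module.Dual ℂ 𝔥), α ≠ 0 ∧
      ∃ X ∈ D.gradedRoot 𝔥 κ α, ∃ Y ∈ D.gradedRoot 𝔥 (-κ) (-α), D.form X Y ≠ 0 := by
  obtain ⟨κ, α, hα, hne⟩ := D.exists_gradedRoot_ne_bot hD
  obtain ⟨X, hX, hX0⟩ := (Submodule.ne_bot_iff _).1 hne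
  refine ⟨κ, α, hα, X, hX, ?_⟩
  by_contra! hcon
  refine hX0 (D.form_nondegenerate.1 X fun Z => ?_)
  have hZ : Z ∈ ⨆ (κ) (α), D.gradedRoot 𝔥 κ α := by
    rw [D.iSup_gradedRoot hD]; exact Submodule.mem_top
  have hle : ⨆ (κ) (α), D.gradedRoot 𝔥 κ α ≤ LinearMap.ker (D.form X) := by
    refine iSup₂_le fun μ β Y hY => ?_
    rw [LinearMap.mem_ker]
    by_contra hXY
    obtain rfl := D.form_gradedRoot hX hY hXY
    refine hXY (hcon Y ?_)
    rwa [D.gradedRoot_congr 𝔥 (μ := μ)]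
    intro i
    have h1 := D.form_eq_zero_of_graded hX.1 hY.1 hXY i
    rw [zpow_add₀ (D.ξ_ne_zero i)] at h1
    rw [Pi.neg_apply, zpow_neg]
    exact (eq_inv_of_mul_eq_one_right h1).symm
  exact hle hZ

/-- The span of the brackets of opposite nonzero root vectors, in `𝔤(κ, 0)`. -/
def bracketSpan (𝔥 : LieSubalgebra ℂ D.fixed) (κ : Fin (n + 1) → ℤ) : Submodule ℂ 𝔤 :=
  Submodule.span ℂ {Z | ∃ (μ : Fin (n + 1) → ℤ) (α : Module.Dual ℂ 𝔥), α ≠ 0 ∧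
    ∃ X ∈ D.gradedRoot 𝔥 μ α, ∃ Y ∈ D.gradedRoot 𝔥 (κ - μ) (-α), Z = ⁅X, Y⁆}

omit [FiniteDimensional ℂ 𝔤] [LieAlgebra.IsSimple ℂ D.fixed] [𝔥.IsCartanSubalgebra] in
theorem lie_mem_bracketSpan {κ μ : Fin (n + 1) → ℤ} {α β : Module.Dual ℂ 𝔥} (hα : α ≠ 0)
    (hαβ : α + β = 0) {X Y : 𝔤} (hX : X ∈ D.gradedRoot 𝔥 κ α) (hY : Y ∈ D.gradedRoot 𝔥 μ β) :
    ⁅X, Y⁆ ∈ D.bracketSpan 𝔥 (κ + μ) := by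
  obtain rfl := eq_neg_of_add_eq_zero_right hαβ
  exact Submodule.subset_span ⟨κ, α, hα, X, hX, Y, by rwa [add_sub_cancel_left], rfl⟩

omit [FiniteDimensional ℂ 𝔤] [LieAlgebra.IsSimple ℂ D.fixed] [𝔥.IsCartanSubalgebra] in
theorem bracketSpan_le (κ : Fin (n + 1) → ℤ) : D.bracketSpan 𝔥 κ ≤ D.gradedRoot 𝔥 κ 0 := by
  refine Submodule.span_le.2 ?_
  rintro _ ⟨μ, α, -, X, hX, Y, hY, rfl⟩
  have := D.lie_mem_gradedRoot hX hY
  rwa [add_sub_cancel, add_neg_cancel] at this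

omit [FiniteDimensional ℂ 𝔤] [LieAlgebra.IsSimple ℂ D.fixed] [𝔥.IsCartanSubalgebra] in
theorem bracketSpan_congr {κ μ : Fin (n + 1) → ℤ} (h : ∀ i, D.ξ i ^ κ i = D.ξ i ^ μ i) :
    D.bracketSpan 𝔥 κ = D.bracketSpan 𝔥 μ := by
  have : ∀ ν α, D.gradedRoot 𝔥 (κ - ν) α = D.gradedRoot 𝔥 (μ - ν) α := fun ν α =>
    D.gradedRoot_congr 𝔥 (fun i => by
      rw [Pi.sub_apply, Pi.sub_apply, zpow_sub₀ (D.ξ_ne_zero i), zpow_sub₀ (D.ξ_ne_zero i), h i]) α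
  simp only [bracketSpan, this]

open Classical in
/-- The graded components of the ideal generated by the nonzero root spaces. -/
def rootIdealPart (𝔥 : LieSubalgebra ℂ D.fixed)
    (p : (Fin (n + 1) → ℤ) × Module.Dual ℂ 𝔥) : Submodule ℂ 𝔤 :=
  if p.2 = 0 then D.bracketSpan 𝔥 p.1 else D.gradedRoot 𝔥 p.1 p.2

omit [FiniteDimensional ℂ 𝔤] [LieAlgebra.IsSimple ℂ D.fixed] [𝔥.IsCartanSubalgebra] in
theorem rootIdealPart_le (p : (Fin (n + 1) → ℤ) × Module.Dual ℂ 𝔥) :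
    D.rootIdealPart 𝔥 p ≤ D.gradedRoot 𝔥 p.1 p.2 := by
  unfold rootIdealPart
  split_ifs with h
  · rw [h]; exact D.bracketSpan_le _
  · exact le_rfl

omit [FiniteDimensional ℂ 𝔤] [LieAlgebra.IsSimple ℂ D.fixed] [𝔥.IsCartanSubalgebra] in
theorem lie_mem_rootIdealPart (q p : (Fin (n + 1) → ℤ) × Module.Dual ℂ 𝔥) {Z X : 𝔤}
    (hZ : Z ∈ D.gradedRoot 𝔥 q.1 q.2) (hX : X ∈ D.rootIdealPart 𝔥 p) :
    ⁅Z, X⁆ ∈ D.rootIdealPart 𝔥 (q + p) := by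
  by_cases h : q.2 + p.2 = 0
  · rw [rootIdealPart, if_pos (show (q + p).2 = 0 from h)]
    by_cases hp : p.2 = 0
    · have hq : q.2 = 0 := by rwa [hp, add_zero] at h
      rw [rootIdealPart, if_pos hp] at hX
      induction hX using Submodule.span_induction with
      | zero => rw [lie_zero]; exact zero_mem _
      | add X Y _ _ hX hY => rw [lie_add]; exact add_mem hX hY
      | smul c X _ hX => rw [lie_smul]; exact Submodule.smul_mem _ _ hX
      | mem X hX =>
        obtain ⟨μ, α, hα, X, hX, Y, hY, rfl⟩ := hX
        rw [hq] at hZ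
        rw [leibniz_lie]
        have h1 := D.lie_mem_gradedRoot hZ hX
        have h2 := D.lie_mem_gradedRoot hZ hY
        rw [zero_add] at h1 h2
        have h3 := D.lie_mem_bracketSpan hα (add_neg_cancel α) h1 hY
        have h4 := D.lie_mem_bracketSpan hα (add_neg_cancel α) hX h2
        have e1 : q.1 + μ + (p.1 - μ) = (q + p).1 := by rw [Prod.fst_add]; abel
        have e2 : μ + (q.1 + (p.1 - μ)) = (q + p).1 := by rw [Prod.fst_add]; abel
        rw [e1] at h3
        rw [e2] at h4
        exact add_mem h3 h4
    · have hq : q.2 ≠ 0 := fun hq => hp (by rwa [hq, zero_add] at h)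
      rw [rootIdealPart, if_neg hp] at hX
      exact D.lie_mem_bracketSpan hq h hZ hX
  · rw [rootIdealPart, if_neg (show (q + p).2 ≠ 0 from h)]
    exact D.lie_mem_gradedRoot hZ (D.rootIdealPart_le p hX)

theorem iSup_rootIdealPart [LieAlgebra.IsSimple ℂ 𝔤]
    {b : (LieAlgebra.IsKilling.rootSystem 𝔥).Base} (hD : D.IsLieTorus b) :
    ⨆ p, D.rootIdealPart 𝔥 p = ⊤ := by
  let I : LieIdeal ℂ 𝔤 :=
    { ⨆ p, D.rootIdealPart 𝔥 p with
      lie_mem := fun {Z X} hX => by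
        change X ∈ ⨆ p, D.rootIdealPart 𝔥 p at hX
        change ⁅Z, X⁆ ∈ ⨆ p, D.rootIdealPart 𝔥 p
        have hZ : Z ∈ ⨆ q : (Fin (n + 1) → ℤ) × Module.Dual ℂ 𝔥, D.gradedRoot 𝔥 q.1 q.2 := by
          rw [iSup_prod, D.iSup_gradedRoot hD]; exact Submodule.mem_top
        induction hX using Submodule.iSup_induction' with
        | zero => rw [lie_zero]; exact zero_mem _
        | add X Y _ _ hX hY => rw [lie_add]; exact add_mem hX hY
        | mem p X hX =>
          induction hZ using Submodule.iSup_induction' with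
          | zero => rw [zero_lie]; exact zero_mem _
          | add X Y _ _ hX hY => rw [add_lie]; exact add_mem hX hY
          | mem q Z hZ => exact Submodule.mem_iSup_of_mem _ (D.lie_mem_rootIdealPart q p hZ hX) }
  have hI : I = ⊤ := by
    refine (LieAlgebra.IsSimple.eq_bot_or_eq_top I).resolve_left fun h => ?_
    obtain ⟨κ, α, hα, hne⟩ := D.exists_gradedRoot_ne_bot hD
    obtain ⟨X, hX, hX0⟩ := (Submodule.ne_bot_iff _).1 hne
    have : X ∈ I := by
      refine Submodule.mem_iSup_of_mem (κ, α) ?_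
      rwa [rootIdealPart, if_neg hα]
    rw [h, LieSubmodule.mem_bot] at this
    exact hX0 this
  exact congrArg LieSubmodule.toSubmodule hI

theorem gradedRoot_zero_le_bracketSpan [LieAlgebra.IsSimple ℂ 𝔤]
    {b : (LieAlgebra.IsKilling.rootSystem 𝔥).Base} (hD : D.IsLieTorus b)
    (κ : Fin (n + 1) → ℤ) : D.gradedRoot 𝔥 κ 0 ≤ D.bracketSpan 𝔥 κ := by
  intro Z hZ
  have h := mem_of_mem_iSup_of_iSupIndep (D.iSupIndep_jointEigenspace 𝔥)
    (W := fun χ => ⨆ (p : (Fin (n + 1) → ℤ) × Module.Dual ℂ 𝔥) (_ : D.jointChar 𝔥 p.1 p.2 = χ),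
      D.rootIdealPart 𝔥 p) (fun χ => ?_) (D.gradedRoot_le_jointEigenspace 𝔥 κ 0 hZ) ?_
  · refine (iSup₂_le fun p hp => ?_ : _ ≤ D.bracketSpan 𝔥 κ) h
    have hp2 : p.2 = 0 := by
      ext t; exact congrFun hp (Sum.inr t)
    have hp1 : ∀ i, D.ξ i ^ p.1 i = D.ξ i ^ κ i := fun i => congrFun hp (Sum.inl i)
    rw [rootIdealPart, if_pos hp2, D.bracketSpan_congr hp1]
  · refine iSup₂_le fun p hp => (D.rootIdealPart_le p).trans ?_
    rw [← hp]
    exact D.gradedRoot_le_jointEigenspace 𝔥 _ _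
  · have hZ' : Z ∈ ⨆ p, D.rootIdealPart 𝔥 p := by
      rw [D.iSup_rootIdealPart hD]; exact Submodule.mem_top
    have hle : ⨆ p, D.rootIdealPart 𝔥 p ≤
        ⨆ χ, ⨆ (p) (_ : D.jointChar 𝔥 p.1 p.2 = χ), D.rootIdealPart 𝔥 p :=
      iSup_le fun p => le_iSup_of_le (D.jointChar 𝔥 p.1 p.2) (le_iSup₂_of_le p rfl le_rfl)
    exact hle hZ'

end Simple

end Datum
end LieTorus

namespace LieTorus

/-! ### Representations of `sl₂` -/

section Sl2

variable {L M : Type*} [LieRing L] [LieAlgebra ℂ L] [AddCommGroup M] [Module ℂ M]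
  [LieRingModule L M] [LieModule ℂ L M] {h e f : L}

theorem exists_pow_toEnd_e_eq_zero [FiniteDimensional ℂ M] (t : IsSl2Triple h e f) {c : ℂ} {w : M}
    (hw : ⁅h, w⁆ = c • w) : ∃ p : ℕ, (LieModule.toEnd ℂ L M e ^ p) w = 0 := by
  by_contra! contra
  let evals (n : ℕ) : ℂ := c + 2 * (n : ℂ)
  have h_inj : Function.Injective evals := fun a b hab => by
    simpa [evals, add_right_inj, mul_eq_mul_left_iff, Nat.cast_inj] using hab
  have aux (μ : Set.range evals) : (LieModule.toEnd ℂ L M h).HasEigenvector μ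
      ((LieModule.toEnd ℂ L M e ^ μ.property.choose) w) := by
    set n := μ.property.choose
    refine ⟨?_, contra n⟩
    rw [Module.End.mem_eigenspace_iff, LieModule.toEnd_apply_apply, ← μ.property.choose_spec]
    exact t.lie_h_pow_toEnd_e hw n
  have _i := ((LieModule.toEnd ℂ L M h).eigenvectors_linearIndependent (Set.range evals) _ aux).finite
  exact (Set.infinite_range_of_injective h_inj) (Set.toFinite _)

theorem pow_toEnd_e_lie_f_lie_e (t : IsSl2Triple h e f) {c : ℂ} {w : M} (hw : ⁅h, w⁆ = c • w)
    (j : ℕ) : (LieModule.toEnd ℂ L M e ^ j) ⁅f, ⁅e, w⁆⁆ =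
      ⁅f, ⁅e, (LieModule.toEnd ℂ L M e ^ j) w⁆⁆ +
        (j * (c + j + 1)) • (LieModule.toEnd ℂ L M e ^ j) w := by
  induction j with
  | zero => simp
  | succ j ih =>
    have h1 := t.lie_h_pow_toEnd_e hw (j + 1)
    have h2 : (LieModule.toEnd ℂ L M e ^ (j + 1)) w = ⁅e, (LieModule.toEnd ℂ L M e ^ j) w⁆ := by
      rw [pow_succ', Module.End.mul_apply, LieModule.toEnd_apply_apply]
    rw [pow_succ', Module.End.mul_apply, ih, LieModule.toEnd_apply_apply, lie_add, lie_smul,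
      leibniz_lie e f, t.lie_e_f, ← pow_succ', ← h2, h1]
    push_cast
    module

/-- If `fe` has `w` as an eigenvector, the eigenvalue is determined by the length of the string
above `w`. -/
theorem eq_of_lie_f_lie_e_eq_smul [FiniteDimensional ℂ M] (t : IsSl2Triple h e f) {c s : ℂ} {w : M}
    (hw : ⁅h, w⁆ = c • w) (hw0 : w ≠ 0) (hs : ⁅f, ⁅e, w⁆⁆ = s • w) :
    ∃ p : ℕ, (LieModule.toEnd ℂ L M e ^ p) w ≠ 0 ∧ s = p * (c + p + 1) := by
  obtain ⟨p, hp, hp'⟩ := Nat.exists_not_and_succ_of_not_zero_of_exists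
    (p := fun p => (LieModule.toEnd ℂ L M e ^ p) w = 0) (by simpa using hw0)
    (exists_pow_toEnd_e_eq_zero t hw)
  refine ⟨p, hp, ?_⟩
  have h1 := pow_toEnd_e_lie_f_lie_e t hw p
  rw [pow_succ', Module.End.mul_apply, LieModule.toEnd_apply_apply] at hp'
  rw [hs, map_smul, hp', lie_zero, zero_add] at h1
  exact smul_left_injective ℂ hp h1

theorem pow_toEnd_e_ne_zero [FiniteDimensional ℂ M] (t : IsSl2Triple h e f) {k : ℕ} (hk : 0 < k)
    {w : M} (hw : ⁅h, w⁆ = (-k : ℂ) • w) (hw0 : w ≠ 0) :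
    (LieModule.toEnd ℂ L M e ^ k) w ≠ 0 := by
  intro hcon
  let E : Submodule ℂ M := (LieModule.toEnd ℂ L M h).eigenspace (-k : ℂ) ⊓
    LinearMap.ker (LieModule.toEnd ℂ L M e ^ k)
  have hE : ∀ v ∈ E, ⁅h, v⁆ = (-k : ℂ) • v := fun v hv => Module.End.mem_eigenspace_iff.1 hv.1
  let T : Module.End ℂ M := LieModule.toEnd ℂ L M f * LieModule.toEnd ℂ L M e
  have hT : ∀ v ∈ E, T v ∈ E := by
    intro v hv
    refine ⟨Module.End.mem_eigenspace_iff.2 ?_, ?_⟩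
    · change ⁅h, ⁅f, ⁅e, v⁆⁆⁆ = _ • ⁅f, ⁅e, v⁆⁆
      rw [leibniz_lie, t.lie_lie_smul_f ℂ, leibniz_lie h e, t.lie_h_e_smul ℂ, hE v hv]
      simp only [neg_lie, smul_lie, lie_add, lie_smul]
      module
    · have h0 : (LieModule.toEnd ℂ L M e ^ k) v = 0 := hv.2
      change (LieModule.toEnd ℂ L M e ^ k) ⁅f, ⁅e, v⁆⁆ = 0
      rw [pow_toEnd_e_lie_f_lie_e t (hE v hv), h0]
      simp
  have hnt : Nontrivial E := ⟨⟨⟨w, Module.End.mem_eigenspace_iff.2 hw, hcon⟩, 0, fun h => hw0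
    (congrArg Subtype.val h)⟩⟩
  obtain ⟨s, hs⟩ := Module.End.exists_eigenvalue (T.restrict hT)
  obtain ⟨⟨v, hv⟩, hv1, hv0⟩ := hs.exists_hasEigenvector
  have hv0' : v ≠ 0 := fun h => hv0 (Subtype.ext h)
  have hsv : ⁅f, ⁅e, v⁆⁆ = s • v := congrArg Subtype.val (Module.End.mem_eigenspace_iff.1 hv1)
  obtain ⟨p, hp, hsp⟩ := eq_of_lie_f_lie_e_eq_smul t (hE v hv) hv0' hsv
  have hpk : p < k := by
    by_contra! hle
    refine hp ?_
    obtain ⟨q, rfl⟩ := Nat.exists_eq_add_of_le' hle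
    rw [pow_add, Module.End.mul_apply, show (LieModule.toEnd ℂ L M e ^ k) v = 0 from hv.2, map_zero]
  have hv' : ⁅-h, v⁆ = (k : ℂ) • v := by rw [neg_lie, hE v hv]; module
  have hsv' : ⁅e, ⁅f, v⁆⁆ = (s - k) • v := by
    rw [leibniz_lie, t.lie_e_f, hE v hv, hsv]; module
  obtain ⟨q, -, hsq⟩ := eq_of_lie_f_lie_e_eq_smul t.symm hv' hv0' hsv'
  have hs2 : (p : ℂ) * (-k + p + 1) = (q + 1) * (q + k) := by
    rw [← hsp, eq_add_of_sub_eq hsq]; ring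
  have hs3 : (p : ℤ) * (-k + p + 1) = (q + 1) * (q + k) := by exact_mod_cast hs2
  have h1 : (p : ℤ) * (-k + p + 1) ≤ 0 :=
    mul_nonpos_of_nonneg_of_nonpos (by positivity) (by lia)
  have h2 : (0 : ℤ) < (q + 1) * (q + k) := by positivity
  lia

end Sl2

/-! ### Submodules generated by a subspace stable under a parabolic part -/

section Closure

variable {L M : Type*} [LieRing L] [LieAlgebra ℂ L] [AddCommGroup M] [Module ℂ M]
  [LieRingModule L M] [LieModule ℂ L M]

/-- If `L = A + B` and the subspace `T₀` is stable under `B`, then the smallest `A`-stable subspace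
containing `T₀` is an `L`-submodule. -/
theorem exists_lieSubmodule_of_stable {A B : Submodule ℂ L} (hAB : A ⊔ B = ⊤) {T₀ : Submodule ℂ M}
    (hB : ∀ x ∈ B, ∀ t ∈ T₀, ⁅x, t⁆ ∈ T₀) :
    ∃ T : LieSubmodule ℂ L M, T₀ ≤ T.toSubmodule ∧
      ∀ S : Submodule ℂ M, T₀ ≤ S → (∀ x ∈ A, ∀ t ∈ S, ⁅x, t⁆ ∈ S) → T.toSubmodule ≤ S := by
  let T : Submodule ℂ M := sInf {S | T₀ ≤ S ∧ ∀ x ∈ A, ∀ t ∈ S, ⁅x, t⁆ ∈ S}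
  have hT₀ : T₀ ≤ T := le_sInf fun S hS => hS.1
  have hTA : ∀ x ∈ A, ∀ t ∈ T, ⁅x, t⁆ ∈ T := fun x hx t ht =>
    (Submodule.mem_sInf).2 fun S hS => hS.2 x hx t ((Submodule.mem_sInf).1 ht S hS)
  have hTle : ∀ S : Submodule ℂ M, T₀ ≤ S → (∀ x ∈ A, ∀ t ∈ S, ⁅x, t⁆ ∈ S) → T ≤ S :=
    fun S h1 h2 => sInf_le ⟨h1, h2⟩
  let Q : Submodule ℂ M :=
    { carrier := {t | t ∈ T ∧ ∀ x ∈ B, ⁅x, t⁆ ∈ T}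
      add_mem' := fun ha hb => ⟨add_mem ha.1 hb.1, fun x hx => by
        rw [lie_add]; exact add_mem (ha.2 x hx) (hb.2 x hx)⟩
      zero_mem' := ⟨zero_mem _, fun x _ => by rw [lie_zero]; exact zero_mem _⟩
      smul_mem' := fun c t ht => ⟨Submodule.smul_mem _ _ ht.1, fun x hx => by
        rw [lie_smul]; exact Submodule.smul_mem _ _ (ht.2 x hx)⟩ }
  have hTQ : T ≤ Q := by
    refine hTle Q (fun t ht => ⟨hT₀ ht, fun x hx => hT₀ (hB x hx t ht)⟩) ?_
    rintro y hy t ⟨htT, htB⟩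
    refine ⟨hTA y hy t htT, fun x hx => ?_⟩
    have hxy : ⁅x, y⁆ ∈ A ⊔ B := by rw [hAB]; exact Submodule.mem_top
    obtain ⟨a, ha, c, hc, hac⟩ := Submodule.mem_sup.1 hxy
    rw [leibniz_lie, ← hac, add_lie]
    exact add_mem (add_mem (hTA a ha t htT) (htB c hc)) (hTA y hy _ (htB x hx))
  refine ⟨⟨T, fun {x t} ht => ?_⟩, hT₀, hTle⟩
  have hx : x ∈ A ⊔ B := by rw [hAB]; exact Submodule.mem_top
  obtain ⟨a, ha, c, hc, rfl⟩ := Submodule.mem_sup.1 hx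
  rw [add_lie]
  exact add_mem (hTA a ha t ht) ((hTQ ht).2 c hc)

end Closure

end LieTorus

namespace LieTorus

open LieAlgebra LieAlgebra.IsKilling Module

section RootSystem

variable {L : Type*} [LieRing L] [LieAlgebra ℂ L] [FiniteDimensional ℂ L] [IsKilling ℂ L]
  {H : LieSubalgebra ℂ L} [H.IsCartanSubalgebra]

/-- Zero, the roots, and the doubles of the roots `γ` for which all `⟨α, γ^∨⟩` are even. -/
def saturatedSet (H : LieSubalgebra ℂ L) [H.IsCartanSubalgebra] : Set (Dual ℂ H) :=
  {μ | μ = 0 ∨ (∃ i, μ = (rootSystem H).root i) ∨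
    ∃ i, (∀ j, Even ((rootSystem H).pairingIn ℤ j i)) ∧ μ = (2 : ℂ) • (rootSystem H).root i}

theorem root_apply_coroot_eq_pairingIn (i j : H.root) :
    (rootSystem H).root i ((rootSystem H).coroot j) = ((rootSystem H).pairingIn ℤ i j : ℂ) :=
  ((rootSystem H).algebraMap_pairingIn ℤ i j).symm

theorem root_reflectionPerm_eq (i j : H.root) :
    (rootSystem H).root ((rootSystem H).reflectionPerm i j) = (rootSystem H).root j -
      ((rootSystem H).root j ((rootSystem H).coroot i)) • (rootSystem H).root i := by
  rw [RootPairing.root_reflectionPerm, RootPairing.reflection_apply]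
  rfl

theorem even_pairingIn_reflectionPerm (i : H.root) {j : H.root}
    (hj : ∀ k, Even ((rootSystem H).pairingIn ℤ k j)) (k : H.root) :
    Even ((rootSystem H).pairingIn ℤ k ((rootSystem H).reflectionPerm i j)) := by
  have h := hj ((rootSystem H).reflectionPerm i k)
  have e : (rootSystem H).pairingIn ℤ k ((rootSystem H).reflectionPerm i j) =
      (rootSystem H).pairingIn ℤ ((rootSystem H).reflectionPerm i k) j := by
    apply FaithfulSMul.algebraMap_injective ℤ ℂ
    rw [RootPairing.algebraMap_pairingIn, RootPairing.algebraMap_pairingIn,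
      RootPairing.pairing_reflectionPerm]
  rwa [e]

theorem reflection_mem_saturatedSet (i : H.root) {μ : Dual ℂ H} (hμ : μ ∈ saturatedSet H) :
    μ - μ ((rootSystem H).coroot i) • (rootSystem H).root i ∈ saturatedSet H := by
  rcases hμ with rfl | ⟨j, rfl⟩ | ⟨j, hj, rfl⟩
  · left; simp
  · right; left
    exact ⟨(rootSystem H).reflectionPerm i j, (root_reflectionPerm_eq i j).symm⟩
  · right; right
    refine ⟨(rootSystem H).reflectionPerm i j, even_pairingIn_reflectionPerm i hj, ?_⟩
    rw [root_reflectionPerm_eq, LinearMap.smul_apply, smul_sub, smul_assoc]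

theorem neg_mem_range_root (i : H.root) : ∃ j, -(rootSystem H).root i = (rootSystem H).root j :=
  ⟨(rootSystem H).reflectionPerm i i, by
    rw [RootPairing.root_reflectionPerm, RootPairing.reflection_apply_self]⟩

theorem sub_root_mem_saturatedSet (i : H.root) {β : Dual ℂ H} (hβ : β ∈ saturatedSet H) {k : ℕ}
    (hk : 2 ≤ k) (hβk : β ((rootSystem H).coroot i) = k) :
    β - (rootSystem H).root i ∈ saturatedSet H := by
  rcases hβ with rfl | ⟨j, rfl⟩ | ⟨j, hj, rfl⟩
  · rw [LinearMap.zero_apply] at hβk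
    have : k = 0 := by exact_mod_cast hβk.symm
    lia
  · rw [root_apply_coroot_eq_pairingIn] at hβk
    have hpos : 0 < (rootSystem H).pairingIn ℤ j i := by
      have : (rootSystem H).pairingIn ℤ j i = k := by exact_mod_cast hβk
      lia
    by_cases hij : j = i
    · left; rw [hij, sub_self]
    · obtain ⟨l, hl⟩ := (rootSystem H).root_sub_root_mem_of_pairingIn_pos hpos hij
      exact Or.inr (Or.inl ⟨l, hl.symm⟩)
  · rw [LinearMap.smul_apply, root_apply_coroot_eq_pairingIn, smul_eq_mul] at hβk
    have hpos : 0 < (rootSystem H).pairingIn ℤ j i := by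
      have : 2 * (rootSystem H).pairingIn ℤ j i = k := by exact_mod_cast hβk
      lia
    by_cases hij : j = i
    · right; left; exact ⟨i, by rw [hij]; module⟩
    · have h2 : (rootSystem H).pairingIn ℤ i j = 2 := by
        have h1 : ((rootSystem H).pairingIn ℤ i j, (rootSystem H).pairingIn ℤ j i) ∈
            ({(0, 0), (1, 1), (-1, -1), (1, 2), (2, 1), (-1, -2), (-2, -1), (1, 3), (3, 1),
              (-1, -3), (-3, -1)} : Set (ℤ × ℤ)) :=
          (rootSystem H).pairingIn_pairingIn_mem_set_of_isCrystal_of_isRed' i j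
            (fun h => hij ((rootSystem H).root.injective h).symm) (fun h => ?_)
        · obtain ⟨r, hr⟩ := hj i
          generalize (rootSystem H).pairingIn ℤ i j = p at h1 hr ⊢
          generalize (rootSystem H).pairingIn ℤ j i = q at h1 hpos
          simp only [Set.mem_insert_iff, Set.mem_singleton_iff, Prod.mk.injEq] at h1
          clear hj
          omega
        · have h3 : (rootSystem H).pairing j i = -2 := by
            have : (rootSystem H).root j = -(rootSystem H).root i := by rw [h, neg_neg]
            have h4 : (rootSystem H).root j ((rootSystem H).coroot i) =
                -(rootSystem H).root i ((rootSystem H).coroot i) := by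
              rw [this, LinearMap.neg_apply]
            have h5 : (rootSystem H).root i ((rootSystem H).coroot i) = 2 :=
              (rootSystem H).pairing_same i
            rw [h5] at h4
            exact h4
          rw [← (rootSystem H).algebraMap_pairingIn ℤ, eq_intCast] at h3
          have : (rootSystem H).pairingIn ℤ j i = -2 := by exact_mod_cast h3
          lia
      have h3 := root_reflectionPerm_eq j i
      rw [root_apply_coroot_eq_pairingIn, h2] at h3
      obtain ⟨l, hl⟩ := neg_mem_range_root ((rootSystem H).reflectionPerm j i)
      refine Or.inr (Or.inl ⟨l, ?_⟩)
      rw [← hl, h3]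
      push_cast
      module

variable (b : (rootSystem H).Base)

/-- Sums of simple roots. -/
def rootCone : AddSubmonoid (Dual ℂ H) :=
  AddSubmonoid.closure ((rootSystem H).root '' b.support)

theorem root_mem_or_neg_mem_rootCone (i : H.root) :
    (rootSystem H).root i ∈ rootCone b ∨ -(rootSystem H).root i ∈ rootCone b :=
  b.root_mem_or_neg_mem i

theorem mem_or_neg_mem_rootCone_of_mem_saturatedSet {μ : Dual ℂ H} (hμ : μ ∈ saturatedSet H) :
    μ ∈ rootCone b ∨ -μ ∈ rootCone b := by
  rcases hμ with rfl | ⟨j, rfl⟩ | ⟨j, -, rfl⟩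
  · left; exact zero_mem _
  · exact root_mem_or_neg_mem_rootCone b j
  · rcases root_mem_or_neg_mem_rootCone b j with h | h
    · left; rw [two_smul]; exact add_mem h h
    · right; rw [two_smul, neg_add]; exact add_mem h h

theorem exists_height : ∃ ht : Dual ℂ H →ₗ[ℂ] ℂ, ∀ x ∈ rootCone b,
    ∃ k : ℕ, ht x = k ∧ (k = 0 → x = 0) := by
  refine ⟨b.toWeightBasis.constr ℂ fun _ => (1 : ℂ), fun x hx => ?_⟩
  induction hx using AddSubmonoid.closure_induction with
  | mem x hx =>
    obtain ⟨i, hi, rfl⟩ := hx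
    refine ⟨1, ?_, fun h => absurd h one_ne_zero⟩
    have h := b.toWeightBasis.constr_basis ℂ (fun _ => (1 : ℂ)) ⟨i, hi⟩
    simpa using h
  | zero => exact ⟨0, by simp, fun _ => rfl⟩
  | add x y _ _ hx hy =>
    obtain ⟨k, hk, hk0⟩ := hx
    obtain ⟨l, hl, hl0⟩ := hy
    refine ⟨k + l, by rw [map_add, hk, hl]; push_cast; rfl, fun h => ?_⟩
    rw [hk0 (by lia), hl0 (by lia), add_zero]

theorem eq_zero_of_mem_rootCone {x : Dual ℂ H} (hx : x ∈ rootCone b) (hx' : -x ∈ rootCone b) :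
    x = 0 := by
  obtain ⟨ht, h⟩ := exists_height b
  obtain ⟨k, hk, hk0⟩ := h x hx
  obtain ⟨l, hl, -⟩ := h (-x) hx'
  rw [map_neg, hk] at hl
  refine hk0 ?_
  have : (k : ℂ) + l = 0 := by rw [← hl]; ring
  have : k + l = 0 := by exact_mod_cast this
  lia

/-! ### Weights of irreducible modules -/

variable {M : Type*} [AddCommGroup M] [Module ℂ M] [LieRingModule L M] [LieModule ℂ L M]

/-- The vectors of weight `μ` in `M`. -/
def vectorsOfWeight (H : LieSubalgebra ℂ L) (M : Type*) [AddCommGroup M] [Module ℂ M]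
    [LieRingModule L M] [LieModule ℂ L M] (μ : Dual ℂ H) : Submodule ℂ M where
  carrier := {w | ∀ h : H, ⁅(h : L), w⁆ = μ h • w}
  add_mem' {v w} hv hw h := by rw [lie_add, hv h, hw h, smul_add]
  zero_mem' h := by simp
  smul_mem' c v hv h := by rw [lie_smul, hv h, smul_comm]

omit [FiniteDimensional ℂ L] [IsKilling ℂ L] in
theorem vectorsOfWeight_le (μ : Dual ℂ H) :
    vectorsOfWeight H M μ ≤ (LieModule.genWeightSpace M (μ : H → ℂ)).toSubmodule := by
  intro w hw
  refine LieModule.weightSpace_le_genWeightSpace M _ ?_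
  rw [LieModule.mem_weightSpace]
  exact hw

omit [FiniteDimensional ℂ L] [IsKilling ℂ L] in
theorem iSupIndep_vectorsOfWeight : iSupIndep (vectorsOfWeight H M) := by
  have h := LieModule.iSupIndep_genWeightSpace ℂ H M
  rw [← LieSubmodule.iSupIndep_toSubmodule] at h
  exact (h.comp (f := fun μ : Dual ℂ H => (μ : H → ℂ)) DFunLike.coe_injective).mono
    fun μ => vectorsOfWeight_le μ

theorem lie_mem_vectorsOfWeight {i : H.root} {x : L} (hx : x ∈ rootSpace H i.1) {μ : Dual ℂ H}
    {w : M} (hw : w ∈ vectorsOfWeight H M μ) :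
    ⁅x, w⁆ ∈ vectorsOfWeight H M (μ + (rootSystem H).root i) := by
  intro h
  have h1 : ⁅(h : L), x⁆ = (rootSystem H).root i h • x := lie_eq_smul_of_mem_rootSpace hx h
  rw [leibniz_lie, h1, hw h, smul_lie, lie_smul, LinearMap.add_apply, add_smul, add_comm]

theorem cartan_sup_iSup_rootSpace :
    (⨆ (i : H.root) (_ : -(rootSystem H).root i ∈ rootCone b),
      (rootSpace H i.1).toSubmodule) ⊔ (H.toSubmodule ⊔
    ⨆ (i : H.root) (_ : (rootSystem H).root i ∈ rootCone b), (rootSpace H i.1).toSubmodule) = ⊤ := by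
  have h := LieModule.iSup_genWeightSpace_eq_top' ℂ H L
  have h' : ⨆ χ : LieModule.Weight ℂ H L, (rootSpace H χ).toSubmodule = ⊤ := by
    rw [← LieSubmodule.iSup_toSubmodule, h]; rfl
  rw [eq_top_iff, ← h']
  refine iSup_le fun χ => ?_
  by_cases hχ : χ.IsZero
  · refine le_sup_of_le_right (le_sup_of_le_left ?_)
    rw [hχ.eq]
    intro x hx
    have := LieAlgebra.rootSpace_zero_eq ℂ L H
    have hx' : x ∈ rootSpace H (0 : H → ℂ) := hx
    rw [this] at hx'
    exact hx'
  · let i : H.root := ⟨χ, by simpa using hχ⟩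
    rcases root_mem_or_neg_mem_rootCone b i with hi | hi
    · exact le_sup_of_le_right (le_sup_of_le_right (le_iSup₂_of_le i hi le_rfl))
    · exact le_sup_of_le_left (le_iSup₂_of_le i hi le_rfl)

/-- The weights of an irreducible module are below the weight of any primitive vector. -/
theorem sub_mem_rootCone [LieModule.IsIrreducible ℂ L M] {lam μ : Dual ℂ H} {w v : M} (hw0 : w ≠ 0)
    (hw : w ∈ vectorsOfWeight H M lam)
    (hprim : ∀ i : H.root, (rootSystem H).root i ∈ rootCone b → ∀ x ∈ rootSpace H i.1, ⁅x, w⁆ = 0)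
    (hv0 : v ≠ 0) (hv : v ∈ vectorsOfWeight H M μ) : lam - μ ∈ rootCone b := by
  obtain ⟨T, hT, hTle⟩ := exists_lieSubmodule_of_stable (cartan_sup_iSup_rootSpace b)
    (T₀ := ℂ ∙ w) (fun x hx t ht => by
      obtain ⟨c, rfl⟩ := Submodule.mem_span_singleton.1 ht
      obtain ⟨h, hh, y, hy, rfl⟩ := Submodule.mem_sup.1 hx
      have hy' : ⁅y, w⁆ = 0 := by
        have hle : (⨆ (i : H.root) (_ : (rootSystem H).root i ∈ rootCone b),
            (rootSpace H i.1).toSubmodule) ≤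
            LinearMap.ker ((LieModule.toEnd ℂ L M : L →ₗ[ℂ] End ℂ M).flip w) :=
          iSup₂_le fun i hi x hx => hprim i hi x hx
        exact hle hy
      have hh' : ⁅h, w⁆ = lam ⟨h, hh⟩ • w := hw ⟨h, hh⟩
      rw [lie_smul, add_lie, hy', hh', add_zero]
      exact Submodule.smul_mem _ _ (Submodule.smul_mem _ _ (Submodule.mem_span_singleton_self w)))
  have hTtop : T = ⊤ := by
    refine (eq_bot_or_eq_top T).resolve_left fun h => hw0 ?_
    have : w ∈ T := hT (Submodule.mem_span_singleton_self w)
    rwa [h, LieSubmodule.mem_bot] at this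
  have hS := hTle (⨆ (ν : Dual ℂ H) (_ : lam - ν ∈ rootCone b), vectorsOfWeight H M ν) ?_ ?_
  · have hvS : v ∈ ⨆ ν : Dual ℂ H, ⨆ (_ : lam - ν ∈ rootCone b), vectorsOfWeight H M ν :=
      hS (by rw [hTtop]; exact Submodule.mem_top)
    have := mem_of_mem_iSup_of_iSupIndep (iSupIndep_vectorsOfWeight (H := H) (M := M))
      (fun ν => iSup_le fun _ => le_rfl) hv hvS
    by_contra hcon
    rw [iSup_neg hcon, Submodule.mem_bot] at this
    exact hv0 this
  · rw [Submodule.span_singleton_le_iff_mem]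
    exact Submodule.mem_iSup_of_mem lam (Submodule.mem_iSup_of_mem
      (by rw [sub_self]; exact zero_mem _) hw)
  · intro x hx t ht
    induction ht using Submodule.iSup_induction' with
    | zero => rw [lie_zero]; exact zero_mem _
    | add s t _ _ hs ht => rw [lie_add]; exact add_mem hs ht
    | mem ν t ht =>
      by_cases hν : lam - ν ∈ rootCone b
      swap
      · rw [iSup_neg hν, Submodule.mem_bot] at ht
        rw [ht, lie_zero]; exact zero_mem _
      rw [iSup_pos hν] at ht
      induction hx using Submodule.iSup_induction' with
      | zero => rw [zero_lie]; exact zero_mem _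
      | add x y _ _ hx hy => rw [add_lie]; exact add_mem hx hy
      | mem i x hx =>
        by_cases hi : -(rootSystem H).root i ∈ rootCone b
        swap
        · rw [iSup_neg hi, Submodule.mem_bot] at hx
          rw [hx, zero_lie]; exact zero_mem _
        rw [iSup_pos hi] at hx
        refine Submodule.mem_iSup_of_mem (ν + (rootSystem H).root i) (Submodule.mem_iSup_of_mem ?_
          (lie_mem_vectorsOfWeight hx ht))
        rw [← sub_sub, sub_eq_add_neg _ ((rootSystem H).root i)]
        exact add_mem hν hi

end RootSystem

end LieTorus

namespace LieTorus

open LieAlgebra LieAlgebra.IsKilling Module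

section RootSystem

variable {L : Type*} [LieRing L] [LieAlgebra ℂ L] [FiniteDimensional ℂ L] [IsKilling ℂ L]
  {H : LieSubalgebra ℂ L} [H.IsCartanSubalgebra] (b : (rootSystem H).Base)
  {M : Type*} [AddCommGroup M] [Module ℂ M] [LieRingModule L M] [LieModule ℂ L M]

theorem pow_toEnd_mem_vectorsOfWeight {i : H.root} {x : L} (hx : x ∈ rootSpace H i.1)
    {μ : Dual ℂ H} {w : M} (hw : w ∈ vectorsOfWeight H M μ) (k : ℕ) :
    (LieModule.toEnd ℂ L M x ^ k) w ∈ vectorsOfWeight H M (μ + (k : ℂ) • (rootSystem H).root i) := by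
  induction k with
  | zero => simpa using hw
  | succ k ih =>
    rw [pow_succ', Module.End.mul_apply, LieModule.toEnd_apply_apply]
    have := lie_mem_vectorsOfWeight hx ih
    have e : μ + (k : ℂ) • (rootSystem H).root i + (rootSystem H).root i =
        μ + ((k + 1 : ℕ) : ℂ) • (rootSystem H).root i := by
      push_cast; module
    rwa [e] at this

/-- The weights of an irreducible module whose highest weight lies in `saturatedSet H` all lie in
`saturatedSet H`. -/
theorem mem_saturatedSet_of_isIrreducible [FiniteDimensional ℂ M] [LieModule.IsIrreducible ℂ L M]
    {lam : Dual ℂ H} (hlam : lam ∈ saturatedSet H) {w₀ : M} (hw₀ : w₀ ≠ 0)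
    (hw : w₀ ∈ vectorsOfWeight H M lam)
    (hprim : ∀ i : H.root, (rootSystem H).root i ∈ rootCone b → ∀ x ∈ rootSpace H i.1, ⁅x, w₀⁆ = 0)
    {μ : Dual ℂ H} (hμ : vectorsOfWeight H M μ ≠ ⊥) : μ ∈ saturatedSet H := by
  let r : {μ : Dual ℂ H // vectorsOfWeight H M μ ≠ ⊥} →
      {μ : Dual ℂ H // vectorsOfWeight H M μ ≠ ⊥} → Prop := fun ν μ => ν.1 - μ.1 ∈ rootCone b ∧ ν ≠ μ
  have hfin : Finite {μ : Dual ℂ H // vectorsOfWeight H M μ ≠ ⊥} :=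
    WellFoundedGT.finite_ne_bot_of_iSupIndep iSupIndep_vectorsOfWeight
  have htr : IsTrans _ r := ⟨fun x y z hxy hyz => by
    have h1 : x.1 - z.1 ∈ rootCone b := by
      have := add_mem hxy.1 hyz.1
      rwa [sub_add_sub_cancel] at this
    refine ⟨h1, ?_⟩
    rintro rfl
    refine hxy.2 (Subtype.ext (sub_eq_zero.1 (eq_zero_of_mem_rootCone b hxy.1 ?_)))
    rw [neg_sub]; exact hyz.1⟩
  have hirr : Std.Irrefl r := ⟨fun x h => h.2 rfl⟩
  have hwf : WellFounded r := Finite.wellFounded_of_trans_of_irrefl r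
  suffices h : ∀ μ : {μ : Dual ℂ H // vectorsOfWeight H M μ ≠ ⊥}, μ.1 ∈ saturatedSet H from h ⟨μ, hμ⟩
  intro μ
  induction μ using hwf.induction with
  | _ μ ih =>
  obtain ⟨μ, hμ⟩ := μ
  have ih' : ∀ ν, vectorsOfWeight H M ν ≠ ⊥ → ν - μ ∈ rootCone b → ν ≠ μ → ν ∈ saturatedSet H :=
    fun ν h1 h2 h3 => ih ⟨ν, h1⟩ ⟨h2, fun h => h3 (congrArg Subtype.val h)⟩
  obtain ⟨w, hwμ, hw0⟩ := (Submodule.ne_bot_iff _).1 hμ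
  by_cases hp : ∀ i : H.root, (rootSystem H).root i ∈ rootCone b →
      ∀ x ∈ rootSpace H i.1, ⁅x, w⁆ = 0
  · have h1 := sub_mem_rootCone b hw₀ hw hprim hw0 hwμ
    have h2 := sub_mem_rootCone b hw0 hwμ hp hw₀ hw
    have h3 := eq_zero_of_mem_rootCone b h1 (by rwa [neg_sub])
    exact sub_eq_zero.1 h3 ▸ hlam
  push Not at hp
  obtain ⟨i, hi, x, hx, hxw⟩ := hp
  have hroot0 : (rootSystem H).root i ≠ 0 := (rootSystem H).ne_zero i
  have hβ : μ + (rootSystem H).root i ∈ saturatedSet H := by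
    refine ih' _ (fun h => hxw ?_) (by rwa [add_sub_cancel_left]) (by simp)
    have := lie_mem_vectorsOfWeight hx hwμ
    rwa [h, Submodule.mem_bot] at this
  have hnz : (i.1).IsNonZero := (Finset.mem_filter.1 i.2).2
  obtain ⟨h, e, f, t, he, hf⟩ := exists_isSl2Triple_of_weight_isNonZero hnz
  have hh := t.h_eq_coroot hnz he hf
  obtain ⟨c, hc⟩ : ∃ c, c = μ ((rootSystem H).coroot i) := ⟨_, rfl⟩
  have hhw : ⁅h, w⁆ = c • w := by rw [hh, hc]; exact hwμ _
  obtain ⟨p, hpw, hpw'⟩ := Nat.exists_not_and_succ_of_not_zero_of_exists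
    (p := fun p => (LieModule.toEnd ℂ L M e ^ p) w = 0) (by simpa using hw0)
    (exists_pow_toEnd_e_eq_zero t hhw)
  have hprimv : t.HasPrimitiveVectorWith ((LieModule.toEnd ℂ L M e ^ p) w) (c + 2 * p) :=
    { ne_zero := hpw
      lie_h := t.lie_h_pow_toEnd_e hhw p
      lie_e := by
        rw [pow_succ', Module.End.mul_apply] at hpw'
        exact hpw' }
  obtain ⟨N, hN⟩ := hprimv.exists_nat
  have h2 : (rootSystem H).root i ((rootSystem H).coroot i) = 2 := (rootSystem H).pairing_same i
  rcases lt_or_ge N (2 * p) with hlt | hge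
  · obtain ⟨k, hk⟩ := Nat.exists_eq_add_of_lt hlt
    have hck : c = (-(k + 1 : ℕ) : ℂ) := by
      have : (2 * p : ℂ) = N + k + 1 := by exact_mod_cast hk
      rw [eq_sub_of_add_eq hN, this]; push_cast; ring
    have hne := pow_toEnd_e_ne_zero t (Nat.succ_pos k) (by rw [hhw, hck]) hw0
    have hmem := pow_toEnd_mem_vectorsOfWeight he hwμ (k + 1)
    have hsμ : μ + ((k + 1 : ℕ) : ℂ) • (rootSystem H).root i ∈ saturatedSet H := by
      refine ih' _ (fun h => hne ?_) ?_ ?_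
      · rwa [h, Submodule.mem_bot] at hmem
      · rw [add_sub_cancel_left, Nat.cast_smul_eq_nsmul]
        exact nsmul_mem hi _
      · rw [Ne, add_eq_left, smul_eq_zero, not_or]
        exact ⟨by exact_mod_cast Nat.succ_ne_zero k, hroot0⟩
    have := reflection_mem_saturatedSet i hsμ
    rw [LinearMap.add_apply, LinearMap.smul_apply, h2, ← hc, hck] at this
    have e : μ + ((k + 1 : ℕ) : ℂ) • (rootSystem H).root i -
        ((-(k + 1 : ℕ) : ℂ) + ((k + 1 : ℕ) : ℂ) • (2 : ℂ)) • (rootSystem H).root i = μ := by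
      rw [smul_eq_mul]; module
    rwa [e] at this
  · obtain ⟨k, hk⟩ := Nat.exists_eq_add_of_le hge
    have hck : c = k := by
      rw [eq_sub_of_add_eq hN, hk]; push_cast; ring
    have := sub_root_mem_saturatedSet i hβ (k := k + 2) (by lia)
      (by rw [LinearMap.add_apply, h2, ← hc, hck]; push_cast; rfl)
    rwa [add_sub_cancel_right] at this

/-! ### Short roots in type `B` -/

theorem rootForm_mul_pairingIn (i j : H.root) :
    ((rootSystem H).pairingIn ℤ i j : ℝ) *
        ((rootSystem H).RootForm ((rootSystem H).root j) ((rootSystem H).root j)).re =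
      ((rootSystem H).pairingIn ℤ j i : ℝ) *
        ((rootSystem H).RootForm ((rootSystem H).root i) ((rootSystem H).root i)).re := by
  have h := (rootSystem H).toInvariantForm.pairing_mul_eq_pairing_mul_swap i j
  rw [RootPairing.toInvariantForm_form, ← (rootSystem H).algebraMap_pairingIn ℤ,
    ← (rootSystem H).algebraMap_pairingIn ℤ, eq_intCast, eq_intCast] at h
  have h' := congrArg Complex.re h
  rw [← Complex.ofReal_intCast, ← Complex.ofReal_intCast, Complex.re_ofReal_mul,
    Complex.re_ofReal_mul] at h'
  exact h'.symm

theorem re_rootForm_pos (i : H.root) :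
    0 < ((rootSystem H).RootForm ((rootSystem H).root i) ((rootSystem H).root i)).re := by
  rw [RootPairing.rootForm_root_self, Complex.re_sum]
  have h : ∀ k : H.root, ((rootSystem H).pairing i k * (rootSystem H).pairing i k).re =
      ((rootSystem H).pairingIn ℤ i k : ℝ) * ((rootSystem H).pairingIn ℤ i k : ℝ) := by
    intro k
    rw [← (rootSystem H).algebraMap_pairingIn ℤ, eq_intCast, ← Int.cast_mul, Complex.intCast_re,
      Int.cast_mul]
  simp only [h]
  refine Finset.sum_pos' (fun k _ => mul_self_nonneg _) ⟨i, Finset.mem_univ _, ?_⟩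
  rw [RootPairing.pairingIn_same]
  norm_num

theorem rootForm_reflectionPerm (i j : H.root) :
    (rootSystem H).RootForm ((rootSystem H).root ((rootSystem H).reflectionPerm i j))
      ((rootSystem H).root ((rootSystem H).reflectionPerm i j)) =
    (rootSystem H).RootForm ((rootSystem H).root j) ((rootSystem H).root j) := by
  rw [RootPairing.root_reflectionPerm, RootPairing.rootForm_reflection_reflection_apply]

theorem exists_simple_of_root (i : H.root) : ∃ j ∈ b.support,
    (rootSystem H).RootForm ((rootSystem H).root i) ((rootSystem H).root i) =
      (rootSystem H).RootForm ((rootSystem H).root j) ((rootSystem H).root j) ∧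
    ((∀ k, Even ((rootSystem H).pairingIn ℤ k j)) →
      ∀ k, Even ((rootSystem H).pairingIn ℤ k i)) := by
  induction i using b.induction_reflect with
  | h₀ i hi =>
    obtain ⟨j, hj, h1, h2⟩ := hi
    exact ⟨j, hj, by rw [rootForm_reflectionPerm, h1],
      fun h => even_pairingIn_reflectionPerm i (h2 h)⟩
  | h₁ i hi => exact ⟨i, hi, rfl, id⟩
  | h₂ i l hi hl =>
    obtain ⟨j, hj, h1, h2⟩ := hi
    exact ⟨j, hj, by rw [rootForm_reflectionPerm, h1],
      fun h => even_pairingIn_reflectionPerm l (h2 h)⟩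

theorem even_pairingIn_of_forall_support {i : H.root}
    (h : ∀ j ∈ b.support, Even ((rootSystem H).pairingIn ℤ j i)) (j : H.root) :
    Even ((rootSystem H).pairingIn ℤ j i) := by
  have key : ∀ x ∈ Submodule.span ℤ ((rootSystem H).root '' b.support),
      ∃ r : ℤ, x ((rootSystem H).coroot i) = ((r + r : ℤ) : ℂ) := by
    intro x hx
    induction hx using Submodule.span_induction with
    | mem x hx =>
      obtain ⟨k, hk, rfl⟩ := hx
      obtain ⟨r, hr⟩ := h k hk
      exact ⟨r, by rw [root_apply_coroot_eq_pairingIn, hr]⟩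
    | zero => exact ⟨0, by simp⟩
    | add x y _ _ hx hy =>
      obtain ⟨r, hr⟩ := hx
      obtain ⟨s, hs⟩ := hy
      exact ⟨r + s, by rw [LinearMap.add_apply, hr, hs]; push_cast; ring⟩
    | smul c x _ hx =>
      obtain ⟨r, hr⟩ := hx
      exact ⟨c * r, by rw [LinearMap.smul_apply, hr, zsmul_eq_mul]; push_cast; ring⟩
  obtain ⟨r, hr⟩ := key _ (b.root_mem_span_int j)
  rw [root_apply_coroot_eq_pairingIn] at hr
  exact ⟨r, by exact_mod_cast hr⟩

variable {b}

theorem even_pairingIn_of_typeB {l : ℕ} (e : b.support ≃ Fin l)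
    (hB : ∀ i j, b.cartanMatrix i j = CartanMatrix.B l (e i) (e j)) {i : H.root}
    (hi : ∀ j : H.root,
      ((rootSystem H).RootForm ((rootSystem H).root i) ((rootSystem H).root i)).re ≤
        ((rootSystem H).RootForm ((rootSystem H).root j) ((rootSystem H).root j)).re) (k : H.root) :
    Even ((rootSystem H).pairingIn ℤ k i) := by
  have hB' : ∀ x y : Fin l, (rootSystem H).pairingIn ℤ (e.symm x) (e.symm y) =
      CartanMatrix.B l x y := by
    intro x y
    have := hB (e.symm x) (e.symm y)
    rwa [e.apply_symm_apply, e.apply_symm_apply] at this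
  let len : Fin l → ℝ := fun x => ((rootSystem H).RootForm
    ((rootSystem H).root (e.symm x)) ((rootSystem H).root (e.symm x))).re
  have hlen : ∀ x y : Fin l, (CartanMatrix.B l x y : ℝ) * len y = CartanMatrix.B l y x * len x := by
    intro x y
    rw [← hB', ← hB']
    exact rootForm_mul_pairingIn _ _
  obtain ⟨j, hj, hij, heven⟩ := exists_simple_of_root b i
  have hl : 0 < l := (e ⟨j, hj⟩).pos
  let q : Fin l := ⟨l - 1, by lia⟩
  have hlong : ∀ (d : ℕ) (x : Fin l), x.val + (d + 1) = l - 1 → len x = 2 * len q := by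
    intro d
    induction d with
    | zero =>
      intro x hx
      have h1 := hlen x q
      have hxq : x ≠ q := fun h => by rw [h] at hx; simp [q] at hx
      have e1 : CartanMatrix.B l x q = -2 := by
        simp only [CartanMatrix.B, Matrix.of_apply, if_neg hxq]
        rw [if_pos (by simpa [q] using hx), if_pos rfl]
      have e2 : CartanMatrix.B l q x = -1 := by
        simp only [CartanMatrix.B, Matrix.of_apply, if_neg hxq.symm]
        rw [if_neg (by simp only [q]; lia), if_pos (by simpa [q] using hx)]
      rw [e1, e2] at h1
      push_cast at h1
      linarith
    | succ d ih =>
      intro x hx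
      let y : Fin l := ⟨x.val + 1, by lia⟩
      have hy : len y = 2 * len q := ih y (by simp only [y]; lia)
      have hxy : x ≠ y := fun h => by have := congrArg Fin.val h; simp [y] at this
      have h1 := hlen x y
      have e1 : CartanMatrix.B l x y = -1 := by
        simp only [CartanMatrix.B, Matrix.of_apply, if_neg hxy]
        rw [if_pos rfl, if_neg (by simp only [y]; lia)]
      have e2 : CartanMatrix.B l y x = -1 := by
        simp only [CartanMatrix.B, Matrix.of_apply, if_neg hxy.symm]
        rw [if_neg (by simp only [y]; lia), if_pos rfl]
      rw [e1, e2] at h1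
      push_cast at h1
      linarith
  have hjq : e ⟨j, hj⟩ = q := by
    by_contra hne
    have hval : (e ⟨j, hj⟩).val ≠ l - 1 := fun h => hne (Fin.ext h)
    have h1 := hlong (l - 1 - (e ⟨j, hj⟩).val - 1) (e ⟨j, hj⟩) (by lia)
    have h2 := hi (e.symm q)
    rw [hij] at h2
    have h3 : len (e ⟨j, hj⟩) ≤ len q := by
      simp only [len]
      rw [e.symm_apply_apply]
      exact h2
    have h4 : 0 < len q := re_rootForm_pos _
    linarith
  refine heven (even_pairingIn_of_forall_support b fun k hk => ?_) k
  have h1 : (rootSystem H).pairingIn ℤ k j = CartanMatrix.B l (e ⟨k, hk⟩) q := by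
    rw [← hjq]; exact hB ⟨k, hk⟩ ⟨j, hj⟩
  rw [h1]
  simp only [CartanMatrix.B, Matrix.of_apply]
  split_ifs with h2 h3 h4 h5
  · exact even_two
  · exact ⟨-1, rfl⟩
  · exact absurd rfl h4
  · simp only [q] at h5; lia
  · exact Even.zero

end RootSystem

namespace Datum

universe u
variable {n : ℕ} {𝔤 : Type u} [LieRing 𝔤] [LieAlgebra ℂ 𝔤] [FiniteDimensional ℂ 𝔤]
variable (D : Datum n 𝔤)
variable [LieAlgebra.IsSimple ℂ D.fixed] {𝔥 : LieSubalgebra ℂ D.fixed} [𝔥.IsCartanSubalgebra]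
  {b : (rootSystem 𝔥).Base}

theorem mem_saturatedSet_of_isPropertyMWeight {lam : Dual ℂ 𝔥} (h : D.IsPropertyMWeight b lam) :
    lam ∈ saturatedSet 𝔥 := by
  rcases h with ⟨⟨i, rfl⟩, -⟩ | ⟨-, ⟨i, -, rfl⟩, -⟩ | ⟨⟨l, e, hB⟩, _, ⟨⟨i, hi, rfl⟩, -⟩, rfl⟩
  · exact Or.inr (Or.inl ⟨i, rfl⟩)
  · exact Or.inr (Or.inl ⟨i, rfl⟩)
  · exact Or.inr (Or.inr ⟨i, even_pairingIn_of_typeB e hB hi, rfl⟩)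

/-- Every weight of `𝔥(0)` in `𝔤` is a sum of simple roots or the negative of such a sum. -/
theorem mem_or_neg_mem_posCone (hD : D.IsLieTorus b) {κ : Fin (n + 1) → ℤ} {α : Dual ℂ 𝔥}
    (hα : D.gradedRoot 𝔥 κ α ≠ ⊥) : α ∈ D.posCone b ∨ -α ∈ D.posCone b := by
  obtain ⟨X, hX, hX0⟩ := (Submodule.ne_bot_iff _).1 hα
  obtain ⟨U, W, -, hUW, hU, hW⟩ := hD κ
  have hXκ : X ∈ U ⊔ W := hUW ▸ (show X ∈ D.gradedModule κ from hX.1)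
  obtain ⟨u, hu, w, hw, rfl⟩ := (LieSubmodule.mem_sup _ _ _).1 hXκ
  by_cases hα0 : α = 0
  · rw [hα0]; exact Or.inl (zero_mem _)
  obtain ⟨h₀, hh₀⟩ : ∃ h : 𝔥, α h ≠ 0 := by
    by_contra! hcon
    exact hα0 (LinearMap.ext hcon)
  have hwt : ∀ h : 𝔥, ⁅(h : D.fixed), w⁆ = α h • (u + w) := by
    intro h
    have h1 : ⁅(h : D.fixed), u + w⁆ = α h • (u + w) := hX.2 h
    have h2 : ⁅(h : D.fixed), u⁆ = 0 :=
      congrArg (fun x : U => (x : 𝔤)) (hU.trivial (h : D.fixed) ⟨u, hu⟩)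
    rwa [lie_add, h2, zero_add] at h1
  have hmem : u + w ∈ W := by
    have h1 : ⁅(h₀ : D.fixed), w⁆ ∈ W := LieSubmodule.lie_mem W hw
    rw [hwt] at h1
    have := Submodule.smul_mem W.toSubmodule (α h₀)⁻¹ h1
    rwa [smul_smul, inv_mul_cancel₀ hh₀, one_smul] at this
  rcases hW with rfl | ⟨hirr, lam, v, hv, hv0, hlam, hprim, hM⟩
  · exact absurd ((LieSubmodule.mem_bot _).1 hmem) hX0
  refine mem_or_neg_mem_rootCone_of_mem_saturatedSet b
    (mem_saturatedSet_of_isIrreducible b (M := W) (D.mem_saturatedSet_of_isPropertyMWeight hM)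
      (w₀ := ⟨v, hv⟩) (fun h => hv0 (congrArg Subtype.val h)) (fun h => Subtype.ext (hlam h))
      (fun i hi x hx => Subtype.ext (hprim i hi x hx)) ?_)
  refine (Submodule.ne_bot_iff _).2 ⟨⟨u + w, hmem⟩, fun h => Subtype.ext (hX.2 h),
    fun h => hX0 (congrArg Subtype.val h)⟩

end Datum

end LieTorus

namespace LieTorus
namespace Datum

universe u
variable {n : ℕ} {𝔤 : Type u} [LieRing 𝔤] [LieAlgebra ℂ 𝔤] (D : Datum n 𝔤)

/-! ### Homogeneous elements of `𝔏` -/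

theorem L_ext {x y : D.L} (h1 : D.loopL x = D.loopL y) (h2 : D.cenL x = D.cenL y)
    (h3 : D.dL x = D.dL y) : x = y := Subtype.ext (Ambient.ext h1 h2 h3)

theorem graded_add_expIncl (κ : Fin (n + 1) → ℤ) (γ : D.Γ) :
    D.graded (κ + D.expIncl γ) = D.graded κ := by
  refine D.graded_congr (D.ξ_zpow_congr fun i => ?_)
  rw [Pi.add_apply, add_sub_cancel_left]
  refine Fin.cases ?_ (fun j => ?_) i
  · simp [expIncl]
  · exact γ.2 j

theorem Am_induction {p : D.Am → Prop} (f : D.Am) (h1 : ∀ γ, p (AddMonoidAlgebra.single γ 1))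
    (h2 : ∀ f g, p f → p g → p (f + g)) (h3 : ∀ (c : ℂ) f, p f → p (c • f)) : p f := by
  have hf := (AddMonoidAlgebra.basis D.Γ ℂ).mem_span f
  induction hf using Submodule.span_induction with
  | mem x hx => obtain ⟨γ, rfl⟩ := hx; simpa using h1 γ
  | zero => simpa using h3 0 _ (h1 0)
  | add x y _ _ hx hy => exact h2 x y hx hy
  | smul c x _ hx => exact h3 c x hx

theorem single_mul_incl_single (κ : Fin (n + 1) → ℤ) (γ : D.Γ) :
    (AddMonoidAlgebra.single κ 1 * D.incl (AddMonoidAlgebra.single γ 1) : Laurent n) =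
      AddMonoidAlgebra.single (κ + D.expIncl γ) 1 := by
  rw [incl_single, AddMonoidAlgebra.single_mul_single, one_mul]

theorem tmul_mem_homSpan {S : (Fin (n + 1) → ℤ) → Set 𝔤}
    (hS : ∀ κ (γ : D.Γ), S κ ⊆ S (κ + D.expIncl γ)) {κ : Fin (n + 1) → ℤ} {X : 𝔤} (hX : X ∈ S κ)
    (f : D.Am) : Loop.tmul (AddMonoidAlgebra.single κ 1 * D.incl f) X ∈ homSpan S := by
  induction f using D.Am_induction with
  | h1 γ =>
    rw [single_mul_incl_single]
    exact Submodule.subset_span ⟨_, X, hS κ γ hX, rfl⟩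
  | h2 f g hf hg => rw [map_add, mul_add, Loop.add_tmul]; exact add_mem hf hg
  | h3 c f hf => rw [map_smul, mul_smul_comm, smul_tmul]; exact Submodule.smul_mem _ _ hf

/-- The element `X t^κ f` of `𝔏`, for `X ∈ 𝔤(κ)` and `f ∈ A(m)`. -/
def elem (κ : Fin (n + 1) → ℤ) {X : 𝔤} (hX : X ∈ D.graded κ) (f : D.Am) : D.L :=
  ⟨Ambient.mk (Loop.tmul (AddMonoidAlgebra.single κ 1 * D.incl f) X) 0 0,
    D.tmul_mem_homSpan (S := fun κ => D.graded κ)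
      (fun κ γ => (D.graded_add_expIncl κ γ).ge) hX f⟩

/-- The element `K ⊗ f` of `𝔏`. -/
def cent : D.Am →ₗ[ℂ] D.L where
  toFun f := ⟨Ambient.mk 0 f 0, zero_mem D.LT⟩
  map_add' _ _ := D.L_ext (add_zero (0 : Loop n 𝔤)).symm rfl (add_zero (0 : ℂ)).symm
  map_smul' c _ := D.L_ext (smul_zero (A := Loop n 𝔤) c).symm rfl (smul_zero (A := ℂ) c).symm

/-- The element `d₀` of `𝔏`. -/
def dElem : D.L := ⟨Ambient.mk 0 0 1, zero_mem D.LT⟩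

variable {κ μ ν : Fin (n + 1) → ℤ} {X Y : 𝔤}

@[simp] theorem loopL_elem (hX : X ∈ D.graded κ) (f : D.Am) : D.loopL (D.elem κ hX f) =
    Loop.tmul (AddMonoidAlgebra.single κ 1 * D.incl f) X := rfl

@[simp] theorem cenL_elem (hX : X ∈ D.graded κ) (f : D.Am) : D.cenL (D.elem κ hX f) = 0 := rfl

@[simp] theorem dL_elem (hX : X ∈ D.graded κ) (f : D.Am) : D.dL (D.elem κ hX f) = 0 := rfl

@[simp] theorem loopL_cent (f : D.Am) : D.loopL (D.cent f) = 0 := rfl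

@[simp] theorem cenL_cent (f : D.Am) : D.cenL (D.cent f) = f := rfl

@[simp] theorem dL_cent (f : D.Am) : D.dL (D.cent f) = 0 := rfl

theorem loopL_dElem : D.loopL D.dElem = 0 := rfl

theorem dL_dElem : D.dL D.dElem = 1 := rfl

theorem elem_add (hX : X ∈ D.graded κ) (f g : D.Am) :
    D.elem κ hX (f + g) = D.elem κ hX f + D.elem κ hX g := by
  refine D.L_ext ?_ ?_ ?_
  · rw [map_add, loopL_elem, loopL_elem, loopL_elem, map_add, mul_add, Loop.add_tmul]
  · simp
  · simp

theorem elem_smul (hX : X ∈ D.graded κ) (c : ℂ) (f : D.Am) :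
    D.elem κ hX (c • f) = c • D.elem κ hX f := by
  refine D.L_ext ?_ ?_ ?_
  · rw [map_smul, loopL_elem, loopL_elem, map_smul, mul_smul_comm, smul_tmul]
  · simp
  · simp

theorem elem_add_left (hX : X ∈ D.graded κ) (hY : Y ∈ D.graded κ) (f : D.Am) :
    D.elem κ (add_mem hX hY) f = D.elem κ hX f + D.elem κ hY f := by
  refine D.L_ext ?_ ?_ ?_
  · rw [map_add]
    exact TensorProduct.tmul_add _ _ _
  · simp
  · simp

theorem elem_smul_left (hX : X ∈ D.graded κ) (c : ℂ) (f : D.Am) :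
    D.elem κ (Submodule.smul_mem _ c hX) f = c • D.elem κ hX f := by
  refine D.L_ext ?_ ?_ ?_
  · rw [map_smul]
    exact TensorProduct.tmul_smul _ _ _
  · simp
  · simp

theorem elem_zero_left (f : D.Am) : D.elem κ (zero_mem _) f = 0 := by
  refine D.L_ext ?_ ?_ ?_
  · rw [map_zero]
    exact TensorProduct.tmul_zero _ _
  · simp
  · simp

theorem elem_shift (hX : X ∈ D.graded κ) (γ : D.Γ) (f : D.Am) :
    D.elem (κ + D.expIncl γ) (by rwa [graded_add_expIncl]) f =
      D.elem κ hX (AddMonoidAlgebra.single γ 1 * f) := by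
  refine D.L_ext ?_ ?_ ?_
  · rw [loopL_elem, loopL_elem, map_mul, ← mul_assoc, single_mul_incl_single]
  · rw [cenL_elem, cenL_elem]
  · rw [dL_elem, dL_elem]

theorem exists_eq_add_expIncl (h0 : κ 0 = μ 0) (h : ∀ i, (D.m i : ℤ) ∣ κ i - μ i) :
    ∃ γ : D.Γ, κ = μ + D.expIncl γ := by
  refine ⟨⟨fun i => κ i.succ - μ i.succ, fun i => h i.succ⟩, ?_⟩
  ext i
  refine Fin.cases ?_ (fun j => ?_) i
  · simp [expIncl, h0]
  · simp [expIncl]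

theorem degZero_single_mul_incl (κ : Fin (n + 1) → ℤ) (f : D.Am) :
    degZero n (AddMonoidAlgebra.single κ 1 * D.incl f) =
      (κ 0 : ℂ) • (AddMonoidAlgebra.single κ 1 * D.incl f : Laurent n) := by
  rw [Loop.degZero_mul, degZero_single_one, degZero_incl, mul_zero, add_zero, smul_mul_assoc]

theorem lie_elem_elem (hX : X ∈ D.graded κ) (hY : Y ∈ D.graded μ) (hν : κ + μ = ν)
    (hXY : ⁅X, Y⁆ ∈ D.graded ν) (f g : D.Am) :
    ⁅D.elem κ hX f, D.elem μ hY g⁆ = D.elem ν hXY (f * g) +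
      ((κ 0 : ℂ) * D.form X Y) • D.cent (D.res (AddMonoidAlgebra.single ν 1) * (f * g)) := by
  subst hν
  have e : (AddMonoidAlgebra.single κ 1 * D.incl f * (AddMonoidAlgebra.single μ 1 * D.incl g) :
      Laurent n) = AddMonoidAlgebra.single (κ + μ) 1 * D.incl (f * g) := by
    rw [mul_mul_mul_comm, AddMonoidAlgebra.single_mul_single, one_mul, map_mul]
  refine D.L_ext ?_ ?_ ?_
  · rw [loopL_lie, dL_elem, dL_elem, zero_smul, zero_smul, add_zero, sub_zero, loopL_elem,
      loopL_elem, Loop.tmul_lie_tmul, map_add, map_smul, loopL_cent, smul_zero, add_zero,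
      loopL_elem, e]
  · rw [cenL_lie, loopL_elem, loopL_elem, cocycle_apply, Loop.der_tmul, Loop.form_tmul,
      degZero_single_mul_incl, smul_mul_assoc, e, map_smul, map_smul, res_mul_incl, map_add,
      cenL_elem, zero_add, map_smul, cenL_cent, smul_smul, mul_comm (κ 0 : ℂ)]
  · simp [dL_lie]

theorem lie_cent (x : D.L) (f : D.Am) : ⁅x, D.cent f⁆ = 0 := by
  refine D.L_ext ?_ ?_ ?_
  · rw [loopL_lie, loopL_cent, dL_cent]; simp
  · rw [cenL_lie, loopL_cent]; simp
  · simp [dL_lie]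

theorem res_single_zero : D.res (AddMonoidAlgebra.single 0 1) = 1 := by
  classical
  rw [res_single_one, dif_pos ⟨rfl, zero_mem D.Γ⟩]
  rfl

/-- Elements of `𝔏` built from homogeneous components belong to any subspace containing those. -/
theorem mem_of_loopL_mem_homSpanIdeal {S : (Fin (n + 1) → ℤ) → Set 𝔤}
    (hS : ∀ κ, S κ ⊆ D.graded κ) {I : Ideal D.Am} {P : Submodule ℂ D.L}
    (h1 : ∀ κ X, ∀ hX : X ∈ S κ, ∀ f ∈ I, D.elem κ (hS κ hX) f ∈ P) (h2 : ∀ f ∈ I, D.cent f ∈ P)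
    {x : D.L} (hx : D.loopL x ∈ D.homSpanIdeal S I) (hc : D.cenL x ∈ I) (hd : D.dL x = 0) :
    x ∈ P := by
  have key : ∀ y ∈ D.homSpanIdeal S I, ∃ z ∈ P, D.loopL z = y ∧ D.cenL z = 0 ∧ D.dL z = 0 := by
    intro y hy
    induction hy using Submodule.span_induction with
    | mem y hy =>
      obtain ⟨κ, X, hX, f, hf, rfl⟩ := hy
      exact ⟨_, h1 κ X hX f hf, rfl, rfl, rfl⟩
    | zero => exact ⟨0, zero_mem _, map_zero _, map_zero _, map_zero _⟩
    | add y y' _ _ hy hy' =>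
      obtain ⟨z, hz, e1, e2, e3⟩ := hy
      obtain ⟨z', hz', e1', e2', e3'⟩ := hy'
      exact ⟨z + z', add_mem hz hz', by rw [map_add, e1, e1'], by rw [map_add, e2, e2', add_zero],
        by rw [map_add, e3, e3', add_zero]⟩
    | smul c y _ hy =>
      obtain ⟨z, hz, e1, e2, e3⟩ := hy
      exact ⟨c • z, Submodule.smul_mem _ _ hz, by rw [map_smul, e1],
        by rw [map_smul, e2, smul_zero], by rw [map_smul, e3, smul_zero]⟩
  obtain ⟨z, hz, e1, e2, e3⟩ := key _ hx
  have : x = z + D.cent (D.cenL x) := by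
    refine D.L_ext ?_ ?_ ?_
    · rw [map_add, e1, loopL_cent, add_zero]
    · rw [map_add, e2, cenL_cent, zero_add]
    · rw [map_add, e3, dL_cent, hd, add_zero]
  rw [this]
  exact add_mem hz (h2 _ hc)

theorem cent_mem_idealL {I : Ideal D.Am} {f : D.Am} (hf : f ∈ I) : D.cent f ∈ D.idealL I :=
  ⟨zero_mem (D.homSpanIdeal _ I), hf, rfl⟩

theorem elem_mem_idealL {I : Ideal D.Am} (hX : X ∈ D.graded κ) {f : D.Am} (hf : f ∈ I) :
    D.elem κ hX f ∈ D.idealL I :=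
  ⟨Submodule.subset_span ⟨κ, X, hX, f, hf, rfl⟩, zero_mem I, rfl⟩

theorem idealL_le {I : Ideal D.Am} {P : Submodule ℂ D.L}
    (h1 : ∀ κ X, ∀ hX : X ∈ D.graded κ, ∀ f ∈ I, D.elem κ hX f ∈ P) (h2 : ∀ f ∈ I, D.cent f ∈ P) :
    (D.idealL I).toSubmodule ≤ P := fun _ hx =>
  D.mem_of_loopL_mem_homSpanIdeal (S := fun κ => D.graded κ) (fun _ => le_rfl) h1 h2 hx.1 hx.2.1
    hx.2.2

section Roots

variable {𝔥 : LieSubalgebra ℂ D.fixed}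

theorem cent_mem_L0Ideal {I : Ideal D.Am} {f : D.Am} (hf : f ∈ I) : D.cent f ∈ D.L0Ideal 𝔥 I :=
  ⟨zero_mem (D.homSpanIdeal _ I), hf, rfl⟩

theorem elem_mem_L0Ideal {I : Ideal D.Am} (hκ : κ 0 = 0) (hX : X ∈ D.gradedRoot 𝔥 κ 0) {f : D.Am}
    (hf : f ∈ I) : D.elem κ hX.1 f ∈ D.L0Ideal 𝔥 I :=
  ⟨Submodule.subset_span ⟨κ, X, ⟨hκ, hX⟩, f, hf, rfl⟩, zero_mem I, rfl⟩

theorem L0Ideal_le {I : Ideal D.Am} {P : Submodule ℂ D.L}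
    (h1 : ∀ κ X, κ 0 = 0 → ∀ hX : X ∈ D.gradedRoot 𝔥 κ 0, ∀ f ∈ I, D.elem κ hX.1 f ∈ P)
    (h2 : ∀ f ∈ I, D.cent f ∈ P) : D.L0Ideal 𝔥 I ≤ P := fun _ hx =>
  D.mem_of_loopL_mem_homSpanIdeal (S := fun κ => {X | κ 0 = 0 ∧ X ∈ D.gradedRoot 𝔥 κ 0})
    (fun _ _ hX => hX.2.1) (fun κ X hX f hf => h1 κ X hX.1 hX.2 f hf) h2 hx.1 hx.2.1 hx.2.2

theorem elem_mem_rootSpace {α : Module.Dual ℂ 𝔥} (hX : X ∈ D.gradedRoot 𝔥 κ α) (f : D.Am) :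
    D.elem κ hX.1 f ∈ D.rootSpace 𝔥 α (κ 0) := by
  refine ⟨D.tmul_mem_homSpan (S := fun μ => {X | μ 0 = κ 0 ∧ X ∈ D.gradedRoot 𝔥 μ α}) ?_
    ⟨rfl, hX⟩ f, fun _ => ⟨rfl, rfl⟩⟩
  rintro μ γ X ⟨h0, hX⟩
  exact ⟨by simpa [expIncl] using h0, by rw [D.graded_add_expIncl]; exact hX.1, hX.2⟩

theorem L0Ideal_mono {I J : Ideal D.Am} (h : I ≤ J) : D.L0Ideal 𝔥 I ≤ D.L0Ideal 𝔥 J :=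
  D.L0Ideal_le (fun _ _ hκ hX _ hf => D.elem_mem_L0Ideal hκ hX (h hf)) fun _ hf =>
    D.cent_mem_L0Ideal (h hf)

theorem L0Ideal_le_L0 (I : Ideal D.Am) : D.L0Ideal 𝔥 I ≤ (D.L0 𝔥).toSubmodule := by
  refine D.L0Ideal_le (fun κ X hκ hX f _ => ?_) fun f _ => ?_
  · have := D.elem_mem_rootSpace hX f
    rw [hκ] at this
    exact this
  · exact ⟨zero_mem (homSpan _), fun h => absurd ⟨rfl, rfl⟩ h⟩

end Roots

section Simple

variable [FiniteDimensional ℂ 𝔤] [LieAlgebra.IsSimple ℂ 𝔤] [LieAlgebra.IsSimple ℂ D.fixed]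
  {𝔥 : LieSubalgebra ℂ D.fixed} [𝔥.IsCartanSubalgebra]
  {b : (LieAlgebra.IsKilling.rootSystem 𝔥).Base}

omit [FiniteDimensional ℂ 𝔤] [LieAlgebra.IsSimple ℂ 𝔤] [LieAlgebra.IsSimple ℂ D.fixed] in
theorem exists_update_zero (κ : Fin (n + 1) → ℤ) : ∃ a : ℤ, 1 ≤ a ∧ a ≤ D.m 0 ∧
    ∀ r : ℕ, ∀ i, (D.m i : ℤ) ∣ κ i - Function.update κ 0 (a + r * D.m 0) i := by
  have hm : (0 : ℤ) < D.m 0 := by exact_mod_cast D.m_pos 0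
  refine ⟨(κ 0 - 1) % D.m 0 + 1, ?_, ?_, fun r i => ?_⟩
  · have := Int.emod_nonneg (κ 0 - 1) hm.ne'
    lia
  · have := Int.emod_lt_of_pos (κ 0 - 1) hm
    lia
  · rcases eq_or_ne i 0 with rfl | hi
    · rw [Function.update_self]
      have h1 : (D.m 0 : ℤ) ∣ (κ 0 - 1) - (κ 0 - 1) % D.m 0 := Int.dvd_self_sub_emod
      have h2 : (D.m 0 : ℤ) ∣ r * D.m 0 := Dvd.intro_left _ rfl
      have h3 := dvd_sub h1 h2
      have e : κ 0 - ((κ 0 - 1) % D.m 0 + 1 + r * D.m 0) =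
          κ 0 - 1 - (κ 0 - 1) % D.m 0 - r * D.m 0 := by ring
      rw [e]
      exact h3
    · rw [Function.update_of_ne hi, sub_self]
      exact dvd_zero _

/-- `𝔏⁰(J)` is spanned by brackets of root vectors `X t^κ` and `Y t^μ f`, for opposite nonzero
roots and bounded positive `κ₀`. -/
theorem L0Ideal_le_of_brackets (hD : D.IsLieTorus b) {J : Ideal D.Am} {P : Submodule ℂ D.L}
    (hP : ∀ (α : Module.Dual ℂ 𝔥) (κ μ : Fin (n + 1) → ℤ), α ≠ 0 → 1 ≤ κ 0 → κ 0 ≤ 2 * D.m 0 →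
      κ 0 + μ 0 = 0 → ∀ X Y, ∀ hX : X ∈ D.gradedRoot 𝔥 κ α, ∀ hY : Y ∈ D.gradedRoot 𝔥 μ (-α),
      ∀ f ∈ J, ⁅D.elem κ hX.1 1, D.elem μ hY.1 f⁆ ∈ P) : D.L0Ideal 𝔥 J ≤ P := by
  have hm : (1 : ℤ) ≤ D.m 0 := by exact_mod_cast D.m_pos 0
  have key : ∀ (α : Module.Dual ℂ 𝔥) (κ ν : Fin (n + 1) → ℤ), α ≠ 0 → ν 0 = 0 → ∀ X Y,
      X ∈ D.gradedRoot 𝔥 κ α → Y ∈ D.gradedRoot 𝔥 (ν - κ) (-α) → ∃ a : ℤ, ∃ h : ⁅X, Y⁆ ∈ D.graded ν,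
      ∀ r : ℕ, r ≤ 1 → ∀ f ∈ J, D.elem ν h f + (((a + r * D.m 0 : ℤ) : ℂ) * D.form X Y) •
        D.cent (D.res (AddMonoidAlgebra.single ν 1) * f) ∈ P := by
    intro α κ ν hα hν X Y hX hY
    obtain ⟨a, ha1, ha2, hdvd⟩ := D.exists_update_zero κ
    have hXY := D.lie_mem_graded hX.1 hY.1
    rw [add_sub_cancel] at hXY
    refine ⟨a, hXY, fun r hr f hf => ?_⟩
    have hX' : X ∈ D.gradedRoot 𝔥 (Function.update κ 0 (a + r * D.m 0)) α := by
      rwa [← D.gradedRoot_congr 𝔥 (D.ξ_zpow_congr (hdvd r))]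
    have hY' : Y ∈ D.gradedRoot 𝔥 (ν - Function.update κ 0 (a + r * D.m 0)) (-α) := by
      rwa [← D.gradedRoot_congr 𝔥 (D.ξ_zpow_congr fun i => ?_)]
      rw [Pi.sub_apply, Pi.sub_apply, sub_sub_sub_cancel_left, dvd_sub_comm]
      exact hdvd r i
    have h0 : Function.update κ 0 (a + r * D.m 0) 0 = a + r * D.m 0 := Function.update_self ..
    have hr0 : (0 : ℤ) ≤ r * D.m 0 := by positivity
    have hr1 : (r : ℤ) * D.m 0 ≤ D.m 0 := by
      have : (r : ℤ) ≤ 1 := by exact_mod_cast hr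
      nlinarith
    have := hP α _ _ hα (by rw [h0]; lia) (by rw [h0]; lia)
      (by rw [Pi.sub_apply, hν]; ring) X Y hX' hY' f hf
    rw [D.lie_elem_elem hX'.1 hY'.1 (add_sub_cancel _ ν) hXY, h0, one_mul] at this
    exact this
  have hcent : ∀ f ∈ J, D.cent f ∈ P := by
    intro f hf
    obtain ⟨κ, α, hα, X, hX, Y, hY, hXY⟩ := D.exists_form_ne_zero hD
    obtain ⟨a, h, hk⟩ := key α κ 0 hα rfl X Y hX (by rwa [zero_sub])
    have h1 := sub_mem (hk 1 le_rfl f hf) (hk 0 zero_le_one f hf)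
    rw [add_sub_add_left_eq_sub, ← sub_smul, res_single_zero, one_mul] at h1
    have h2 : ((a + (1 : ℕ) * D.m 0 : ℤ) : ℂ) * D.form X Y - ((a + (0 : ℕ) * D.m 0 : ℤ) : ℂ) *
        D.form X Y = D.m 0 * D.form X Y := by push_cast; ring
    rw [h2] at h1
    have h3 : (D.m 0 : ℂ) * D.form X Y ≠ 0 :=
      mul_ne_zero (by exact_mod_cast (D.m_pos 0).ne') hXY
    have := Submodule.smul_mem P (D.m 0 * D.form X Y)⁻¹ h1
    rwa [smul_smul, inv_mul_cancel₀ h3, one_smul] at this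
  refine D.L0Ideal_le (fun ν Z hν hZ f hf => ?_) hcent
  have hZ' := D.gradedRoot_zero_le_bracketSpan hD ν hZ
  suffices h : ∃ h : Z ∈ D.graded ν, D.elem ν h f ∈ P from h.2
  clear hZ
  induction hZ' using Submodule.span_induction with
  | zero => exact ⟨zero_mem _, by rw [elem_zero_left]; exact zero_mem _⟩
  | add X Y _ _ hX hY =>
    obtain ⟨h1, hX⟩ := hX
    obtain ⟨h2, hY⟩ := hY
    exact ⟨add_mem h1 h2, by rw [elem_add_left _ h1 h2]; exact add_mem hX hY⟩
  | smul c X _ hX =>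
    obtain ⟨h1, hX⟩ := hX
    exact ⟨Submodule.smul_mem _ _ h1, by rw [elem_smul_left _ h1]; exact Submodule.smul_mem _ _ hX⟩
  | mem Z hZ =>
    obtain ⟨κ, α, hα, X, hX, Y, hY, rfl⟩ := hZ
    obtain ⟨a, h, hk⟩ := key α κ ν hα hν X Y hX hY
    refine ⟨h, ?_⟩
    have h1 := hk 0 zero_le_one f hf
    have h2 := Submodule.smul_mem P (((a + (0 : ℕ) * D.m 0 : ℤ) : ℂ) * D.form X Y)
      (hcent _ (J.mul_mem_left (D.res (AddMonoidAlgebra.single ν 1)) hf))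
    simpa using sub_mem h1 h2

end Simple

end Datum
end LieTorus

namespace LieTorus
namespace Datum

universe u v
variable {n : ℕ} {𝔤 : Type u} [LieRing 𝔤] [LieAlgebra ℂ 𝔤] (D : Datum n 𝔤)

/-! ### Brackets of the ideals `𝔏(I)` and `𝔏⁰(I)` -/

theorem lie_mem_idealL_mul {I J : Ideal D.Am} {x y : D.L} (hx : x ∈ D.idealL I)
    (hy : y ∈ D.idealL J) : ⁅x, y⁆ ∈ D.idealL (I * J) := by
  have h2 : ∀ y' : D.L, (∀ κ X, ∀ hX : X ∈ D.graded κ, ∀ f ∈ I,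
      ⁅D.elem κ hX f, y'⁆ ∈ D.idealL (I * J)) → ⁅x, y'⁆ ∈ D.idealL (I * J) := by
    intro y' h
    have h3 : (D.idealL I).toSubmodule ≤ (D.idealL (I * J)).toSubmodule.comap
        (LieModule.toEnd ℂ D.L D.L y') := by
      refine D.idealL_le (fun κ X hX f hf => ?_) fun f _ => ?_
      · rw [Submodule.mem_comap, LieModule.toEnd_apply_apply, ← lie_skew]
        exact neg_mem (h κ X hX f hf)
      · rw [Submodule.mem_comap, LieModule.toEnd_apply_apply, lie_cent]
        exact zero_mem _
    have h4 := h3 hx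
    rw [Submodule.mem_comap, LieModule.toEnd_apply_apply] at h4
    rw [← lie_skew]
    exact neg_mem h4
  have h : (D.idealL J).toSubmodule ≤ (D.idealL (I * J)).toSubmodule.comap
      (LieModule.toEnd ℂ D.L D.L x) := by
    refine D.idealL_le (fun μ Y hY g hg => ?_) fun g _ => ?_
    · rw [Submodule.mem_comap, LieModule.toEnd_apply_apply]
      refine h2 _ fun κ X hX f hf => ?_
      rw [D.lie_elem_elem hX hY rfl (D.lie_mem_graded hX hY)]
      have hfg := Ideal.mul_mem_mul hf hg
      exact add_mem (D.elem_mem_idealL _ hfg)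
        (Submodule.smul_mem (D.idealL (I * J)).toSubmodule _
          (D.cent_mem_idealL (Ideal.mul_mem_left _ _ hfg)))
    · rw [Submodule.mem_comap, LieModule.toEnd_apply_apply, lie_cent]
      exact zero_mem _
  have h4 := h hy
  rwa [Submodule.mem_comap, LieModule.toEnd_apply_apply] at h4

theorem homSpan_le_homSpanIdeal_top (S : (Fin (n + 1) → ℤ) → Set 𝔤) :
    homSpan S ≤ D.homSpanIdeal S ⊤ := by
  refine Submodule.span_mono ?_
  rintro _ ⟨κ, X, hX, rfl⟩
  exact ⟨κ, X, hX, 1, Submodule.mem_top, by rw [map_one, mul_one]⟩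

theorem sub_dElem_mem_idealL_top (x : D.L) : x - D.dL x • D.dElem ∈ D.idealL ⊤ := by
  refine ⟨?_, Submodule.mem_top, ?_⟩
  · rw [map_sub, map_smul, loopL_dElem, smul_zero, sub_zero]
    exact D.homSpan_le_homSpanIdeal_top _ (D.loopL_mem x)
  · rw [map_sub, map_smul, dL_dElem, smul_eq_mul, mul_one, sub_self]

theorem dElem_lie_elem {κ : Fin (n + 1) → ℤ} {X : 𝔤} (hX : X ∈ D.graded κ) (f : D.Am) :
    ⁅D.dElem, D.elem κ hX f⁆ = (κ 0 : ℂ) • D.elem κ hX f := by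
  refine D.L_ext ?_ ?_ ?_
  · rw [loopL_lie, loopL_dElem, dL_dElem, dL_elem, zero_lie, zero_add, one_smul, zero_smul, sub_zero,
      loopL_elem, Loop.der_tmul, degZero_single_mul_incl, smul_tmul, map_smul, loopL_elem]
  · rw [cenL_lie, loopL_dElem]; simp
  · simp [dL_lie]

section Roots

variable {𝔥 : LieSubalgebra ℂ D.fixed}

theorem L0Ideal_le_idealL (I : Ideal D.Am) : D.L0Ideal 𝔥 I ≤ (D.idealL I).toSubmodule :=
  D.L0Ideal_le (fun _ _ _ hX _ hf => D.elem_mem_idealL hX.1 hf) fun _ hf => D.cent_mem_idealL hf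

theorem sub_dElem_mem_L0Ideal_top {x : D.L} (hx : x ∈ D.L0 𝔥) :
    x - D.dL x • D.dElem ∈ D.L0Ideal 𝔥 ⊤ := by
  refine ⟨?_, Submodule.mem_top, ?_⟩
  · rw [map_sub, map_smul, loopL_dElem, smul_zero, sub_zero]
    exact D.homSpan_le_homSpanIdeal_top _ hx.1
  · rw [map_sub, map_smul, dL_dElem, smul_eq_mul, mul_one, sub_self]

theorem dElem_mem_L0 : D.dElem ∈ D.L0 𝔥 :=
  ⟨zero_mem (homSpan _), fun h => absurd ⟨rfl, rfl⟩ h⟩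

theorem lie_elem_elem_mem_L0Ideal {J : Ideal D.Am} {κ μ : Fin (n + 1) → ℤ}
    {α β : Module.Dual ℂ 𝔥} {X Y : 𝔤} (hκμ : κ 0 + μ 0 = 0) (hαβ : α + β = 0)
    (hX : X ∈ D.gradedRoot 𝔥 κ α) (hY : Y ∈ D.gradedRoot 𝔥 μ β) (f : D.Am) {g : D.Am}
    (hg : g ∈ J) : ⁅D.elem κ hX.1 f, D.elem μ hY.1 g⁆ ∈ D.L0Ideal 𝔥 J := by
  have hXY := D.lie_mem_gradedRoot hX hY
  rw [hαβ] at hXY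
  rw [D.lie_elem_elem hX.1 hY.1 rfl hXY.1]
  have hfg := J.mul_mem_left f hg
  exact add_mem (D.elem_mem_L0Ideal hκμ hXY hfg)
    (Submodule.smul_mem _ _ (D.cent_mem_L0Ideal (J.mul_mem_left _ hfg)))

theorem lie_mem_L0Ideal_of_mem_top {J : Ideal D.Am} {z y : D.L} (hz : z ∈ D.L0Ideal 𝔥 ⊤)
    (hy : y ∈ D.L0Ideal 𝔥 J) : ⁅z, y⁆ ∈ D.L0Ideal 𝔥 J := by
  have h2 : ∀ y' : D.L, (∀ κ X, κ 0 = 0 → ∀ hX : X ∈ D.gradedRoot 𝔥 κ 0, ∀ f,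
      ⁅D.elem κ hX.1 f, y'⁆ ∈ D.L0Ideal 𝔥 J) → ⁅z, y'⁆ ∈ D.L0Ideal 𝔥 J := by
    intro y' h
    have h3 : D.L0Ideal 𝔥 ⊤ ≤ (D.L0Ideal 𝔥 J).comap (LieModule.toEnd ℂ D.L D.L y') := by
      refine D.L0Ideal_le (fun κ X hκ hX f _ => ?_) fun f _ => ?_
      · rw [Submodule.mem_comap, LieModule.toEnd_apply_apply, ← lie_skew]
        exact neg_mem (h κ X hκ hX f)
      · rw [Submodule.mem_comap, LieModule.toEnd_apply_apply, lie_cent]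
        exact zero_mem _
    have h4 := h3 hz
    rw [Submodule.mem_comap, LieModule.toEnd_apply_apply] at h4
    rw [← lie_skew]
    exact neg_mem h4
  have h : D.L0Ideal 𝔥 J ≤ (D.L0Ideal 𝔥 J).comap (LieModule.toEnd ℂ D.L D.L z) := by
    refine D.L0Ideal_le (fun μ Y hμ hY g hg => ?_) fun g hg => ?_
    · rw [Submodule.mem_comap, LieModule.toEnd_apply_apply]
      refine h2 _ fun κ X hκ hX f => ?_
      exact D.lie_elem_elem_mem_L0Ideal (by rw [hκ, hμ, add_zero]) (add_zero 0) hX hY f hg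
    · rw [Submodule.mem_comap, LieModule.toEnd_apply_apply, lie_cent]
      exact zero_mem _
  have h4 := h hy
  rwa [Submodule.mem_comap, LieModule.toEnd_apply_apply] at h4

theorem dElem_lie_mem_L0Ideal {J : Ideal D.Am} {y : D.L} (hy : y ∈ D.L0Ideal 𝔥 J) :
    ⁅D.dElem, y⁆ ∈ D.L0Ideal 𝔥 J := by
  have hd : D.L0Ideal 𝔥 J ≤ (D.L0Ideal 𝔥 J).comap (LieModule.toEnd ℂ D.L D.L D.dElem) := by
    refine D.L0Ideal_le (fun μ Y hμ hY g hg => ?_) fun g hg => ?_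
    · change ⁅D.dElem, D.elem μ hY.1 g⁆ ∈ D.L0Ideal 𝔥 J
      rw [dElem_lie_elem]
      exact Submodule.smul_mem _ _ (D.elem_mem_L0Ideal hμ hY hg)
    · change ⁅D.dElem, D.cent g⁆ ∈ D.L0Ideal 𝔥 J
      rw [lie_cent]
      exact zero_mem _
  exact hd hy

theorem lie_mem_L0Ideal {J : Ideal D.Am} {x y : D.L} (hx : x ∈ D.L0 𝔥) (hy : y ∈ D.L0Ideal 𝔥 J) :
    ⁅x, y⁆ ∈ D.L0Ideal 𝔥 J := by
  have h3 := add_mem (D.lie_mem_L0Ideal_of_mem_top (D.sub_dElem_mem_L0Ideal_top hx) hy)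
    (Submodule.smul_mem _ (D.dL x) (D.dElem_lie_mem_L0Ideal hy))
  rwa [sub_lie, smul_lie, sub_add_cancel] at h3

/-! ### Weights -/

/-- The weight `α + k₀δ` of `𝔥(0) ⊕ ℂK ⊕ ℂd₀`. -/
def shift (α : Module.Dual ℂ 𝔥) (k₀ : ℤ) : Module.Dual ℂ (𝔥 × ℂ × ℂ) :=
  α ∘ₗ LinearMap.fst ℂ 𝔥 (ℂ × ℂ) +
    (k₀ : ℂ) • (LinearMap.snd ℂ ℂ ℂ ∘ₗ LinearMap.snd ℂ 𝔥 (ℂ × ℂ))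

theorem shift_apply (α : Module.Dual ℂ 𝔥) (k₀ : ℤ) (p : 𝔥 × ℂ × ℂ) :
    D.shift α k₀ p = α p.1 + k₀ * p.2.2 := rfl

theorem shift_add (α β : Module.Dual ℂ 𝔥) (k l : ℤ) :
    D.shift α k + D.shift β l = D.shift (α + β) (k + l) := by
  ext p <;> simp [shift_apply]

theorem eq_zero_of_shift_eq_zero {α : Module.Dual ℂ 𝔥} {k₀ : ℤ} (h : D.shift α k₀ = 0) :
    α = 0 ∧ k₀ = 0 := by
  constructor
  · ext t
    have := LinearMap.congr_fun h (t, 0, 0)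
    simpa [shift_apply] using this
  · have := LinearMap.congr_fun h (0, 0, 1)
    simpa [shift_apply] using this

theorem der_tmul_one (X : 𝔤) : Loop.der (Loop.tmul (1 : Laurent n) X) = 0 := by
  rw [Loop.der_tmul, AddMonoidAlgebra.one_def, degZero_single_one]
  rw [Pi.zero_apply, Int.cast_zero, zero_smul]
  exact TensorProduct.zero_tmul _ _

theorem cartanIncl_lie (p : 𝔥 × ℂ × ℂ) {α : Module.Dual ℂ 𝔥} {k₀ : ℤ} {x : D.L}
    (hx : x ∈ D.rootSpace 𝔥 α k₀) : ⁅D.cartanIncl 𝔥 p, x⁆ = D.shift α k₀ p • x := by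
  have hl : D.loopL (D.cartanIncl 𝔥 p) = Loop.tmul 1 ((p.1 : D.fixed) : 𝔤) := rfl
  have hd : D.dL (D.cartanIncl 𝔥 p) = p.2.2 := rfl
  have key : ∀ y ∈ homSpan (n := n) (fun κ => {X | κ 0 = k₀ ∧ X ∈ D.gradedRoot 𝔥 κ α}),
      ⁅Loop.tmul (1 : Laurent n) ((p.1 : D.fixed) : 𝔤), y⁆ + p.2.2 • Loop.der y = D.shift α k₀ p • y := by
    intro y hy
    induction hy using Submodule.span_induction with
    | mem y hy =>
      obtain ⟨κ, X, ⟨hκ, hX⟩, rfl⟩ := hy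
      rw [Loop.tmul_lie_tmul, one_mul, Loop.der_tmul, degZero_single_one, smul_tmul, hX.2 p.1, hκ,
        shift_apply, add_smul, smul_smul, mul_comm p.2.2]
      congr 1
      exact TensorProduct.tmul_smul _ _ _
    | zero => simp
    | add x y _ _ hx hy => rw [lie_add, map_add, smul_add, smul_add, ← hx, ← hy]; abel
    | smul c x _ hx => rw [lie_smul, map_smul, smul_comm _ c, ← smul_add, hx, smul_comm]
  have hz : D.shift α k₀ p • D.cenL x = 0 ∧ D.shift α k₀ p • D.dL x = 0 := by
    by_cases h : α = 0 ∧ k₀ = 0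
    · rw [h.1, h.2, shift_apply]; simp
    · rw [(hx.2 h).1, (hx.2 h).2]; simp
  refine D.L_ext ?_ ?_ ?_
  · rw [loopL_lie, hl, hd, der_tmul_one, smul_zero, sub_zero, map_smul]
    exact key _ hx.1
  · rw [cenL_lie, hl, cocycle_apply, der_tmul_one, map_zero, LinearMap.zero_apply, map_zero,
      map_smul, hz.1]
  · rw [dL_lie, map_smul, hz.2]

variable {V : Type v} [AddCommGroup V] [Module ℂ V] [LieRingModule D.L V] [LieModule ℂ D.L V]

theorem lie_mem_weightSpace {α : Module.Dual ℂ 𝔥} {k₀ : ℤ} {x : D.L}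
    (hx : x ∈ D.rootSpace 𝔥 α k₀) {lam : Module.Dual ℂ (𝔥 × ℂ × ℂ)} {w : V}
    (hw : w ∈ D.weightSpace 𝔥 V lam) : ⁅x, w⁆ ∈ D.weightSpace 𝔥 V (lam + D.shift α k₀) := by
  intro p
  rw [leibniz_lie, D.cartanIncl_lie p hx, hw p, smul_lie, lie_smul, LinearMap.add_apply, add_smul,
    add_comm]

theorem cartanIncl_mem_L0 [IsLieAbelian 𝔥] (p : 𝔥 × ℂ × ℂ) : D.cartanIncl 𝔥 p ∈ D.L0 𝔥 := by
  refine ⟨Submodule.subset_span ⟨0, _, ⟨rfl, D.mem_graded_zero p.1, fun h => ?_⟩, rfl⟩,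
    fun h => absurd ⟨rfl, rfl⟩ h⟩
  have := congrArg (fun x : 𝔥 => ((x : D.fixed) : 𝔤)) (trivial_lie_zero 𝔥 𝔥 h p.1)
  simpa using this

end Roots

end Datum
end LieTorus

namespace LieTorus

/-- Commuting, locally nilpotent operators on a nonzero finite-dimensional space have a common
kernel vector. -/
theorem exists_ne_zero_forall_apply_eq_zero {ι V : Type*} [AddCommGroup V] [Module ℂ V]
    {E : ι → Module.End ℂ V} (hE : ∀ i j, Commute (E i) (E j)) :
    ∀ (d : ℕ) (S : Submodule ℂ V) [FiniteDimensional ℂ S], Module.finrank ℂ S = d → S ≠ ⊥ →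
      (∀ i, ∀ v ∈ S, E i v ∈ S) → (∀ i, ∀ v ∈ S, ∃ r, (E i ^ r) v = 0) →
      ∃ v ∈ S, v ≠ 0 ∧ ∀ i, E i v = 0 := by
  intro d
  induction d using Nat.strong_induction_on with
  | _ d ih =>
    intro S _ hd hS hst hnil
    by_cases hall : ∀ i, ∀ v ∈ S, E i v = 0
    · obtain ⟨v, hv, hv0⟩ := (Submodule.ne_bot_iff S).1 hS
      exact ⟨v, hv, hv0, fun i => hall i v hv⟩
    · push Not at hall
      obtain ⟨i, w, hw, hiw⟩ := hall
      have hlt : S ⊓ LinearMap.ker (E i) < S :=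
        lt_of_le_of_ne inf_le_left fun h => hiw (h.ge hw).2
      have hfin : FiniteDimensional ℂ ↥(S ⊓ LinearMap.ker (E i)) :=
        Submodule.finiteDimensional_of_le hlt.le
      have hpow : ∀ r, ∀ v ∈ S, (E i ^ r) v ∈ S := by
        intro r
        induction r with
        | zero => intro v hv; simpa using hv
        | succ r ihr => intro v hv; rw [pow_succ]; exact ihr _ (hst i v hv)
      have hne : S ⊓ LinearMap.ker (E i) ≠ ⊥ := by
        classical
        have hex := hnil i w hw
        have hr0 : Nat.find hex ≠ 0 := fun h0 => hiw (by
          have := Nat.find_spec hex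
          rw [h0, pow_zero, Module.End.one_apply] at this
          rw [this, map_zero])
        obtain ⟨r, hr⟩ := Nat.exists_eq_succ_of_ne_zero hr0
        refine (Submodule.ne_bot_iff _).2 ⟨(E i ^ r) w, ⟨hpow r w hw, ?_⟩,
          Nat.find_min hex (by lia)⟩
        have := Nat.find_spec hex
        rwa [hr, Nat.succ_eq_add_one, pow_succ', Module.End.mul_apply] at this
      obtain ⟨v, hv, h⟩ := ih _ (hd ▸ Submodule.finrank_lt_finrank_of_lt hlt) _ rfl hne
        (fun j v hv => ⟨hst j v hv.1, by
          have h1 : E i (E j v) = E j (E i v) := LinearMap.congr_fun (hE i j).eq v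
          exact LinearMap.mem_ker.2 (by rw [h1, LinearMap.mem_ker.1 hv.2, map_zero])⟩)
        (fun j v hv => hnil j v hv.1)
      exact ⟨v, hv.1, h⟩

namespace Datum

universe u v
variable {n : ℕ} {𝔤 : Type u} [LieRing 𝔤] [LieAlgebra ℂ 𝔤] [FiniteDimensional ℂ 𝔤]
  (D : Datum n 𝔤) [LieAlgebra.IsSimple ℂ D.fixed]
  {𝔥 : LieSubalgebra ℂ D.fixed} [𝔥.IsCartanSubalgebra]
  (b : (LieAlgebra.IsKilling.rootSystem 𝔥).Base)

/-! ### The triangular decomposition -/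

/-- `𝔏⁻`, the sum of the root spaces `𝔏_{α + k₀δ}` with `α + k₀δ < 0`. -/
def Lminus : Submodule ℂ D.L :=
  ⨆ (α : Module.Dual ℂ 𝔥) (k₀ : ℤ) (_ : D.IsPositive b (-α) (-k₀)), D.rootSpace 𝔥 α k₀

variable {b}

theorem rootSpace_le_Lplus {α : Module.Dual ℂ 𝔥} {k₀ : ℤ} (h : D.IsPositive b α k₀) :
    D.rootSpace 𝔥 α k₀ ≤ D.Lplus b :=
  le_iSup_of_le α (le_iSup_of_le k₀ (le_iSup_of_le h le_rfl))

theorem rootSpace_le_Lminus {α : Module.Dual ℂ 𝔥} {k₀ : ℤ} (h : D.IsPositive b (-α) (-k₀)) :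
    D.rootSpace 𝔥 α k₀ ≤ D.Lminus b :=
  le_iSup_of_le α (le_iSup_of_le k₀ (le_iSup_of_le h le_rfl))

theorem IsPositive.add {α β : Module.Dual ℂ 𝔥} {k l : ℤ} (h : D.IsPositive b α k)
    (h' : D.IsPositive b β l) : D.IsPositive b (α + β) (k + l) := by
  rcases h with h | ⟨h0, h1, h2⟩ <;> rcases h' with h' | ⟨h0', h1', h2'⟩
  · left; lia
  · left; lia
  · left; lia
  · refine Or.inr ⟨by lia, fun h => h1 ?_, add_mem h2 h2'⟩
    rw [← neg_eq_iff_add_eq_zero] at h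
    exact eq_zero_of_mem_rootCone b h2 (h ▸ h2')

theorem IsPositive.ne_zero {α : Module.Dual ℂ 𝔥} {k : ℤ} (h : D.IsPositive b α k) :
    ¬(α = 0 ∧ k = 0) := by
  rintro ⟨h1, h2⟩
  rcases h with h | ⟨_, h, _⟩
  · exact h.ne' h2
  · exact h h1

/-- A triangular decomposition of `𝔏(I)`. -/
theorem idealL_le_of_triangular (hD : D.IsLieTorus b) {I : Ideal D.Am} {P : Submodule ℂ D.L}
    (hneg : ∀ α κ X, ∀ hX : X ∈ D.gradedRoot 𝔥 κ α, D.IsPositive b (-α) (-κ 0) → ∀ f ∈ I,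
      D.elem κ hX.1 f ∈ P)
    (hpos : ∀ α κ X, ∀ hX : X ∈ D.gradedRoot 𝔥 κ α, D.IsPositive b α (κ 0) → ∀ f ∈ I,
      D.elem κ hX.1 f ∈ P)
    (h0 : D.L0Ideal 𝔥 I ≤ P) : (D.idealL I).toSubmodule ≤ P := by
  have hroot : ∀ α κ X, ∀ hX : X ∈ D.gradedRoot 𝔥 κ α, ∀ f ∈ I, D.elem κ hX.1 f ∈ P := by
    intro α κ X hX f hf
    by_cases hX0 : X = 0
    · subst hX0
      rw [elem_zero_left]
      exact zero_mem _
    have hcone := D.mem_or_neg_mem_posCone hD ((Submodule.ne_bot_iff _).2 ⟨X, hX, hX0⟩)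
    rcases lt_trichotomy (κ 0) 0 with hκ | hκ | hκ
    · exact hneg α κ X hX (Or.inl (by lia)) f hf
    · by_cases hα : α = 0
      · subst hα
        exact h0 (D.elem_mem_L0Ideal hκ hX hf)
      · rcases hcone with hc | hc
        · exact hpos α κ X hX (Or.inr ⟨hκ, hα, hc⟩) f hf
        · exact hneg α κ X hX (Or.inr ⟨by lia, neg_ne_zero.2 hα, hc⟩) f hf
    · exact hpos α κ X hX (Or.inl hκ) f hf
  refine D.idealL_le (fun κ X hX f hf => ?_) fun f hf => h0 (D.cent_mem_L0Ideal hf)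
  suffices h : ∃ h : X ∈ D.graded κ, D.elem κ h f ∈ P from h.2
  have hX' := D.graded_le_iSup_gradedRoot (𝔥 := 𝔥) hD κ hX
  clear hX
  induction hX' using Submodule.iSup_induction' with
  | mem α X hX => exact ⟨hX.1, hroot α κ X hX f hf⟩
  | zero => exact ⟨zero_mem _, by rw [elem_zero_left]; exact zero_mem _⟩
  | add X Y _ _ hX hY =>
    obtain ⟨h1, hX⟩ := hX
    obtain ⟨h2, hY⟩ := hY
    exact ⟨add_mem h1 h2, by rw [elem_add_left _ h1 h2]; exact add_mem hX hY⟩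

theorem Lminus_sup_Lplus_sup_L0 (hD : D.IsLieTorus b) :
    D.Lminus b ⊔ (D.Lplus b ⊔ (D.L0 𝔥).toSubmodule) = ⊤ := by
  set P := D.Lminus b ⊔ (D.Lplus b ⊔ (D.L0 𝔥).toSubmodule)
  have hm : D.Lminus b ≤ P := le_sup_left
  have hp : D.Lplus b ≤ P := le_sup_left.trans le_sup_right
  have h0 : (D.L0 𝔥).toSubmodule ≤ P := le_sup_right.trans le_sup_right
  refine eq_top_iff.2 fun x _ => ?_
  have hle : (D.idealL ⊤).toSubmodule ≤ P := D.idealL_le_of_triangular hD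
    (fun α κ X hX h f _ => hm (D.rootSpace_le_Lminus h (D.elem_mem_rootSpace hX f)))
    (fun α κ X hX h f _ => hp (D.rootSpace_le_Lplus h (D.elem_mem_rootSpace hX f)))
    ((D.L0Ideal_le_L0 ⊤).trans h0)
  have h1 : x - D.dL x • D.dElem ∈ P := hle (D.sub_dElem_mem_idealL_top x)
  have h2 := add_mem h1 (Submodule.smul_mem P (D.dL x) (h0 (D.dElem_mem_L0 (𝔥 := 𝔥))))
  rwa [sub_add_cancel] at h2

/-! ### The top of a highest weight module -/

variable {V : Type v} [AddCommGroup V] [Module ℂ V] [LieRingModule D.L V] [LieModule ℂ D.L V]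

variable (b) in
/-- `T` is a finite-dimensional irreducible `𝔏⁰`-submodule of `V` which is killed by `𝔏⁺`. -/
structure IsTop (T : Submodule ℂ V) : Prop where
  ne_bot : T ≠ ⊥
  finiteDimensional : FiniteDimensional ℂ T
  lie_eq_zero : ∀ x ∈ D.Lplus b, ∀ v ∈ T, ⁅x, v⁆ = 0
  lie_mem : ∀ x ∈ D.L0 𝔥, ∀ v ∈ T, ⁅x, v⁆ ∈ T
  eq_of_stable : ∀ S ≤ T, S ≠ ⊥ → (∀ x ∈ D.L0 𝔥, ∀ v ∈ S, ⁅x, v⁆ ∈ S) → S = T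

omit [FiniteDimensional ℂ 𝔤] [LieAlgebra.IsSimple ℂ D.fixed] [𝔥.IsCartanSubalgebra] in
theorem cartanIncl_add (p q : 𝔥 × ℂ × ℂ) :
    D.cartanIncl 𝔥 (p + q) = D.cartanIncl 𝔥 p + D.cartanIncl 𝔥 q :=
  D.L_ext (TensorProduct.tmul_add _ _ _) (AddMonoidAlgebra.single_add _ _ _) rfl

omit [FiniteDimensional ℂ 𝔤] [LieAlgebra.IsSimple ℂ D.fixed] [𝔥.IsCartanSubalgebra] in
theorem cartanIncl_smul (c : ℂ) (p : 𝔥 × ℂ × ℂ) :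
    D.cartanIncl 𝔥 (c • p) = c • D.cartanIncl 𝔥 p :=
  D.L_ext (TensorProduct.tmul_smul _ _ _) (by
    rw [map_smul]
    exact (AddMonoidAlgebra.smul_single _ _ _).symm) rfl

namespace IsTop

variable {D} {T : Submodule ℂ V}

theorem exists_le_weightSpace (hT : D.IsTop b T) : ∃ lam, T ≤ D.weightSpace 𝔥 V lam := by
  have := hT.finiteDimensional
  have : Nontrivial T := Submodule.nontrivial_iff_ne_bot.2 hT.ne_bot
  have key : ∀ p, ∃ c : ℂ, ∀ v ∈ T, ⁅D.cartanIncl 𝔥 p, v⁆ = c • v := by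
    intro p
    obtain ⟨c, hc⟩ := Module.End.exists_eigenvalue ((LieModule.toEnd ℂ D.L V
      (D.cartanIncl 𝔥 p)).restrict (p := T) (q := T) (hT.lie_mem _ (D.cartanIncl_mem_L0 p)))
    obtain ⟨v, hv⟩ := hc.exists_hasEigenvector
    have hv1 := congrArg Subtype.val hv.apply_eq_smul
    let S : Submodule ℂ V := T ⊓ LinearMap.ker (LieModule.toEnd ℂ D.L V (D.cartanIncl 𝔥 p) - c • 1)
    have hS : ∀ w, w ∈ S ↔ w ∈ T ∧ ⁅D.cartanIncl 𝔥 p, w⁆ = c • w := fun w => by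
      simp [S, sub_eq_zero]
    have hST : S = T := by
      refine hT.eq_of_stable S inf_le_left ?_ fun x hx w hw => ?_
      · refine (Submodule.ne_bot_iff _).2 ⟨v, (hS _).2 ⟨v.2, hv1⟩, fun h => hv.2 (Subtype.ext h)⟩
      · rw [hS] at hw ⊢
        have h0 := D.cartanIncl_lie p (α := 0) (k₀ := 0) hx
        rw [shift_apply, LinearMap.zero_apply, Int.cast_zero, zero_mul, add_zero, zero_smul] at h0
        exact ⟨hT.lie_mem x hx w hw.1, by rw [leibniz_lie, h0, zero_lie, zero_add, hw.2, lie_smul]⟩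
    exact ⟨c, fun w hw => ((hS w).1 (hST.ge hw)).2⟩
  choose c hc using key
  obtain ⟨v, hv, hv0⟩ := (Submodule.ne_bot_iff T).1 hT.ne_bot
  refine ⟨⟨⟨c, fun p q => smul_left_injective ℂ hv0 ?_⟩, fun a p => smul_left_injective ℂ hv0 ?_⟩,
    fun w hw p => hc p w hw⟩
  · change c (p + q) • v = (c p + c q) • v
    rw [← hc _ v hv, cartanIncl_add, add_lie, hc p v hv, hc q v hv, add_smul]
  · change c (a • p) • v = (a * c p) • v
    rw [← hc _ v hv, cartanIncl_smul, smul_lie, hc p v hv, smul_smul]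

/-- An ideal whose `𝔏⁰`-part kills the top kills the module. -/
theorem idealL_lie_eq_zero [LieModule.IsIrreducible ℂ D.L V] (hD : D.IsLieTorus b)
    (hV : D.IsWeightModule 𝔥 V) (hT : D.IsTop b T) {I : Ideal D.Am}
    (hI : ∀ x ∈ D.L0Ideal 𝔥 I, ∀ v ∈ T, ⁅x, v⁆ = 0) :
    ∀ x ∈ D.idealL I, ∀ v : V, ⁅x, v⁆ = 0 := by
  obtain ⟨lam, hlam⟩ := hT.exists_le_weightSpace
  let T₀ : Submodule ℂ V := Submodule.span ℂ {w | ∃ x ∈ D.idealL I, ∃ v ∈ T, w = ⁅x, v⁆}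
  have hB : ∀ x ∈ D.Lplus b ⊔ (D.L0 𝔥).toSubmodule, ∀ t ∈ T₀, ⁅x, t⁆ ∈ T₀ := by
    intro x hx t ht
    have hxT : ∀ v ∈ T, ⁅x, v⁆ ∈ T := by
      obtain ⟨y, hy, z, hz, rfl⟩ := Submodule.mem_sup.1 hx
      intro v hv
      rw [add_lie, hT.lie_eq_zero y hy v hv, zero_add]
      exact hT.lie_mem z hz v hv
    induction ht using Submodule.span_induction with
    | mem t ht =>
      obtain ⟨y, hy, v, hv, rfl⟩ := ht
      rw [leibniz_lie]
      refine add_mem (Submodule.subset_span ⟨⁅x, y⁆, lie_mem_right ℂ D.L _ _ _ hy, v, hv, rfl⟩)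
        (Submodule.subset_span ⟨y, hy, _, hxT v hv, rfl⟩)
    | zero => rw [lie_zero]; exact zero_mem _
    | add t t' _ _ h h' => rw [lie_add]; exact add_mem h h'
    | smul c t _ h => rw [lie_smul]; exact Submodule.smul_mem _ _ h
  obtain ⟨M, hM₀, hM⟩ := exists_lieSubmodule_of_stable (D.Lminus_sup_Lplus_sup_L0 hD) hB
  let W : Module.Dual ℂ (𝔥 × ℂ × ℂ) → Submodule ℂ V := fun μ =>
    ⨆ (_ : ∃ α k₀, D.IsPositive b (-α) (-k₀) ∧ μ = lam + D.shift α k₀), D.weightSpace 𝔥 V μ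
  have hW : ∀ {α : Module.Dual ℂ 𝔥} {k₀ : ℤ}, D.IsPositive b (-α) (-k₀) →
      D.weightSpace 𝔥 V (lam + D.shift α k₀) ≤ ⨆ μ, W μ := fun {α k₀} h =>
    le_iSup_of_le (lam + D.shift α k₀) (le_iSup_of_le ⟨α, k₀, h, rfl⟩ le_rfl)
  have hWle : ∀ μ, W μ ≤ D.weightSpace 𝔥 V μ := fun μ => iSup_le fun _ => le_rfl
  have hT₀W : T₀ ≤ ⨆ μ, W μ := by
    refine Submodule.span_le.2 ?_
    rintro _ ⟨x, hx, v, hv, rfl⟩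
    have hle : (D.idealL I).toSubmodule ≤ (⨆ μ, W μ).comap
        ((LieModule.toEnd ℂ D.L V : D.L →ₗ[ℂ] Module.End ℂ V).flip v) := by
      refine D.idealL_le_of_triangular hD (fun α κ X hX h f _ => ?_) (fun α κ X hX h f _ => ?_)
        fun y hy => ?_
      · exact hW h (D.lie_mem_weightSpace (D.elem_mem_rootSpace hX f) (hlam hv))
      · have := hT.lie_eq_zero _ (D.rootSpace_le_Lplus h (D.elem_mem_rootSpace hX f)) v hv
        change ⁅D.elem κ hX.1 f, v⁆ ∈ ⨆ μ, W μ
        rw [this]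
        exact zero_mem _
      · change ⁅y, v⁆ ∈ ⨆ μ, W μ
        rw [hI y hy v hv]
        exact zero_mem _
    exact hle hx
  have hWA : ∀ x ∈ D.Lminus b, ∀ t ∈ ⨆ μ, W μ, ⁅x, t⁆ ∈ ⨆ μ, W μ := by
    intro x hx t ht
    have hle : D.Lminus b ≤ (⨆ μ, W μ).comap
        ((LieModule.toEnd ℂ D.L V : D.L →ₗ[ℂ] Module.End ℂ V).flip t) := by
      refine iSup_le fun α => iSup_le fun k₀ => iSup_le fun h y hy => ?_
      have hle' : ⨆ μ, W μ ≤ (⨆ μ, W μ).comap (LieModule.toEnd ℂ D.L V y) := by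
        refine iSup_le fun μ => iSup_le ?_
        rintro ⟨β, l₀, h', rfl⟩ w hw
        have h1 := D.lie_mem_weightSpace hy hw
        rw [add_assoc, shift_add] at h1
        refine hW ?_ h1
        rw [neg_add, neg_add]
        exact h'.add D h
      exact hle' ht
    exact hle hx
  have hMtop : M ≠ ⊤ := by
    rintro rfl
    have hle : (⊤ : Submodule ℂ V) ≤ ⨆ μ, W μ := hM _ hT₀W hWA
    obtain ⟨v, hv, hv0⟩ := (Submodule.ne_bot_iff T).1 hT.ne_bot
    have := mem_of_mem_iSup_of_iSupIndep hV.1 hWle (hlam hv) (hle Submodule.mem_top)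
    refine hv0 ?_
    have hb : W lam = ⊥ := by
      refine iSup_eq_bot.2 ?_
      rintro ⟨α, k₀, h, h'⟩
      have h0 := D.eq_zero_of_shift_eq_zero (left_eq_add.1 h')
      exact absurd ⟨neg_eq_zero.2 h0.1, neg_eq_zero.2 h0.2⟩ h.ne_zero
    rwa [hb] at this
  have hMbot : M = ⊥ := (eq_bot_or_eq_top M).resolve_right hMtop
  let K : LieSubmodule ℂ D.L V :=
    { carrier := {v | ∀ x ∈ D.idealL I, ⁅x, v⁆ = 0}
      add_mem' := fun ha hb x hx => by rw [lie_add, ha x hx, hb x hx, add_zero]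
      zero_mem' := fun x _ => lie_zero x
      smul_mem' := fun c v hv x hx => by rw [lie_smul, hv x hx, smul_zero]
      lie_mem := fun {y v} hv x hx => by
        rw [leibniz_lie, hv x hx, lie_zero, add_zero]
        exact hv _ (lie_mem_left ℂ D.L _ _ _ hx) }
  have hTK : ∀ v ∈ T, v ∈ K := by
    intro v hv x hx
    have : ⁅x, v⁆ ∈ M := hM₀ (Submodule.subset_span ⟨x, hx, v, hv, rfl⟩)
    rwa [hMbot, LieSubmodule.mem_bot] at this
  have hK : K = ⊤ := by
    refine (eq_bot_or_eq_top K).resolve_left fun h => hT.ne_bot ?_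
    refine (Submodule.eq_bot_iff _).2 fun v hv => ?_
    have := hTK v hv
    rwa [h, LieSubmodule.mem_bot] at this
  intro x hx v
  have hv : v ∈ K := by rw [hK]; exact LieSubmodule.mem_top v
  exact hv x hx

end IsTop

end Datum
end LieTorus

namespace LieTorus

/-- If `[X, Y] = H`, the operators `Y` and `H` commute, and `X` kills the `H`-stable subspace `T`,
then `X^r Y^r = r! H^r` on `T`. -/
theorem pow_apply_pow_apply_eq {V : Type*} [AddCommGroup V] [Module ℂ V]
    {X Y H : Module.End ℂ V} (hXY : X * Y - Y * X = H) (hYH : Commute Y H) {T : Submodule ℂ V}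
    (hX : ∀ v ∈ T, X v = 0) (hH : ∀ v ∈ T, H v ∈ T) (r : ℕ) :
    ∀ v ∈ T, (X ^ r) ((Y ^ r) v) = (r.factorial : ℂ) • (H ^ r) v := by
  have h1 : ∀ r : ℕ, X * Y ^ (r + 1) = Y ^ (r + 1) * X + ((r + 1 : ℕ) : ℂ) • (Y ^ r * H) := by
    intro r
    induction r with
    | zero => rw [zero_add, pow_one, pow_zero, one_mul, Nat.cast_one, one_smul, ← hXY]; abel
    | succ r ih =>
      have h2 : X * Y ^ (r + 1 + 1) = X * Y ^ (r + 1) * Y := by rw [pow_succ, mul_assoc]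
      have h3 : X * Y = Y * X + H := by rw [← hXY]; abel
      rw [h2, ih, add_mul, mul_assoc, h3, mul_add, smul_mul_assoc, mul_assoc, ← hYH.eq,
        ← mul_assoc (Y ^ r), ← pow_succ, ← mul_assoc, ← pow_succ, add_assoc]
      congr 1
      push_cast
      module
  induction r with
  | zero => intro v _; simp
  | succ r ih =>
    intro v hv
    have h2 := LinearMap.congr_fun (h1 r) v
    simp only [Module.End.mul_apply, LinearMap.add_apply, LinearMap.smul_apply, hX v hv,
      map_zero, zero_add] at h2
    rw [pow_succ X, Module.End.mul_apply, h2, map_smul, ih _ (hH v hv), smul_smul,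
      ← Nat.cast_mul, pow_succ H, Module.End.mul_apply, Nat.factorial_succ]

namespace Datum

universe u v
variable {n : ℕ} {𝔤 : Type u} [LieRing 𝔤] [LieAlgebra ℂ 𝔤] [FiniteDimensional ℂ 𝔤]
  {D : Datum n 𝔤} [LieAlgebra.IsSimple ℂ 𝔤] [LieAlgebra.IsSimple ℂ D.fixed]
  {𝔥 : LieSubalgebra ℂ D.fixed} [𝔥.IsCartanSubalgebra]
  {b : (LieAlgebra.IsKilling.rootSystem 𝔥).Base}
  {V : Type v} [AddCommGroup V] [Module ℂ V] [LieRingModule D.L V] [LieModule ℂ D.L V]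
  {T : Submodule ℂ V}

omit [FiniteDimensional ℂ 𝔤] [LieAlgebra.IsSimple ℂ 𝔤] [LieAlgebra.IsSimple ℂ D.fixed] in
theorem commute_toEnd {x y : D.L} (h : ∀ v : V, ⁅⁅x, y⁆, v⁆ = 0) :
    Commute (LieModule.toEnd ℂ D.L V x) (LieModule.toEnd ℂ D.L V y) := by
  refine LinearMap.ext fun v => ?_
  have := h v
  rw [lie_lie, sub_eq_zero] at this
  exact this

namespace IsTop

omit [LieAlgebra.IsSimple ℂ 𝔤] in
theorem lie_eq_zero_of_nilpotent (hT : D.IsTop b T) {J : Ideal D.Am}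
    (hcomm : ∀ x ∈ D.idealL J, ∀ y ∈ D.idealL J, ∀ v : V, ⁅⁅x, y⁆, v⁆ = 0)
    (hnil : ∀ x ∈ D.L0Ideal 𝔥 J, ∀ v ∈ T, ∃ r, ((LieModule.toEnd ℂ D.L V x) ^ r) v = 0) :
    ∀ x ∈ D.L0Ideal 𝔥 J, ∀ v ∈ T, ⁅x, v⁆ = 0 := by
  have := hT.finiteDimensional
  obtain ⟨v, hv, hv0, hk⟩ := exists_ne_zero_forall_apply_eq_zero
    (E := fun x : D.L0Ideal 𝔥 J => LieModule.toEnd ℂ D.L V (x : D.L))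
    (fun x y => commute_toEnd
      (hcomm _ (D.L0Ideal_le_idealL J x.2) _ (D.L0Ideal_le_idealL J y.2))) _ T rfl hT.ne_bot
    (fun x v hv => hT.lie_mem _ (D.L0Ideal_le_L0 J x.2) v hv) (fun x => hnil x x.2)
  let S : Submodule ℂ V :=
    { carrier := {v | v ∈ T ∧ ∀ x ∈ D.L0Ideal 𝔥 J, ⁅x, v⁆ = 0}
      add_mem' := fun ha hb => ⟨add_mem ha.1 hb.1, fun x hx => by
        rw [lie_add, ha.2 x hx, hb.2 x hx, add_zero]⟩
      zero_mem' := ⟨zero_mem _, fun x _ => lie_zero x⟩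
      smul_mem' := fun c v hv => ⟨Submodule.smul_mem _ c hv.1, fun x hx => by
        rw [lie_smul, hv.2 x hx, smul_zero]⟩ }
  have hS : S = T := by
    refine hT.eq_of_stable S (fun w hw => hw.1)
      ((Submodule.ne_bot_iff _).2 ⟨v, ⟨hv, fun x hx => hk ⟨x, hx⟩⟩, hv0⟩) fun y hy w hw =>
        ⟨hT.lie_mem y hy w hw.1, fun x hx => ?_⟩
    have h1 : ⁅⁅x, y⁆, w⁆ = 0 := by
      rw [← lie_skew, neg_lie, hw.2 _ (D.lie_mem_L0Ideal hy hx), neg_zero]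
    rw [leibniz_lie, h1, hw.2 x hx, lie_zero, add_zero]
  intro x hx w hw
  exact (hS.ge hw).2 x hx

theorem exists_pow_apply_eq_zero (hD : D.IsLieTorus b) (hV : D.IsIntegrable 𝔥 V)
    (hT : D.IsTop b T) {J : Ideal D.Am}
    (hcomm : ∀ x ∈ D.idealL J, ∀ y ∈ D.idealL J, ∀ v : V, ⁅⁅x, y⁆, v⁆ = 0) :
    ∀ x ∈ D.L0Ideal 𝔥 J, ∀ v ∈ T, ∃ r, ((LieModule.toEnd ℂ D.L V x) ^ r) v = 0 := by
  let P : Submodule ℂ D.L :=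
    { carrier := {x | x ∈ D.L0Ideal 𝔥 J ∧
        T ≤ Module.End.maxGenEigenspace (LieModule.toEnd ℂ D.L V x) 0}
      add_mem' := fun {x y} hx hy => ⟨add_mem hx.1 hy.1, fun v hv => by
        have h := Module.End.genEigenspace_inf_le_add _ _ 0 0 ⊤ ⊤ (commute_toEnd (V := V)
          (hcomm _ (D.L0Ideal_le_idealL J hx.1) _ (D.L0Ideal_le_idealL J hy.1)))
          ⟨hx.2 hv, hy.2 hv⟩
        rw [add_zero, ← map_add] at h
        exact h⟩
      zero_mem' := ⟨zero_mem _, fun v _ => by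
        rw [Module.End.mem_maxGenEigenspace]
        exact ⟨1, by simp⟩⟩
      smul_mem' := fun c x hx => ⟨Submodule.smul_mem _ c hx.1, fun v hv => by
        obtain ⟨r, hr⟩ := (Module.End.mem_maxGenEigenspace _ _ _).1 (hx.2 hv)
        refine (Module.End.mem_maxGenEigenspace _ _ _).2 ⟨r, ?_⟩
        rw [zero_smul, sub_zero] at hr ⊢
        rw [map_smul, smul_pow, LinearMap.smul_apply, hr, smul_zero]⟩ }
  have hP : D.L0Ideal 𝔥 J ≤ P := by
    refine D.L0Ideal_le_of_brackets hD fun α κ μ hα hκ _ hκμ X Y hX hY f hf => ?_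
    set x := D.elem κ hX.1 1
    set y := D.elem μ hY.1 f
    have hH : ⁅x, y⁆ ∈ D.L0Ideal 𝔥 J :=
      D.lie_elem_elem_mem_L0Ideal hκμ (add_neg_cancel α) hX hY 1 hf
    refine ⟨hH, fun v hv => (Module.End.mem_maxGenEigenspace _ _ _).2 ?_⟩
    obtain ⟨r, hr⟩ := hV.2 (-α) (neg_ne_zero.2 hα) (μ 0) y (D.elem_mem_rootSpace hY f) v
    refine ⟨r, ?_⟩
    have hpow := pow_apply_pow_apply_eq (X := LieModule.toEnd ℂ D.L V x)
      (Y := LieModule.toEnd ℂ D.L V y) (H := LieModule.toEnd ℂ D.L V ⁅x, y⁆)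
      (LinearMap.ext fun w => (lie_lie x y w).symm)
      (commute_toEnd (hcomm _ (D.elem_mem_idealL hY.1 hf) _ (D.L0Ideal_le_idealL J hH)))
      (T := T) (fun w hw => hT.lie_eq_zero _ (D.rootSpace_le_Lplus (Or.inl (by lia))
        (D.elem_mem_rootSpace hX 1)) w hw)
      (fun w hw => hT.lie_mem _ (D.L0Ideal_le_L0 J hH) w hw) r v hv
    rw [hr, map_zero] at hpow
    rw [zero_smul, sub_zero]
    exact (smul_eq_zero.1 hpow.symm).resolve_left (by exact_mod_cast r.factorial_ne_zero)
  intro x hx v hv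
  obtain ⟨r, hr⟩ := (Module.End.mem_maxGenEigenspace _ _ _).1 ((hP hx).2 hv)
  exact ⟨r, by rwa [zero_smul, sub_zero] at hr⟩

theorem lie_eq_zero_of_mul_self [LieModule.IsIrreducible ℂ D.L V] (hD : D.IsLieTorus b)
    (hV : D.IsIntegrable 𝔥 V) (hT : D.IsTop b T) {J : Ideal D.Am}
    (hJ : ∀ x ∈ D.L0Ideal 𝔥 (J * J), ∀ v ∈ T, ⁅x, v⁆ = 0) :
    ∀ x ∈ D.L0Ideal 𝔥 J, ∀ v ∈ T, ⁅x, v⁆ = 0 := by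
  have hcomm : ∀ x ∈ D.idealL J, ∀ y ∈ D.idealL J, ∀ v : V, ⁅⁅x, y⁆, v⁆ = 0 :=
    fun x hx y hy v => hT.idealL_lie_eq_zero hD hV.1 hJ _ (D.lie_mem_idealL_mul hx hy) v
  exact hT.lie_eq_zero_of_nilpotent hcomm (hT.exists_pow_apply_eq_zero hD hV hcomm)

theorem lie_eq_zero_of_le_radical [LieModule.IsIrreducible ℂ D.L V] (hD : D.IsLieTorus b)
    (hV : D.IsIntegrable 𝔥 V) (hT : D.IsTop b T) {I J : Ideal D.Am}
    (hI : ∀ x ∈ D.L0Ideal 𝔥 I, ∀ v ∈ T, ⁅x, v⁆ = 0) (hJI : J ≤ I.radical) (hJ : J.FG) :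
    ∀ x ∈ D.L0Ideal 𝔥 J, ∀ v ∈ T, ⁅x, v⁆ = 0 := by
  have hpow : ∀ k : ℕ, (∀ x ∈ D.L0Ideal 𝔥 (J ^ 2 ^ k), ∀ v ∈ T, ⁅x, v⁆ = 0) →
      ∀ x ∈ D.L0Ideal 𝔥 J, ∀ v ∈ T, ⁅x, v⁆ = 0 := by
    intro k
    induction k with
    | zero => intro h; rwa [pow_zero, pow_one] at h
    | succ k ih =>
      intro h
      refine ih (hT.lie_eq_zero_of_mul_self hD hV ?_)
      rwa [pow_succ, pow_mul, pow_two] at h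
  obtain ⟨r, hr⟩ := Ideal.exists_pow_le_of_le_radical_of_fg hJI hJ
  refine hpow r fun x hx => hI x ?_
  exact D.L0Ideal_mono ((Ideal.pow_le_pow_right Nat.lt_two_pow_self.le).trans hr) hx

end IsTop

end Datum
end LieTorus

namespace LieTorus

/-- Every nonzero polynomial is a power of `X` times a polynomial which divides a polynomial with
constant term `1`. -/
theorem exists_dvd_mul_pow {p : ℂ[X]} (hp : p ≠ 0) :
    ∃ (q : ℂ[X]) (k : ℕ), q.coeff 0 = 1 ∧ p ∣ q * Polynomial.X ^ k := by
  obtain ⟨q, hq, hq0⟩ := Polynomial.exists_eq_pow_rootMultiplicity_mul_and_not_dvd p hp 0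
  rw [Polynomial.C_0, sub_zero] at hq hq0
  rw [Polynomial.X_dvd_iff] at hq0
  refine ⟨Polynomial.C (q.coeff 0)⁻¹ * q, p.rootMultiplicity 0, ?_, ?_⟩
  · rw [Polynomial.coeff_C_mul, inv_mul_cancel₀ hq0]
  · conv_lhs => rw [hq]
    exact ⟨Polynomial.C (q.coeff 0)⁻¹, by ring⟩

namespace Datum

universe u v

section Quotient

variable {n : ℕ} {𝔤 : Type u} [LieRing 𝔤] [LieAlgebra ℂ 𝔤] (D : Datum n 𝔤)

/-- The element `mᵢ eᵢ` of `Γ`. -/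
def gen (i : Fin n) : D.Γ :=
  ⟨Pi.single i (D.m i.succ : ℤ), fun j => by
    rcases eq_or_ne j i with rfl | h
    · simp
    · simp [h]⟩

theorem powVar_eq (i : Fin n) : D.powVar i = AddMonoidAlgebra.single (D.gen i) 1 := rfl

theorem powVar_mul_inv (i : Fin n) :
    D.powVar i * AddMonoidAlgebra.single (-D.gen i) 1 = 1 := by
  rw [powVar_eq, AddMonoidAlgebra.single_mul_single, add_neg_cancel, one_mul]
  rfl

theorem eq_sum_gen (γ : D.Γ) : ∃ c : Fin n → ℤ, γ = ∑ i, c i • D.gen i := by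
  choose c hc using γ.2
  refine ⟨c, Subtype.ext ?_⟩
  ext j
  rw [hc j, AddSubgroup.val_finsetSum, Finset.sum_apply, Finset.sum_eq_single j]
  · simp [gen, mul_comm]
  · intro i _ hij
    simp [gen, Pi.single_eq_of_ne hij.symm]
  · simp

theorem finiteDimensional_quotient_idealOf {P : Fin n → ℂ[X]} (hP : ∀ i, P i ≠ 0) :
    FiniteDimensional ℂ (D.Am ⧸ D.idealOf P) := by
  let q : D.Am →ₐ[ℂ] D.Am ⧸ D.idealOf P := Ideal.Quotient.mkₐ ℂ _
  let S : AddSubgroup D.Γ :=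
    { carrier := {γ | IsIntegral ℂ (q (AddMonoidAlgebra.single γ 1)) ∧
        IsIntegral ℂ (q (AddMonoidAlgebra.single (-γ) 1))}
      zero_mem' := by
        have : IsIntegral ℂ (q (AddMonoidAlgebra.single 0 1)) := by
          rw [← AddMonoidAlgebra.one_def, map_one]; exact isIntegral_one
        exact ⟨this, by rwa [neg_zero]⟩
      add_mem' := fun {a b} ha hb => by
        constructor
        · rw [← one_mul (1 : ℂ), ← AddMonoidAlgebra.single_mul_single, map_mul]
          exact ha.1.mul hb.1
        · rw [neg_add, ← one_mul (1 : ℂ), ← AddMonoidAlgebra.single_mul_single, map_mul]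
          exact ha.2.mul hb.2
      neg_mem' := fun {a} ha => ⟨ha.2, by rw [neg_neg]; exact ha.1⟩ }
  have hgen : ∀ i, D.gen i ∈ S := by
    intro i
    have h1 : IsAlgebraic ℂ (q (D.powVar i)) := by
      refine ⟨P i, hP i, ?_⟩
      rw [Polynomial.aeval_algHom_apply]
      exact Ideal.Quotient.eq_zero_iff_mem.2 (Ideal.subset_span ⟨i, rfl⟩)
    have hinv : q (D.powVar i) * q (AddMonoidAlgebra.single (-D.gen i) 1) = 1 := by
      rw [← map_mul, powVar_mul_inv, map_one]
    let _ : Invertible (q (D.powVar i)) := invertibleOfRightInverse _ _ hinv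
    exact ⟨h1.isIntegral, h1.invOf.isIntegral⟩
  have hS : ∀ γ, γ ∈ S := by
    intro γ
    obtain ⟨c, hc⟩ := D.eq_sum_gen γ
    rw [hc]
    exact sum_mem fun i _ => zsmul_mem (hgen i) _
  have hint : Algebra.IsIntegral ℂ (D.Am ⧸ D.idealOf P) := by
    refine ⟨fun x => ?_⟩
    obtain ⟨f, rfl⟩ := Ideal.Quotient.mkₐ_surjective ℂ _ x
    induction f using D.Am_induction with
    | h1 γ => exact (hS γ).1
    | h2 f g hf hg => rw [map_add]; exact hf.add hg
    | h3 c f hf => rw [map_smul]; exact hf.smul c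
  have : AddMonoid.FG D.Γ := by
    refine AddGroup.fg_iff_addMonoid_fg.1 (AddGroup.fg_iff.2 ⟨Set.range D.gen, ?_,
      Set.finite_range _⟩)
    refine eq_top_iff.2 fun γ _ => ?_
    obtain ⟨c, hc⟩ := D.eq_sum_gen γ
    rw [hc]
    exact sum_mem fun i _ => zsmul_mem (AddSubgroup.subset_closure (Set.mem_range_self i)) _
  exact Algebra.IsIntegral.finite

end Quotient

variable {n : ℕ} {𝔤 : Type u} [LieRing 𝔤] [LieAlgebra ℂ 𝔤] [FiniteDimensional ℂ 𝔤]
  {D : Datum n 𝔤} [LieAlgebra.IsSimple ℂ D.fixed]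
  {𝔥 : LieSubalgebra ℂ D.fixed} [𝔥.IsCartanSubalgebra]
  {b : (LieAlgebra.IsKilling.rootSystem 𝔥).Base}
  {V : Type v} [AddCommGroup V] [Module ℂ V] [LieRingModule D.L V] [LieModule ℂ D.L V]
  {T : Submodule ℂ V}

variable (D T) in
/-- The elements `Y` of `𝔤(μ)` such that `Y t^μ g f` kills `T` for all `g ∈ A(m)`. -/
def killers (μ : Fin (n + 1) → ℤ) (f : D.Am) : Submodule ℂ 𝔤 where
  carrier := {Y | ∃ hY : Y ∈ D.graded μ, ∀ g, ∀ v ∈ T, ⁅D.elem μ hY (g * f), v⁆ = 0}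
  add_mem' := by
    rintro X Y ⟨hX, hX'⟩ ⟨hY, hY'⟩
    refine ⟨add_mem hX hY, fun g v hv => ?_⟩
    rw [elem_add_left _ hX hY, add_lie, hX' g v hv, hY' g v hv, add_zero]
  zero_mem' := ⟨zero_mem _, fun g v _ => by rw [elem_zero_left, zero_lie]⟩
  smul_mem' := by
    rintro c X ⟨hX, hX'⟩
    refine ⟨Submodule.smul_mem _ c hX, fun g v hv => ?_⟩
    rw [elem_smul_left _ hX, smul_lie, hX' g v hv, smul_zero]

omit [FiniteDimensional ℂ 𝔤] [LieAlgebra.IsSimple ℂ D.fixed] in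
theorem killers_mono {μ : Fin (n + 1) → ℤ} {f f' : D.Am} (h : f ∣ f') :
    D.killers T μ f ≤ D.killers T μ f' := by
  obtain ⟨a, rfl⟩ := h
  rintro Y ⟨hY, hY'⟩
  refine ⟨hY, fun g v hv => ?_⟩
  rw [mul_comm f, ← mul_assoc]
  exact hY' _ v hv

omit [FiniteDimensional ℂ 𝔤] [LieAlgebra.IsSimple ℂ D.fixed] in
theorem killers_shift (μ : Fin (n + 1) → ℤ) (γ : D.Γ) (f : D.Am) :
    D.killers T μ f ≤ D.killers T (μ + D.expIncl γ) f := by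
  rintro Y ⟨hY, hY'⟩
  refine ⟨by rwa [graded_add_expIncl], fun g v hv => ?_⟩
  rw [D.elem_shift hY γ, ← mul_assoc]
  exact hY' _ v hv

namespace IsTop

/-- For `β ≠ 0`, the `f ∈ A(m)` such that `Y t^μ f` kills the top form an ideal. -/
theorem mem_killers (hT : D.IsTop b T) {β : Module.Dual ℂ 𝔥} (hβ : β ≠ 0)
    {μ : Fin (n + 1) → ℤ} {Y : 𝔤} (hY : Y ∈ D.gradedRoot 𝔥 μ β) {f : D.Am}
    (hf : ∀ v ∈ T, ⁅D.elem μ hY.1 f, v⁆ = 0) : Y ∈ D.killers T μ f := by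
  refine ⟨hY.1, fun g v hv => ?_⟩
  obtain ⟨h, hh⟩ : ∃ h, β h ≠ 0 := by
    by_contra hc
    push Not at hc
    exact hβ (LinearMap.ext hc)
  have hh0 : ((h : D.fixed) : 𝔤) ∈ D.gradedRoot 𝔥 0 0 := by
    refine ⟨D.mem_graded_zero h, fun h' => ?_⟩
    have := congrArg (fun x : 𝔥 => ((x : D.fixed) : 𝔤)) (trivial_lie_zero 𝔥 𝔥 h' h)
    simpa using this
  have hz : D.elem 0 hh0.1 g ∈ D.L0 𝔥 :=
    D.L0Ideal_le_L0 ⊤ (D.elem_mem_L0Ideal rfl hh0 Submodule.mem_top)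
  have hmem : ⁅((h : D.fixed) : 𝔤), Y⁆ ∈ D.graded μ := by
    rw [hY.2 h]; exact Submodule.smul_mem _ _ hY.1
  have e := D.lie_elem_elem hh0.1 hY.1 (zero_add μ) hmem g f
  have e2 : D.elem μ hmem (g * f) = β h • D.elem μ hY.1 (g * f) := by
    rw [← D.elem_smul_left hY.1]
    congr 1
    exact hY.2 h
  rw [Pi.zero_apply, Int.cast_zero, zero_mul, zero_smul, add_zero, e2] at e
  have e3 := congrArg (fun x => ⁅x, v⁆) e
  simp only [lie_lie, smul_lie] at e3
  rw [hf v hv, hf _ (hT.lie_mem _ hz v hv), lie_zero, sub_zero] at e3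
  exact (smul_eq_zero.1 e3.symm).resolve_left hh

theorem exists_polynomial_mem_killers (hV : D.IsWeightModule 𝔥 V) (hT : D.IsTop b T)
    {β : Module.Dual ℂ 𝔥} (hβ : β ≠ 0) {μ : Fin (n + 1) → ℤ} {Y : 𝔤}
    (hY : Y ∈ D.gradedRoot 𝔥 μ β) (i : Fin n) :
    ∃ p : ℂ[X], p ≠ 0 ∧ Y ∈ D.killers T μ (Polynomial.aeval (D.powVar i) p) := by
  obtain ⟨lam, hlam⟩ := hT.exists_le_weightSpace
  have := hT.finiteDimensional
  have := hV.2.2 (lam + D.shift β (μ 0))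
  let φ : ℂ[X] →ₗ[ℂ] T →ₗ[ℂ] D.weightSpace 𝔥 V (lam + D.shift β (μ 0)) :=
    LinearMap.mk₂ ℂ (fun p v => ⟨⁅D.elem μ hY.1 (Polynomial.aeval (D.powVar i) p), (v : V)⁆,
        D.lie_mem_weightSpace (D.elem_mem_rootSpace hY _) (hlam v.2)⟩)
      (fun p q v => Subtype.ext (by
        change ⁅_, (v : V)⁆ = ⁅_, (v : V)⁆ + ⁅_, (v : V)⁆
        rw [map_add, elem_add, add_lie]))
      (fun c p v => Subtype.ext (by
        change ⁅_, (v : V)⁆ = c • ⁅_, (v : V)⁆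
        rw [map_smul, elem_smul, smul_lie]))
      (fun p v w => Subtype.ext (lie_add _ _ _))
      (fun c p v => Subtype.ext (lie_smul _ _ _))
  have hφ : ¬ Function.Injective φ := fun h =>
    Polynomial.not_finite (R := ℂ) (Module.Finite.of_injective φ h)
  rw [← LinearMap.ker_eq_bot, ← Ne, Submodule.ne_bot_iff] at hφ
  obtain ⟨p, hp, hp0⟩ := hφ
  refine ⟨p, hp0, hT.mem_killers hβ hY fun v hv => ?_⟩
  exact congrArg Subtype.val (LinearMap.congr_fun (LinearMap.mem_ker.1 hp) ⟨v, hv⟩)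

theorem exists_polynomial_forall_le_killers (hV : D.IsWeightModule 𝔥 V) (hT : D.IsTop b T)
    (i : Fin n) (μ : Fin (n + 1) → ℤ) : ∃ p : ℂ[X], p ≠ 0 ∧ ∀ β : Module.Dual ℂ 𝔥, β ≠ 0 →
      D.gradedRoot 𝔥 μ β ≤ D.killers T μ (Polynomial.aeval (D.powVar i) p) := by
  classical
  let G : Set 𝔤 := {Y | ∃ β : Module.Dual ℂ 𝔥, β ≠ 0 ∧ Y ∈ D.gradedRoot 𝔥 μ β}
  obtain ⟨s, hsG, hs⟩ := Submodule.fg_span_iff_fg_span_finset_subset G |>.1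
    (IsNoetherian.noetherian (Submodule.span ℂ G))
  have hex : ∀ Y : 𝔤, ∃ p : ℂ[X], p ≠ 0 ∧
      (Y ∈ G → Y ∈ D.killers T μ (Polynomial.aeval (D.powVar i) p)) := by
    intro Y
    by_cases hY : Y ∈ G
    · obtain ⟨β, hβ, hY⟩ := hY
      obtain ⟨p, hp, h⟩ := hT.exists_polynomial_mem_killers hV hβ hY i
      exact ⟨p, hp, fun _ => h⟩
    · exact ⟨1, one_ne_zero, fun h => absurd h hY⟩
  choose p hp0 hp using hex
  refine ⟨∏ Y ∈ s, p Y, Finset.prod_ne_zero_iff.2 fun Y _ => hp0 Y, fun β hβ Y hY => ?_⟩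
  have hle : Submodule.span ℂ (s : Set 𝔤) ≤
      D.killers T μ (Polynomial.aeval (D.powVar i) (∏ Y ∈ s, p Y)) := Submodule.span_le.2
    fun Z hZ => killers_mono (map_dvd _ (Finset.dvd_prod_of_mem p hZ)) (hp Z (hsG hZ))
  refine hle ?_
  rw [← hs]
  exact Submodule.subset_span ⟨β, hβ, hY⟩

theorem exists_polynomial_forall_bounded (hV : D.IsWeightModule 𝔥 V) (hT : D.IsTop b T)
    (i : Fin n) : ∃ p : ℂ[X], p.coeff 0 = 1 ∧ ∀ μ : Fin (n + 1) → ℤ,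
      -(2 * D.m 0) ≤ μ 0 → μ 0 ≤ 0 → ∀ β : Module.Dual ℂ 𝔥, β ≠ 0 →
      D.gradedRoot 𝔥 μ β ≤ D.killers T μ (Polynomial.aeval (D.powVar i) p) := by
  classical
  choose p hp0 hp using hT.exists_polynomial_forall_le_killers hV i
  let s : Finset (Fin (n + 1) → ℤ) := Finset.Icc (fun _ => -(2 * D.m 0)) (fun j => D.m j)
  obtain ⟨q, k, hq0, hq⟩ := exists_dvd_mul_pow
    (Finset.prod_ne_zero_iff.2 fun μ (_ : μ ∈ s) => hp0 μ)
  refine ⟨q, hq0, fun μ hμ1 hμ2 β hβ => ?_⟩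
  have hm : ∀ j, (0 : ℤ) < D.m j := fun j => by exact_mod_cast D.m_pos j
  let ν : Fin (n + 1) → ℤ := fun j => if j = 0 then μ 0 else μ j % D.m j
  have hν : ν ∈ s := by
    refine Finset.mem_Icc.2 ⟨fun j => ?_, fun j => ?_⟩
    · by_cases hj : j = 0
      · simp only [ν, hj, if_true]; exact hμ1
      · simp only [ν, hj, if_false]
        have := Int.emod_nonneg (μ j) (hm j).ne'
        have := hm 0
        lia
    · by_cases hj : j = 0
      · simp only [ν, hj, if_true]
        have := hm 0
        lia
      · simp only [ν, hj, if_false]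
        exact (Int.emod_lt_of_pos _ (hm j)).le
  have hdvd : ∀ j, (D.m j : ℤ) ∣ μ j - ν j := by
    intro j
    by_cases hj : j = 0
    · simp [ν, hj]
    · simp only [ν, hj, if_false]
      exact Int.dvd_self_sub_emod
  obtain ⟨γ, hγ⟩ := exists_eq_add_expIncl D (κ := μ) (μ := ν) (by simp [ν]) hdvd
  have h1 : D.gradedRoot 𝔥 ν β ≤
      D.killers T ν (Polynomial.aeval (D.powVar i) (q * Polynomial.X ^ k)) :=
    (hp ν β hβ).trans (killers_mono (map_dvd _ ((Finset.dvd_prod_of_mem p hν).trans hq)))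
  have h2 : Polynomial.aeval (D.powVar i) (q * Polynomial.X ^ k) ∣
      Polynomial.aeval (D.powVar i) q := by
    refine ⟨(AddMonoidAlgebra.single (-D.gen i) 1) ^ k, ?_⟩
    rw [map_mul, map_pow, Polynomial.aeval_X, mul_assoc, ← mul_pow, powVar_mul_inv, one_pow,
      mul_one]
  rw [D.gradedRoot_congr 𝔥 (D.ξ_zpow_congr hdvd), hγ]
  exact (h1.trans (killers_mono h2)).trans (killers_shift _ _ _)

theorem exists_idealOf [LieAlgebra.IsSimple ℂ 𝔤] (hD : D.IsLieTorus b) (hV : D.IsWeightModule 𝔥 V) (hT : D.IsTop b T) :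
    ∃ P : Fin n → ℂ[X], (∀ i, (P i).coeff 0 = 1) ∧
      ∀ x ∈ D.L0Ideal 𝔥 (D.idealOf P), ∀ v ∈ T, ⁅x, v⁆ = 0 := by
  choose P hP0 hP using hT.exists_polynomial_forall_bounded hV
  refine ⟨P, hP0, ?_⟩
  let K : Submodule ℂ D.L :=
    { carrier := {x | ∀ v ∈ T, ⁅x, v⁆ = 0}
      add_mem' := fun ha hb v hv => by rw [add_lie, ha v hv, hb v hv, add_zero]
      zero_mem' := fun v _ => zero_lie v
      smul_mem' := fun c x hx v hv => by rw [smul_lie, hx v hv, smul_zero] }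
  refine D.L0Ideal_le_of_brackets (P := K) hD fun α κ μ hα hκ1 hκ2 hκμ X Y hX hY f hf v hv => ?_
  have h1 : ∀ v ∈ T, ⁅D.elem κ hX.1 1, v⁆ = 0 :=
    hT.lie_eq_zero _ (D.rootSpace_le_Lplus (Or.inl (by lia)) (D.elem_mem_rootSpace hX 1))
  have h2 : ∀ f ∈ D.idealOf P, ∀ v ∈ T, ⁅D.elem μ hY.1 f, v⁆ = 0 := by
    intro f hf
    induction hf using Submodule.span_induction with
    | mem f hf =>
      obtain ⟨i, rfl⟩ := hf
      obtain ⟨_, h⟩ := hP i μ (by lia) (by lia) (-α) (neg_ne_zero.2 hα) hY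
      intro v hv
      have := h 1 v hv
      rwa [one_mul] at this
    | zero =>
      intro v _
      rw [← zero_smul ℂ (0 : D.Am), elem_smul, zero_smul, zero_lie]
    | add f g _ _ hf hg => intro v hv; rw [elem_add, add_lie, hf v hv, hg v hv, add_zero]
    | smul g f _ hf =>
      intro v hv
      obtain ⟨_, h⟩ := hT.mem_killers (neg_ne_zero.2 hα) hY hf
      exact h g v hv
  rw [lie_lie, h1 v hv, h2 f hf v hv, lie_zero, lie_zero, sub_zero]

end IsTop

end Datum
end LieTorus

namespace LieTorus

theorem exists_dvd_squarefreePart_pow {P : ℂ[X]} (hP : P ≠ 0) :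
    ∃ r : ℕ, P ∣ squarefreePart P ^ r := by
  obtain ⟨r, hr⟩ := Multiset.le_smul_dedup P.roots
  refine ⟨r, ?_⟩
  have h1 := Multiset.prod_dvd_prod_of_le
    (Multiset.map_le_map (f := fun c : ℂ => Polynomial.X - Polynomial.C c) hr)
  rw [Multiset.map_nsmul, Multiset.prod_nsmul] at h1
  have h2 : P = Polynomial.C P.leadingCoeff *
      (P.roots.map fun c => Polynomial.X - Polynomial.C c).prod :=
    (IsAlgClosed.splits P).eq_prod_roots
  obtain ⟨Q, hQ⟩ := h1
  refine ⟨Polynomial.C P.leadingCoeff⁻¹ * Q, ?_⟩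
  have h3 : Polynomial.C P.leadingCoeff * Polynomial.C P.leadingCoeff⁻¹ = 1 := by
    rw [← Polynomial.C_mul, mul_inv_cancel₀ (Polynomial.leadingCoeff_ne_zero.2 hP), Polynomial.C_1]
  calc squarefreePart P ^ r = (P.roots.map fun c => Polynomial.X - Polynomial.C c).prod * Q := hQ
    _ = (Polynomial.C P.leadingCoeff * Polynomial.C P.leadingCoeff⁻¹) *
        ((P.roots.map fun c => Polynomial.X - Polynomial.C c).prod * Q) := by rw [h3, one_mul]
    _ = (Polynomial.C P.leadingCoeff * (P.roots.map fun c => Polynomial.X - Polynomial.C c).prod) *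
        (Polynomial.C P.leadingCoeff⁻¹ * Q) := by ring
    _ = P * (Polynomial.C P.leadingCoeff⁻¹ * Q) := by rw [← h2]

section QuotientModule

variable {L V : Type*} [LieRing L] [LieAlgebra ℂ L] [AddCommGroup V] [Module ℂ V]
  [LieRingModule L V] [LieModule ℂ L V]

/-- A representation factors through the quotient by an ideal which acts as zero. -/
theorem exists_lieModule_quotient (I : LieIdeal ℂ L) (hI : ∀ x ∈ I, ∀ v : V, ⁅x, v⁆ = 0) :
    ∃ (_ : LieRingModule (L ⧸ I) V) (_ : LieModule ℂ (L ⧸ I) V), ∀ (x : L) (v : V),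
      ⁅(LieSubmodule.Quotient.mk x : L ⧸ I), v⁆ = ⁅x, v⁆ := by
  let φ : (L ⧸ I) →ₗ[ℂ] Module.End ℂ V :=
    I.toSubmodule.liftQ (LieModule.toEnd ℂ L V : L →ₗ[ℂ] Module.End ℂ V)
      fun x hx => LinearMap.ext (hI x hx)
  have hφ : ∀ (x : L) (v : V), φ (LieSubmodule.Quotient.mk x) v = ⁅x, v⁆ := fun _ _ => rfl
  let i1 : LieRingModule (L ⧸ I) V :=
    { bracket := fun x v => φ x v
      add_lie := fun x y v => by
        change φ (x + y) v = φ x v + φ y v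
        rw [map_add, LinearMap.add_apply]
      lie_add := fun x v w => map_add (φ x) v w
      leibniz_lie := fun x y v => by
        obtain ⟨x, rfl⟩ := LieSubmodule.Quotient.surjective_mk' I x
        obtain ⟨y, rfl⟩ := LieSubmodule.Quotient.surjective_mk' I y
        exact leibniz_lie x y v }
  refine ⟨i1, ⟨fun c x v => ?_, fun c x v => map_smul (φ x) c v⟩, hφ⟩
  change φ (c • x) v = c • φ x v
  rw [map_smul, LinearMap.smul_apply]

end QuotientModule

section Enveloping

attribute [local instance 100] LieRing.ofAssociativeRing

/-- `U(L)` is generated by `L`. -/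
theorem mem_of_ι_mem {L : Type*} [LieRing L] [LieAlgebra ℂ L]
    (S : Subalgebra ℂ (UniversalEnvelopingAlgebra ℂ L))
    (hS : ∀ x : L, UniversalEnvelopingAlgebra.ι ℂ x ∈ S) (u : UniversalEnvelopingAlgebra ℂ L) :
    u ∈ S := by
  let f : L →ₗ⁅ℂ⁆ S :=
    { toFun := fun x => ⟨UniversalEnvelopingAlgebra.ι ℂ x, hS x⟩
      map_add' := fun x y => Subtype.ext (map_add _ x y)
      map_smul' := fun c x => Subtype.ext (map_smul _ c x)
      map_lie' := fun {x y} => Subtype.ext (LieHom.map_lie _ x y) }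
  have h : S.val.comp (UniversalEnvelopingAlgebra.lift ℂ f) =
      AlgHom.id ℂ (UniversalEnvelopingAlgebra ℂ L) := by
    refine UniversalEnvelopingAlgebra.hom_ext ℂ (LieHom.ext fun x => ?_)
    change ((UniversalEnvelopingAlgebra.lift ℂ f (UniversalEnvelopingAlgebra.ι ℂ x) : S) :
      UniversalEnvelopingAlgebra ℂ L) = UniversalEnvelopingAlgebra.ι ℂ x
    rw [UniversalEnvelopingAlgebra.lift_ι_apply]
    rfl
  have h2 := DFunLike.congr_fun h u
  rw [AlgHom.id_apply] at h2
  rw [← h2]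
  exact Subtype.property _

end Enveloping

namespace Datum

universe u v w
variable {n : ℕ} {𝔤 : Type u} [LieRing 𝔤] [LieAlgebra ℂ 𝔤] [FiniteDimensional ℂ 𝔤]
  (D : Datum n 𝔤) [LieAlgebra.IsSimple ℂ D.fixed]
  {𝔥 : LieSubalgebra ℂ D.fixed} [𝔥.IsCartanSubalgebra]
  (b : (LieAlgebra.IsKilling.rootSystem 𝔥).Base)
  {N : Type v} [AddCommGroup N] [Module ℂ N] [LieRingModule (D.L0 𝔥) N]
  [LieModule ℂ (D.L0 𝔥) N]
  {V : Type w} [AddCommGroup V] [Module ℂ V] [LieRingModule D.L V] [LieModule ℂ D.L V]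

namespace Verma

/-- The element `u ⊗ v` of `M(N)`. -/
def tmul (u : UniversalEnvelopingAlgebra ℂ D.L) (v : N) : D.Verma b N :=
  (Submodule.Quotient.mk (u ⊗ₜ[ℂ] v) :
    (UniversalEnvelopingAlgebra ℂ D.L ⊗[ℂ] N) ⧸ D.vermaRel b N)

omit [LieModule ℂ (D.L0 𝔥) N] in
theorem smul_tmul (u u' : UniversalEnvelopingAlgebra ℂ D.L) (v : N) :
    u • tmul D b u' v = tmul D b (u * u') v := rfl

omit [LieModule ℂ (D.L0 𝔥) N] in
theorem lie_tmul_one (x : D.L) (v : N) :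
    ⁅x, tmul D b 1 v⁆ = tmul D b (UniversalEnvelopingAlgebra.ι ℂ x) v := by
  change UniversalEnvelopingAlgebra.ι ℂ x • tmul D b 1 v = _
  rw [smul_tmul, mul_one]

omit [LieModule ℂ (D.L0 𝔥) N] in
theorem lie_tmul_one_of_mem_L0 (x : D.L0 𝔥) (v : N) :
    ⁅(x : D.L), tmul D b 1 v⁆ = tmul D b 1 ⁅x, v⁆ := by
  rw [lie_tmul_one]
  exact (Submodule.Quotient.eq _).2 (Submodule.subset_span (Or.inl ⟨x, v, rfl⟩))

omit [LieModule ℂ (D.L0 𝔥) N] in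
theorem lie_tmul_one_of_mem_Lplus {x : D.L} (hx : x ∈ D.Lplus b) (v : N) :
    ⁅x, tmul D b 1 v⁆ = 0 := by
  rw [lie_tmul_one]
  exact (Submodule.Quotient.mk_eq_zero _).2 (Submodule.subset_span (Or.inr ⟨x, hx, v, rfl⟩))

/-- The map `v ↦ 1 ⊗ v` from `N` to `M(N)`. -/
def tmulOne : N →ₗ[ℂ] D.Verma b N where
  toFun := tmul D b 1
  map_add' v w := congrArg Submodule.Quotient.mk (TensorProduct.tmul_add _ v w)
  map_smul' c v := by
    change _ = algebraMap ℂ (UniversalEnvelopingAlgebra ℂ D.L) c • tmul D b 1 v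
    rw [smul_tmul, mul_one]
    rw [Algebra.algebraMap_eq_smul_one]
    exact congrArg Submodule.Quotient.mk (TensorProduct.smul_tmul c 1 v).symm

omit [LieModule ℂ (D.L0 𝔥) N] in
/-- An `𝔏`-submodule of `M(N)` which contains `1 ⊗ N` is everything. -/
theorem eq_top_of_tmul_one_mem (K : LieSubmodule ℂ D.L (D.Verma b N))
    (hK : ∀ v : N, tmul D b 1 v ∈ K) : K = ⊤ := by
  let S : Subalgebra ℂ (UniversalEnvelopingAlgebra ℂ D.L) :=
    { carrier := {u | ∀ z ∈ K, u • z ∈ K}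
      mul_mem' := fun ha hb z hz => by rw [mul_smul]; exact ha _ (hb z hz)
      add_mem' := fun ha hb z hz => by rw [add_smul]; exact add_mem (ha z hz) (hb z hz)
      algebraMap_mem' := fun c z hz => K.smul_mem c hz }
  have hS : ∀ u, u ∈ S := mem_of_ι_mem S fun x z hz => K.lie_mem (x := x) hz
  refine eq_top_iff.2 fun z _ => ?_
  obtain ⟨y, rfl⟩ := Submodule.Quotient.mk_surjective (D.vermaRel b N) z
  induction y using TensorProduct.induction_on with
  | zero => exact zero_mem K
  | add x y hx hy => exact add_mem (hx trivial) (hy trivial)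
  | tmul u v =>
    have h : u • tmul D b 1 v ∈ K := hS u _ (hK v)
    rw [smul_tmul, mul_one] at h
    exact h

end Verma

variable {D b}

omit [LieModule ℂ D.L V] [LieModule ℂ (D.L0 𝔥) N] in
/-- The image of `N` in an irreducible quotient of `M(N)`. -/
theorem exists_isTop [FiniteDimensional ℂ N] [LieModule.IsIrreducible ℂ (D.L0 𝔥) N]
    [LieModule.IsIrreducible ℂ D.L V] (π : D.Verma b N →ₗ⁅ℂ, D.L⁆ V)
    (hπ : Function.Surjective π) : ∃ j : N →ₗ[ℂ] V, Function.Injective j ∧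
      (∀ (x : D.L0 𝔥) (v : N), ⁅(x : D.L), j v⁆ = j ⁅x, v⁆) ∧ D.IsTop b (LinearMap.range j) := by
  let j : N →ₗ[ℂ] V := (π : D.Verma b N →ₗ[ℂ] V) ∘ₗ Verma.tmulOne D b
  have hj0 : ∀ (x : D.L0 𝔥) (v : N), ⁅(x : D.L), j v⁆ = j ⁅x, v⁆ := fun x v =>
    (LieModuleHom.map_lie π _ _).symm.trans
      (congrArg π (Verma.lie_tmul_one_of_mem_L0 D b x v))
  have hjp : ∀ x ∈ D.Lplus b, ∀ v : N, ⁅x, j v⁆ = 0 := fun x hx v =>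
    (LieModuleHom.map_lie π _ _).symm.trans
      ((congrArg π (Verma.lie_tmul_one_of_mem_Lplus D b hx v)).trans (map_zero π))
  have hne : ∃ v, j v ≠ 0 := by
    by_contra hc
    push Not at hc
    have hker : π.ker = ⊤ := Verma.eq_top_of_tmul_one_mem D b π.ker fun v =>
      LieModuleHom.mem_ker.2 (hc v)
    have := LieModule.nontrivial_of_isIrreducible ℂ D.L V
    obtain ⟨w, hw⟩ := exists_ne (0 : V)
    obtain ⟨z, rfl⟩ := hπ w
    have hz : z ∈ π.ker := by rw [hker]; exact LieSubmodule.mem_top z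
    exact hw (LieModuleHom.mem_ker.1 hz)
  have hstab : ∀ S : Submodule ℂ V, (∀ x ∈ D.L0 𝔥, ∀ v ∈ S, ⁅x, v⁆ ∈ S) →
      S.comap j = ⊥ ∨ S.comap j = ⊤ := by
    intro S hS
    let K : LieSubmodule ℂ (D.L0 𝔥) N :=
      { S.comap j with
        lie_mem := fun {x v} hv => by
          change j ⁅x, v⁆ ∈ S
          rw [← hj0]
          exact hS _ x.2 _ hv }
    rcases eq_bot_or_eq_top K with h | h
    · exact Or.inl (congrArg LieSubmodule.toSubmodule h)
    · exact Or.inr (congrArg LieSubmodule.toSubmodule h)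
  refine ⟨j, ?_, hj0, ?_, inferInstance, ?_, ?_, ?_⟩
  · rw [← LinearMap.ker_eq_bot]
    refine (hstab ⊥ fun x _ v hv => ?_).resolve_right fun h => ?_
    · rw [(Submodule.mem_bot ℂ).1 hv, lie_zero]; exact zero_mem _
    · obtain ⟨v, hv⟩ := hne
      have : v ∈ (⊥ : Submodule ℂ V).comap j := h ▸ Submodule.mem_top
      exact hv this
  · obtain ⟨v, hv⟩ := hne
    exact (Submodule.ne_bot_iff _).2 ⟨j v, ⟨v, rfl⟩, hv⟩
  · rintro x hx _ ⟨v, rfl⟩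
    exact hjp x hx v
  · rintro x hx _ ⟨v, rfl⟩
    exact ⟨⁅(⟨x, hx⟩ : D.L0 𝔥), v⁆, (hj0 ⟨x, hx⟩ v).symm⟩
  · intro S hS hS0 hst
    refine le_antisymm hS ?_
    have h := (hstab S hst).resolve_left fun h => hS0 ?_
    · rintro _ ⟨v, rfl⟩
      have : v ∈ S.comap j := h ▸ Submodule.mem_top
      exact this
    · refine (Submodule.eq_bot_iff _).2 fun w hw => ?_
      obtain ⟨v, rfl⟩ := hS hw
      have : v ∈ S.comap j := hw
      rw [h, Submodule.mem_bot] at this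
      rw [this, map_zero]

end Datum

end LieTorus

end

theorem mainTheorem3 {n : ℕ} {𝔤 : Type*} [LieRing 𝔤] [LieAlgebra ℂ 𝔤] [FiniteDimensional ℂ 𝔤]
    [LieAlgebra.IsSimple ℂ 𝔤] (D : LieTorus.Datum n 𝔤) [LieAlgebra.IsSimple ℂ D.fixed]
    (𝔥 : LieSubalgebra ℂ D.fixed) [𝔥.IsCartanSubalgebra]
    (b : (LieAlgebra.IsKilling.rootSystem 𝔥).Base) (hD : D.IsLieTorus b)
    {N : Type*} [AddCommGroup N] [Module ℂ N] [FiniteDimensional ℂ N]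
    [LieRingModule (D.L0 𝔥) N] [LieModule ℂ (D.L0 𝔥) N]
    [LieModule.IsIrreducible ℂ (D.L0 𝔥) N]
    {V : Type*} [AddCommGroup V] [Module ℂ V] [LieRingModule D.L V] [LieModule ℂ D.L V]
    [LieModule.IsIrreducible ℂ D.L V]
    (π : D.Verma b N →ₗ⁅ℂ, D.L⁆ V) (hπ : Function.Surjective π)
    (hV : D.IsIntegrable 𝔥 V) :
    (∃ P : Fin n → Polynomial ℂ, (∀ i, (P i).coeff 0 = 1) ∧
      FiniteDimensional ℂ (D.Am ⧸ D.idealOf P) ∧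
      ∀ x : D.L0 𝔥, (x : D.L) ∈ D.L0Ideal 𝔥 (D.idealOf P) → ∀ v : N, ⁅x, v⁆ = 0) ∧
    ∀ P : Fin n → Polynomial ℂ, (∀ i, (P i).coeff 0 ≠ 0) →
      (∀ x : D.L0 𝔥, (x : D.L) ∈ D.L0Ideal 𝔥 (D.idealOf P) → ∀ v : N, ⁅x, v⁆ = 0) →
      (∀ x ∈ D.idealL (D.idealOf fun i => LieTorus.squarefreePart (P i)), ∀ v : V, ⁅x, v⁆ = 0) ∧
      ∃ (_ : LieRingModule
            (D.quotientL (D.idealOf fun i => LieTorus.squarefreePart (P i))) V)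
          (_ : LieModule ℂ (D.quotientL (D.idealOf fun i => LieTorus.squarefreePart (P i))) V),
        ∀ (x : D.L) (v : V),
          ⁅(LieSubmodule.Quotient.mk x :
            D.quotientL (D.idealOf fun i => LieTorus.squarefreePart (P i))), v⁆ = ⁅x, v⁆ := by
  obtain ⟨j, hj, hj0, hT⟩ := LieTorus.Datum.exists_isTop π hπ
  have hkill : ∀ I : Ideal D.Am,
      (∀ x : D.L0 𝔥, (x : D.L) ∈ D.L0Ideal 𝔥 I → ∀ v : N, ⁅x, v⁆ = 0) ↔
      ∀ x ∈ D.L0Ideal 𝔥 I, ∀ v ∈ LinearMap.range j, ⁅x, v⁆ = 0 := by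
    refine fun I => ⟨?_, fun h x hx v => hj ?_⟩
    · rintro h x hx _ ⟨v, rfl⟩
      have h1 := hj0 ⟨x, D.L0Ideal_le_L0 I hx⟩ v
      rwa [h ⟨x, D.L0Ideal_le_L0 I hx⟩ hx v, map_zero] at h1
    · rw [← hj0, map_zero]
      exact h x hx _ ⟨v, rfl⟩
  refine ⟨?_, fun P hP hPN => ?_⟩
  · obtain ⟨P, hP, h⟩ := hT.exists_idealOf hD hV.1
    refine ⟨P, hP, D.finiteDimensional_quotient_idealOf fun i h0 => ?_, (hkill _).2 h⟩
    have := hP i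
    rw [h0, Polynomial.coeff_zero] at this
    exact zero_ne_one this
  · have hle : D.idealOf (fun i => LieTorus.squarefreePart (P i)) ≤ (D.idealOf P).radical := by
      refine Ideal.span_le.2 ?_
      rintro _ ⟨i, rfl⟩
      obtain ⟨r, hr⟩ := LieTorus.exists_dvd_squarefreePart_pow (P := P i)
        fun h0 => hP i (by rw [h0, Polynomial.coeff_zero])
      refine ⟨r, ?_⟩
      change Polynomial.aeval (D.powVar i) (LieTorus.squarefreePart (P i)) ^ r ∈ _
      rw [← map_pow]
      exact Ideal.mem_of_dvd _ (map_dvd _ hr) (Ideal.subset_span ⟨i, rfl⟩)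
    have hfg : (D.idealOf fun i => LieTorus.squarefreePart (P i)).FG :=
      Submodule.fg_span (Set.finite_range _)
    have hzero := hT.idealL_lie_eq_zero hD hV.1
      (hT.lie_eq_zero_of_le_radical hD hV ((hkill _).1 hPN) hle hfg)
    exact ⟨hzero, LieTorus.exists_lieModule_quotient _ hzero⟩
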